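/- **Conventions.** Let $\mathcal X$ be an instance space and $\mathcal C\subseteq\{0,1\}^{\mathcal X}$ a concept class with finite VC dimension $d$. The dual VC dimension $d^*$ of $\mathcal C$ is the VC dimension of the class of functions $f\mapsto f(x)$ on $\mathcal C$, $x\in\mathcal X$; assume $d^*\ge 1$ (some concept is not constant). Let $\mathcal A$ be a deterministic learner, mapping finite labelled samples to functions $\mathcal X\to\{0,1\}$, which on samples labelled by some $f^*\in\mathcal C$ is proper (its output $\hat f$ lies in $\mathcal C$), consistent ($\hat f$ agrees with $f^*$ on the sample), and a PAC learner: there is a function $m_{\mathcal C}$ such that for all $0<\varepsilon,\delta<1/2$, all $f^*\in\mathcal C$, all distributions $D$ on $\mathcal X$ and all $m\ge m_{\mathcal C}(\varepsilon,\delta)$, the output $\hat f$ of $\mathcal A$ on $m$ points $S$ drawn i.i.d. from $D$ and labelled by $f^*$ satisfies $$\mathbb P_{S\sim D^m}\big(\mathbb P_{X\sim D}(\hat f(X)\ne f^*(X)\mid S)>\varepsilon\big)<\delta .$$ A *randomized sample compression scheme of size $s$* for $\mathcal C$ consists of a random map $\kappa$, which sends a nonempty finite labelled sample to a finite sequence of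 at most $k'$ labelled points of that sample together with a string of at most $k''$ bits, where $k'+k''\le s$, and a deterministic map $\rho$ from such pairs to $\{0,1\}^{\mathcal X}$, such that for every $h\in\mathcal C$ and every sample $S=((x_1,h(x_1)),\dots,(x_m,h(x_m)))$, $m\ge1$, with probability one $\rho(\kappa(S))(x_i)=h(x_i)$ for all $i\le m$. Running time is counted on a randomized word RAM whose words are the nonnegative integers below a fixed power of $m+d+d^*+1$, with unit-cost arithmetic on words, memory access, access to a sample point by its index, and drawing of uniformly random integers below a given word. The machine is given $m,d,d^*$ and black-box access to $\mathcal A$: a call of $\mathcal A$ on $\ell$ sample points costs $1+\ell+T_{\mathcal A}(\ell)$, and one evaluation of a hypothesis learned from $\ell$ points at a sample point costs $1+T_{\mathcal E}(\ell)$. Here $T_{\mathcal A}(\ell)\ge1$ is the runtime of $\mathcal A$ on samples of size $\ell$ and $T_{\mathcal E}(\ell)\ge1$ the time to evaluate such an $\hat f$ at one point. **Theorem (Efficient compression for classification).** There are universal constants $c,c_1,c_2,c_3$ and a single randomized program such that for all $\mathcal X$, $\mathcal C$, $d$, $d^*$, $\mathcal A$ as above there is a randomized sample compression scheme $(\kappa,\rho)$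 for $\mathcal C$ of size at most $c_2\,k\log k$, where $k=c_1\,d\,d^*$, with the following property. For all $m\ge1$ and all samples $S$ of size $m$ labelled by a concept of $\mathcal C$, the program halts on $S$ with probability one, its output has the distribution of $\kappa(S)$, and its expected running time is at most $$c_3\Big(\big(m+T_{\mathcal A}(cd)\big)\log m+m\,T_{\mathcal E}(cd)\,\big(d^*+\log m\big)\Big).$$ -/

import Mathlib

open scoped ENNReal

noncomputable section

/-! ### VC dimension and dual VC dimension -/

/-- The class `C` realizes every 0/1 labelling of the finite set `s`. -/
def Shatters {X : Type*} (C : Set (X → Bool)) (s : Finset X) : Prop :=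
  ∀ g : X → Bool, ∃ f ∈ C, ∀ x ∈ s, f x = g x

/-- Size of the largest shattered set, `⊤` if there are shattered sets of arbitrary size. -/
def vcDim {X : Type*} (C : Set (X → Bool)) : ℕ∞ :=
  ⨆ (s : Finset X) (_ : Shatters C s), (s.card : ℕ∞)

/-- The dual class: the points of `X`, acting on the concepts by `x(f) = f(x)`. -/
def dualClass {X : Type*} (C : Set (X → Bool)) : Set (C → Bool) :=
  Set.range fun (x : X) (f : C) => f.1 x

/-! ### Learners -/

/-- A learner maps labelled samples to hypotheses. -/
abbrev Learner (X : Type*) := List (X × Bool) → X → Bool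

/-- The points of `xs`, labelled by `f`. -/
def labelled {X : Type*} (f : X → Bool) (xs : List X) : List (X × Bool) :=
  xs.map fun x => (x, f x)

/-- On samples labelled by a concept, the learner outputs a concept. -/
def Learner.Proper {X : Type*} (A : Learner X) (C : Set (X → Bool)) : Prop :=
  ∀ f ∈ C, ∀ xs : List X, A (labelled f xs) ∈ C

/-- On samples labelled by a concept, the output of the learner agrees with the labels. -/
def Learner.Consistent {X : Type*} (A : Learner X) (C : Set (X → Bool)) : Prop :=
  ∀ f ∈ C, ∀ xs : List X, ∀ x ∈ xs, A (labelled f xs) x = f x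

/-- Distribution-free PAC learning of `C` with some sample complexity `mC ε δ`. -/
def Learner.PAC {X : Type*} [MeasurableSpace X] (A : Learner X) (C : Set (X → Bool)) : Prop :=
  ∃ mC : ℝ → ℝ → ℕ, ∀ ε δ : ℝ, 0 < ε → ε < 1 / 2 → 0 < δ → δ < 1 / 2 →
    ∀ f ∈ C, ∀ D : MeasureTheory.Measure X, MeasureTheory.IsProbabilityMeasure D →
      ∀ m : ℕ, mC ε δ ≤ m →
        MeasureTheory.Measure.pi (fun _ : Fin m => D)
          {S : Fin m → X | ENNReal.ofReal ε < D {x | A (labelled f (List.ofFn S)) x ≠ f x}}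
          < ENNReal.ofReal δ

/-! ### Randomized sample compression schemes -/

/-- A compressed sample: a finite sequence of labelled points and a finite string of bits. -/
abbrev Compressed (X : Type*) := List (X × Bool) × List Bool

/-- `(κ, ρ)` is a randomized sample compression scheme of size `s` for `C`.  The compression is
random, the reconstruction is not.  The points that are kept come from the sample, their number
plus the number of bits is bounded by `s`, and with probability one the reconstruction agrees with
every label of a sample that is labelled by a concept. -/
def IsRandomizedCompressionScheme {X : Type*} (C : Set (X → Bool)) (s : ℕ)
    (κ : List (X × Bool) → PMF (Compressed X)) (ρ : Compressed X → X → Bool) : Prop :=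
  (∃ k' k'' : ℕ, k' + k'' ≤ s ∧
    ∀ S : List (X × Bool), S ≠ [] → ∀ z ∈ (κ S).support,
      z.1 ⊆ S ∧ z.1.length ≤ k' ∧ z.2.length ≤ k'') ∧
  ∀ f ∈ C, ∀ xs : List X, xs ≠ [] → ∀ z ∈ (κ (labelled f xs)).support, ∀ x ∈ xs, ρ z x = f x

/-! ### Randomized word-RAM programs with black-box access to a learner

A program manipulates machine words (integers below a bound `B`), which live in registers and in an
array that is addressed by words.  The sample is a read-only array, whose entries are accessible
through their indices only.  The learner is called on a sequence of sample indices; the hypothesis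
that it returns is stored in a hypothesis slot and can be evaluated at sample points. -/

/-- Elementary instructions; the arguments `r a b h l` are names of registers. -/
inductive Instr
  /-- `reg r := n` -/
  | const (r n : ℕ)
  /-- `reg r := reg a + reg b` -/
  | add (r a b : ℕ)
  /-- `reg r := reg a - reg b`, truncated at `0` -/
  | sub (r a b : ℕ)
  /-- `reg r := reg a * reg b` -/
  | mul (r a b : ℕ)
  /-- `reg r := reg a / reg b`, rounded down -/
  | div (r a b : ℕ)
  /-- `reg r := mem (reg a)` -/
  | load (r a : ℕ)
  /-- `mem (reg a) := reg b` -/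
  | store (a b : ℕ)
  /-- `reg r :=` a fresh uniformly random element of `{0, …, reg a - 1}` -/
  | rand (r a : ℕ)
  /-- `reg r :=` the label of the sample point with index `reg a` -/
  | label (r a : ℕ)
  /-- slot `reg h :=` the output of the learner on the `reg l` sample points whose indices are
  stored in `mem` from address `reg a` on -/
  | learn (h a l : ℕ)
  /-- `reg r :=` the value of the hypothesis in slot `reg h` at the sample point of index `reg a` -/
  | eval (r h a : ℕ)
  /-- append the sample point with index `reg a` to the output -/
  | emitPoint (a : ℕ)
  /-- append the bit `reg a ≠ 0` to the output -/
  | emitBit (a : ℕ)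

/-- Programs; the tests of `ite` and `while` are `reg a ≠ 0`. -/
inductive Prog
  | instr (i : Instr)
  | seq (p q : Prog)
  | ite (a : ℕ) (p q : Prog)
  | while (a : ℕ) (p : Prog)

/-- What a run depends on: the sample, the learner, the running time `TA ℓ` of the learner on
samples of size `ℓ`, the time `TE ℓ` to evaluate once a hypothesis learned from a sample of size
`ℓ`, and the bound `B` on machine words. -/
structure Env (X : Type*) where
  sample : List (X × Bool)
  learner : Learner X
  TA : ℕ → ℕ
  TE : ℕ → ℕ
  B : ℕ

/-- Machine states.  A hypothesis slot holds a hypothesis and the size of its training sample. -/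
structure RamState (X : Type*) where
  reg : ℕ → ℕ
  mem : ℕ → ℕ
  hyp : ℕ → ℕ × (X → Bool)
  outPoints : List (X × Bool)
  outBits : List Bool

namespace RamState

variable {X : Type*}

def setReg (s : RamState X) (r v : ℕ) : RamState X :=
  { s with reg := Function.update s.reg r v }

def output (s : RamState X) : Compressed X := (s.outPoints, s.outBits)

/-- The labelled points whose indices are stored at the addresses `a, …, a + l - 1`. -/
def subsample (E : Env X) (s : RamState X) (a l : ℕ) : List (X × Bool) :=
  (List.range l).filterMap fun j => E.sample[s.mem (a + j)]?

end RamState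

/-- Effect of an instruction.  Arithmetic is modulo `B`.  Reading outside of the sample yields `0`,
and emits nothing. -/
def Instr.exec {X : Type*} (E : Env X) (s : RamState X) : Instr → PMF (RamState X)
  | .const r n => PMF.pure (s.setReg r (n % E.B))
  | .add r a b => PMF.pure (s.setReg r ((s.reg a + s.reg b) % E.B))
  | .sub r a b => PMF.pure (s.setReg r (s.reg a - s.reg b))
  | .mul r a b => PMF.pure (s.setReg r ((s.reg a * s.reg b) % E.B))
  | .div r a b => PMF.pure (s.setReg r (s.reg a / s.reg b))
  | .load r a => PMF.pure (s.setReg r (s.mem (s.reg a)))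
  | .store a b => PMF.pure { s with mem := Function.update s.mem (s.reg a) (s.reg b) }
  | .rand r a =>
      if h : (Finset.range (s.reg a)).Nonempty then
        (PMF.uniformOfFinset (Finset.range (s.reg a)) h).map fun v => s.setReg r v
      else PMF.pure (s.setReg r 0)
  | .label r a =>
      PMF.pure (s.setReg r (((E.sample[s.reg a]?).map fun p => p.2.toNat % E.B).getD 0))
  | .learn h a l =>
      let S := s.subsample E (s.reg a) (s.reg l)
      PMF.pure { s with hyp := Function.update s.hyp (s.reg h) (S.length, E.learner S) }
  | .eval r h a =>
      PMF.pure (s.setReg r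
        (((E.sample[s.reg a]?).map fun p => ((s.hyp (s.reg h)).2 p.1).toNat % E.B).getD 0))
  | .emitPoint a => PMF.pure { s with outPoints := s.outPoints ++ (E.sample[s.reg a]?).toList }
  | .emitBit a => PMF.pure { s with outBits := s.outBits ++ [decide (s.reg a ≠ 0)] }

/-- Time taken by an instruction: one unit, plus the time of the learner and of passing its input
for a call of the learner, plus the evaluation time for an evaluation of a hypothesis. -/
def Instr.time {X : Type*} (E : Env X) (s : RamState X) : Instr → ℕ
  | .learn _ a l => 1 + s.reg l + E.TA (s.subsample E (s.reg a) (s.reg l)).length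
  | .eval _ h _ => 1 + E.TE (s.hyp (s.reg h)).1
  | _ => 1

/-- A configuration: the stack of programs that are still to be run, and the machine state.  The
machine has halted when the stack is empty. -/
structure RamConfig (X : Type*) where
  todo : List Prog
  state : RamState X

namespace RamConfig

variable {X : Type*}

/-- One step of the machine, a Markov kernel on configurations. -/
def step (E : Env X) : RamConfig X → PMF (RamConfig X)
  | ⟨[], s⟩ => PMF.pure ⟨[], s⟩
  | ⟨.instr i :: K, s⟩ => (i.exec E s).map fun s' => ⟨K, s'⟩
  | ⟨.seq p q :: K, s⟩ => PMF.pure ⟨p :: q :: K, s⟩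
  | ⟨.ite a p q :: K, s⟩ => PMF.pure ⟨(if s.reg a ≠ 0 then p else q) :: K, s⟩
  | ⟨.while a p :: K, s⟩ =>
      PMF.pure ⟨if s.reg a ≠ 0 then p :: .while a p :: K else K, s⟩

/-- Time taken by the next step. -/
def time (E : Env X) : RamConfig X → ℕ
  | ⟨[], _⟩ => 0
  | ⟨.instr i :: _, s⟩ => i.time E s
  | ⟨_ :: _, _⟩ => 1

end RamConfig

namespace Prog

variable {X : Type*}

/-- Start: the three input numbers are in the registers `0, 1, 2`, everything else is blank. -/
def init (P : Prog) (n₀ n₁ n₂ : ℕ) : RamConfig X where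
  todo := [P]
  state :=
    { reg := fun r => if r = 0 then n₀ else if r = 1 then n₁ else if r = 2 then n₂ else 0
      mem := fun _ => 0
      hyp := fun _ => (0, fun _ => false)
      outPoints := []
      outBits := [] }

/-- Law of the configuration after `t` steps from `c`. -/
def law (E : Env X) (c : RamConfig X) : ℕ → PMF (RamConfig X)
  | 0 => PMF.pure c
  | t + 1 => (law E c t).bind (RamConfig.step E)

/-- Probability that the machine, started at `c`, eventually halts with output `z`. -/
def outputProb (E : Env X) (c : RamConfig X) (z : Compressed X) : ℝ≥0∞ :=
  ⨆ t, (law E c t).toOuterMeasure {e | e.todo = [] ∧ e.state.output = z}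

/-- Expected total time until the machine, started at `c`, halts. -/
def expectedTime (E : Env X) (c : RamConfig X) : ℝ≥0∞ :=
  ∑' t, ∑' e, law E c t e * (e.time E : ℝ≥0∞)

end Prog

end

/-! ### Expected running time of programs -/

namespace Prog

variable {X : Type*}

/-! The scheme is boosting followed by sparsification of the vote. Each sample point carries a
weight that starts at 1 and doubles whenever the point is misclassified. If every round supplies a
hypothesis of weighted error at most 1/4, the total weight grows by a factor of at most 5/4 per
round, whereas a point misclassified `r` times weighs `2 ^ r`. Comparing the two after `T = 20 *
⌈log₂ m⌉` rounds shows that no sample point is misclassified in more than 3/8 of the rounds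
(`eight_mul_le_of_potential`).

Such hypotheses come from training on only `L = 2 ^ 14 * d` points. Uniform convergence over the
class makes it unlikely that some concept has large error and yet agrees with all drawn labels, so a
proper consistent learner errs on less than 1/8 of the distribution with probability at least 1/2
(`card_large_error_le`). For unit-cost draws, the weights are rounded to a table of at most `2 * m`
indices; error below 1/8 on the table implies weighted error at most 1/4
(`four_mul_weighted_error_le`).

The same uniform convergence in the dual class (`card_bad_votes_le`) thins out the vote: among `n =
2 ^ 14 * dstar` uniformly drawn rounds, with probability at least 1/2, fewer than 3/8 + 1/8 = 1/2
are wrong at any sample point. Both kinds of success can be checked on the sample, so failed draws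
are repeated: the result is always correct, and two attempts suffice on average. The compressed
sample consists of the training sets of the chosen hypotheses, `n * L` points and no bits;
reconstruction retrains and takes the majority. A sample with fewer than `n * L` points is kept
whole. The time is `O(log m)` rounds of cost `O(m + T_A + m T_E)`, plus `O(m n T_E)` for testing
votes.

The machine is analysed by the transformer `ert`. It is a potential that decreases in expectation by
at least the time spent in each step (`time_add_step_le`), so it bounds the expected time; fed with
a continuation that is infinite outside a postcondition, it also excludes wrong outputs. `Hoare` and
`HalfHoare` package this, `HalfHoare.draws` turns counting bounds into probabilities, and
`HalfHoare.retry` treats repeated attempts. -/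

/-- Expected running time of a program followed by a continuation of expected running time `φ`;
the value of a loop is the least solution of its recursive inequality. -/
noncomputable def ert (E : Env X) : Prog → (RamState X → ℝ≥0∞) → RamState X → ℝ≥0∞
  | .instr i, φ => fun s => i.time E s + ∑' s', i.exec E s s' * φ s'
  | .seq p q, φ => fun s => 1 + ert E p (ert E q φ) s
  | .ite a p q, φ => fun s => 1 + if s.reg a ≠ 0 then ert E p φ s else ert E q φ s
  | .while a p, φ => fun s =>
      ⨅ (I : RamState X → ℝ≥0∞)
        (_ : ∀ s, 1 + (if s.reg a ≠ 0 then ert E p I s else φ s) ≤ I s), I s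

theorem ert_mono (E : Env X) (p : Prog) {φ ψ : RamState X → ℝ≥0∞} (h : ∀ s, φ s ≤ ψ s)
    (s : RamState X) : ert E p φ s ≤ ert E p ψ s := by
  induction p generalizing φ ψ s with
  | instr i =>
    simp only [ert]
    gcongr
    exact h _
  | seq p q hp hq =>
    simp only [ert]
    gcongr
    exact hp (hq h) s
  | ite a p q hp hq =>
    simp only [ert]
    gcongr
    split_ifs
    · exact hp h s
    · exact hq h s
  | _ =>
    rename_i a p hp
    simp only [ert]
    refine le_iInf₂ fun I hI => iInf₂_le I fun s => le_trans ?_ (hI s)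
    gcongr
    split_ifs
    · exact le_rfl
    · exact h s

theorem ert_while_le_of_invariant (E : Env X) {a : ℕ} {p : Prog} {φ I : RamState X → ℝ≥0∞}
    (hI : ∀ s, 1 + (if s.reg a ≠ 0 then ert E p I s else φ s) ≤ I s) (s : RamState X) :
    ert E (.while a p) φ s ≤ I s := by
  simp only [ert]
  exact iInf₂_le I hI

theorem le_ert_while (E : Env X) (a : ℕ) (p : Prog) (φ : RamState X → ℝ≥0∞) (s : RamState X) :
    1 + (if s.reg a ≠ 0 then ert E p (ert E (.while a p) φ) s else φ s)
      ≤ ert E (.while a p) φ s := by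
  conv_rhs => simp only [ert]
  refine le_iInf₂ fun I hI => le_trans ?_ (hI s)
  gcongr
  split_ifs
  · exact ert_mono E p (ert_while_le_of_invariant E hI) s
  · exact le_rfl

/-- Knaster–Tarski: unrolling the infimum of all super-solutions once gives again a super-solution,
by monotonicity, so the infimum is a fixed point. -/
theorem ert_while (E : Env X) (a : ℕ) (p : Prog) (φ : RamState X → ℝ≥0∞) (s : RamState X) :
    ert E (.while a p) φ s =
      1 + if s.reg a ≠ 0 then ert E p (ert E (.while a p) φ) s else φ s := by
  refine le_antisymm (ert_while_le_of_invariant E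
    (I := fun s => 1 + if s.reg a ≠ 0 then ert E p (ert E (.while a p) φ) s else φ s)
    (fun s => ?_) s) (le_ert_while E a p φ s)
  gcongr
  split_ifs
  · exact ert_mono E p (le_ert_while E a p φ) s
  · exact le_rfl

/-- Expected running time of a configuration, with continuation `φ`. -/
noncomputable def configErt (E : Env X) (φ : RamState X → ℝ≥0∞) (e : RamConfig X) : ℝ≥0∞ :=
  e.todo.foldr (fun p ψ => ert E p ψ) φ e.state

theorem tsum_pure_mul {α : Type*} (a : α) (g : α → ℝ≥0∞) : ∑' b, PMF.pure a b * g b = g a := by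
  rw [tsum_eq_single a]
  · simp
  · intro b hb
    simp [hb]

theorem tsum_bind_mul {α β : Type*} (p : PMF α) (q : α → PMF β) (g : β → ℝ≥0∞) :
    ∑' b, p.bind q b * g b = ∑' a, p a * ∑' b, q a b * g b := by
  simp only [PMF.bind_apply, ← ENNReal.tsum_mul_right, ← ENNReal.tsum_mul_left, mul_assoc]
  rw [ENNReal.tsum_comm]

theorem tsum_map_mul {α β : Type*} (p : PMF α) (f : α → β) (g : β → ℝ≥0∞) :
    ∑' b, p.map f b * g b = ∑' a, p a * g (f a) := by
  rw [← PMF.bind_pure_comp, tsum_bind_mul]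
  simp only [Function.comp_apply, tsum_pure_mul]

/-- The supermartingale property behind all time bounds: in each step the potential `configErt` pays
for the time of that step and for the expected potential afterwards. -/
theorem time_add_step_le (E : Env X) (φ : RamState X → ℝ≥0∞) (e : RamConfig X) :
    (e.time E : ℝ≥0∞) + ∑' e', RamConfig.step E e e' * configErt E φ e' ≤ configErt E φ e := by
  obtain ⟨K, s⟩ := e
  match K with
  | [] => simp [RamConfig.time, RamConfig.step]
  | .instr i :: K =>
    simp only [RamConfig.time, RamConfig.step, tsum_map_mul, configErt, ert, List.foldr, le_refl]
  | .seq p q :: K =>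
    simp [RamConfig.time, RamConfig.step, configErt, ert]
  | .ite a p q :: K =>
    simp only [RamConfig.time, RamConfig.step, tsum_pure_mul, configErt, ert, List.foldr]
    split_ifs <;> simp
  | .while a p :: K =>
    simp only [RamConfig.time, RamConfig.step, tsum_pure_mul, configErt, List.foldr]
    rw [ert_while E a p]
    split_ifs <;> simp

/-- Telescoping of `time_add_step_le`. The leftover potential is kept on the left because it detects
reachable states where `φ` is infinite. -/
theorem sum_time_add_law_le (E : Env X) (φ : RamState X → ℝ≥0∞) (c : RamConfig X) (n : ℕ) :
    (∑ t ∈ Finset.range n, ∑' e, law E c t e * (e.time E : ℝ≥0∞))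
      + ∑' e, law E c n e * configErt E φ e ≤ configErt E φ c := by
  induction n with
  | zero => simp [law]
  | succ n ih =>
    refine le_trans ?_ ih
    rw [Finset.sum_range_succ, add_assoc]
    gcongr
    rw [law, tsum_bind_mul, ← ENNReal.tsum_add]
    gcongr with e
    rw [← mul_add]
    gcongr
    exact time_add_step_le E φ e

theorem expectedTime_le (E : Env X) (φ : RamState X → ℝ≥0∞) (c : RamConfig X) :
    expectedTime E c ≤ configErt E φ c := by
  rw [expectedTime, ENNReal.tsum_eq_iSup_nat]
  exact iSup_le fun n => le_trans le_self_add (sum_time_add_law_le E φ c n)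

/-- Every reachable final state satisfies `Q` if the expected running time is finite for a
continuation that diverges outside of `Q`. -/
theorem of_mem_support_law (E : Env X) {φ : RamState X → ℝ≥0∞} {Q : RamState X → Prop}
    (hφ : ∀ s, φ s ≠ ⊤ → Q s) {c : RamConfig X} (hc : configErt E φ c ≠ ⊤) {n : ℕ}
    {e : RamConfig X} (he : law E c n e ≠ 0) (hh : e.todo = []) : Q e.state := by
  apply hφ
  intro htop
  apply hc
  rw [eq_top_iff]
  refine le_trans ?_ (le_trans le_add_self (sum_time_add_law_le E φ c n))
  refine le_trans ?_ (ENNReal.le_tsum e)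
  have : configErt E φ e = ⊤ := by simp [configErt, hh, htop]
  rw [this, ENNReal.mul_top he]

/-! ### Almost sure termination and the output distribution -/

theorem one_le_time (E : Env X) (e : RamConfig X) (h : e.todo ≠ []) : 1 ≤ e.time E := by
  obtain ⟨K, s⟩ := e
  match K with
  | [] => exact absurd rfl h
  | .instr i :: K => cases i <;> simp [RamConfig.time, Instr.time, add_assoc]
  | .seq p q :: K => exact le_rfl
  | .ite a p q :: K => exact le_rfl
  | .while a p :: K => exact le_rfl

theorem tendsto_running_prob (E : Env X) {c : RamConfig X} (hc : expectedTime E c ≠ ⊤) :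
    Filter.Tendsto (fun t => (law E c t).toOuterMeasure {e | e.todo ≠ []}) Filter.atTop
      (nhds 0) := by
  refine ENNReal.tendsto_atTop_zero_of_tsum_ne_top (ne_top_of_le_ne_top hc ?_)
  rw [expectedTime]
  gcongr with t
  rw [PMF.toOuterMeasure_apply]
  gcongr with e
  by_cases h : e.todo ≠ []
  · rw [Set.indicator_of_mem (show e ∈ {e : RamConfig X | e.todo ≠ []} from h)]
    have := one_le_time E e h
    calc law E c t e = law E c t e * 1 := (mul_one _).symm
      _ ≤ _ := by gcongr; exact_mod_cast this
  · rw [Set.indicator_of_notMem (show e ∉ {e : RamConfig X | e.todo ≠ []} from h)]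
    exact zero_le

/-- Halted configurations are fixed by `step`, so halted mass is never lost. Hence the supremum in
`outputProb` is a limit. -/
theorem toOuterMeasure_halted_mono (E : Env X) (c : RamConfig X) (z : Compressed X) :
    Monotone fun t => (law E c t).toOuterMeasure {e | e.todo = [] ∧ e.state.output = z} := by
  refine monotone_nat_of_le_succ fun t => ?_
  simp only [law, PMF.toOuterMeasure_bind_apply]
  rw [PMF.toOuterMeasure_apply]
  gcongr with e
  by_cases h : e ∈ {e : RamConfig X | e.todo = [] ∧ e.state.output = z}
  · rw [Set.indicator_of_mem h]
    obtain ⟨K, s⟩ := e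
    obtain ⟨rfl, hz⟩ := h
    have : RamConfig.step E ⟨[], s⟩ = PMF.pure ⟨[], s⟩ := rfl
    simp only at hz
    simp [this, PMF.toOuterMeasure_pure_apply, hz]
  · rw [Set.indicator_of_notMem h]
    exact zero_le

/-- At each time the halted mass, split by output, and the running mass add up to one. The running
mass tends to zero because every running step costs at least one unit; monotonicity in time allows
the exchange of supremum and sum. -/
theorem tsum_outputProb (E : Env X) {c : RamConfig X} (hc : expectedTime E c ≠ ⊤) :
    ∑' z, outputProb E c z = 1 := by
  have hsum (t : ℕ) :
      (∑' z, (law E c t).toOuterMeasure {e | e.todo = [] ∧ e.state.output = z})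
        + (law E c t).toOuterMeasure {e | e.todo ≠ []} = 1 := by
    simp only [PMF.toOuterMeasure_apply]
    rw [ENNReal.tsum_comm, ← ENNReal.tsum_add, ← (law E c t).tsum_coe]
    congr 1
    ext e
    by_cases h : e.todo = []
    · rw [tsum_eq_single e.state.output]
      · simp [Set.indicator, h]
      · intro z hz
        simp [Set.indicator, h, hz.symm]
    · simp [Set.indicator, h]
  have hlim : Filter.Tendsto (fun t =>
      ∑' z, (law E c t).toOuterMeasure {e | e.todo = [] ∧ e.state.output = z}) Filter.atTop
      (nhds 1) := by
    have heq : (fun t => ∑' z, (law E c t).toOuterMeasure {e | e.todo = [] ∧ e.state.output = z})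
        = fun t => 1 - (law E c t).toOuterMeasure {e | e.todo ≠ []} := by
      ext t
      rw [← hsum t, ENNReal.add_sub_cancel_right]
      refine ne_top_of_le_ne_top ENNReal.one_ne_top ?_
      rw [← hsum t]
      exact le_add_self
    rw [heq]
    have := ENNReal.Tendsto.sub (tendsto_const_nhds (x := (1 : ℝ≥0∞)))
      (tendsto_running_prob E hc) (Or.inl ENNReal.one_ne_top)
    simpa using this
  have hmono : Monotone fun t =>
      ∑' z, (law E c t).toOuterMeasure {e | e.todo = [] ∧ e.state.output = z} :=
    fun a b hab => ENNReal.tsum_le_tsum fun z => toOuterMeasure_halted_mono E c z hab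
  have := tendsto_nhds_unique (tendsto_atTop_iSup hmono) hlim
  rw [← this]
  simp only [outputProb, ENNReal.tsum_eq_iSup_sum]
  rw [iSup_comm]
  refine iSup_congr fun F => ?_
  exact ENNReal.finsetSum_iSup_of_monotone fun z => toOuterMeasure_halted_mono E c z

/-- Costs do not influence transitions. This is what allows the compression map to be fixed before
the running times `TA` and `TE` are given. -/
theorem law_congr_time (S : List (X × Bool)) (A : Learner X) (TA TE TA' TE' : ℕ → ℕ) (B : ℕ)
    (c : RamConfig X) (t : ℕ) : law ⟨S, A, TA, TE, B⟩ c t = law ⟨S, A, TA', TE', B⟩ c t := by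
  induction t with
  | zero => rfl
  | succ t ih =>
    rw [law, law, ih]
    congr 1

theorem outputProb_congr_time (S : List (X × Bool)) (A : Learner X) (TA TE TA' TE' : ℕ → ℕ)
    (B : ℕ) (c : RamConfig X) (z : Compressed X) :
    outputProb ⟨S, A, TA, TE, B⟩ c z = outputProb ⟨S, A, TA', TE', B⟩ c z := by
  simp only [outputProb, law_congr_time S A TA TE TA' TE' B c]

theorem exists_law_of_outputProb_ne_zero (E : Env X) {c : RamConfig X} {z : Compressed X}
    (h : outputProb E c z ≠ 0) :
    ∃ t e, law E c t e ≠ 0 ∧ e.todo = [] ∧ e.state.output = z := by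
  by_contra! hcon
  apply h
  simp only [outputProb, PMF.toOuterMeasure_apply, ENNReal.iSup_eq_zero, ENNReal.tsum_eq_zero]
  intro t e
  rw [Set.indicator_apply_eq_zero]
  rintro ⟨h1, h2⟩
  by_contra h3
  exact hcon t e h3 h1 h2

end Prog

/-! ### Uniform deviations -/

open Classical in
/-- Hoeffding's inequality for signed sums, as a count of sign patterns. -/
theorem card_signed_sum_ge_le (n : ℕ) (a : Fin n → ℝ) (ha : ∀ j, |a j| ≤ 1) :
    ((Finset.univ.filter fun σ : Fin n → Bool =>
      (n : ℝ) / 16 ≤ ∑ j, if σ j then -a j else a j).card : ℝ)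
      ≤ 2 ^ n * Real.exp (-(n : ℝ) / 512) := by
  -- Chernoff's method with exponent 1/16: `cosh t ≤ exp (t ^ 2 / 2)` bounds the moment by `exp (n /
  -- 512)`, against `exp (n / 256)` from the threshold `n / 16` in `h6`.
  have h1 : ∑ σ : Fin n → Bool, Real.exp (1 / 16 * ∑ j, if σ j then -a j else a j)
      ≤ 2 ^ n * Real.exp ((n : ℝ) / 512) := by
    have h2 : ∀ σ : Fin n → Bool, Real.exp (1 / 16 * ∑ j, if σ j then -a j else a j)
        = ∏ j, Real.exp (1 / 16 * if σ j then -a j else a j) := by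
      intro σ
      rw [Finset.mul_sum, Real.exp_sum]
    have h3 := Finset.prod_univ_sum (R := ℝ) (fun _ : Fin n => (Finset.univ : Finset Bool))
      (fun j b => Real.exp (1 / 16 * if b then -a j else a j))
    rw [Fintype.piFinset_univ] at h3
    simp only [h2]
    rw [← h3]
    calc ∏ j, ∑ b : Bool, Real.exp (1 / 16 * if b then -a j else a j)
        ≤ ∏ _j : Fin n, 2 * Real.exp (1 / 512) := by
          refine Finset.prod_le_prod (fun j _ => by positivity) fun j _ => ?_
          have h4 := Real.cosh_le_exp_half_sq (1 / 16 * a j)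
          rw [Real.cosh_eq] at h4
          have h5 : Real.exp ((1 / 16 * a j) ^ 2 / 2) ≤ Real.exp (1 / 512) := by
            apply Real.exp_le_exp.2
            have := (sq_le_one_iff_abs_le_one (a j)).2 (ha j)
            nlinarith
          simp only [Fintype.sum_bool, if_true, Bool.false_eq_true, if_false]
          rw [show 1 / 16 * -a j = -(1 / 16 * a j) by ring]
          linarith
      _ = 2 ^ n * Real.exp ((n : ℝ) / 512) := by
          rw [Finset.prod_const, mul_pow, ← Real.exp_nat_mul]
          simp [div_eq_mul_inv]
  have h6 : ((Finset.univ.filter fun σ : Fin n → Bool =>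
      (n : ℝ) / 16 ≤ ∑ j, if σ j then -a j else a j).card : ℝ) * Real.exp ((n : ℝ) / 256)
      ≤ ∑ σ : Fin n → Bool, Real.exp (1 / 16 * ∑ j, if σ j then -a j else a j) := by
    rw [← nsmul_eq_mul]
    refine le_trans (Finset.card_nsmul_le_sum _
      (fun σ : Fin n → Bool => Real.exp (1 / 16 * ∑ j, if σ j then -a j else a j)) _ ?_) ?_
    · intro σ hσ
      apply Real.exp_le_exp.2
      have := (Finset.mem_filter.1 hσ).2
      linarith
    · exact Finset.sum_le_sum_of_subset_of_nonneg (Finset.filter_subset _ _)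
        fun _ _ _ => by positivity
  have h7 : Real.exp ((n : ℝ) / 512) = Real.exp (-(n : ℝ) / 512) * Real.exp ((n : ℝ) / 256) := by
    rw [← Real.exp_add]
    congr 1
    ring
  have h8 := le_trans h6 h1
  rw [h7, ← mul_assoc] at h8
  exact le_of_mul_le_mul_right h8 (by positivity)

open Classical in
-- Linearity of expectation: each coordinate of a uniform tuple is uniform. Multiplying by the size
-- of `Ω` avoids division.
theorem sum_card_filter_apply {Ω : Type*} [Fintype Ω] (f : Ω → Bool) (n : ℕ) :
    (Fintype.card Ω) * ∑ ω : Fin n → Ω, (Finset.univ.filter fun j => f (ω j) = true).card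
      = n * (Finset.univ.filter fun a => f a = true).card * Fintype.card Ω ^ n := by
  have h (j : Fin n) : Fintype.card Ω *
      (Finset.univ.filter fun ω : Fin n → Ω => f (ω j) = true).card
      = (Finset.univ.filter fun a => f a = true).card * Fintype.card Ω ^ n := by
    have h1 : (Finset.univ.filter fun ω : Fin n → Ω => f (ω j) = true)
        = Fintype.piFinset (Function.update (fun _ => Finset.univ) j
            (Finset.univ.filter fun a => f a = true)) := by
      ext ω
      simp only [Finset.mem_filter, Finset.mem_univ, true_and, Fintype.mem_piFinset]
      constructor
      · intro h k
        by_cases hk : k = j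
        · subst hk
          simpa using h
        · simp [hk]
      · intro h
        simpa using h j
    rw [h1, Fintype.card_piFinset]
    have h2 : ∀ k, (Function.update (fun _ => Finset.univ) j
        (Finset.univ.filter fun a => f a = true) k : Finset Ω).card
        = Function.update (fun _ => Fintype.card Ω) j
          (Finset.univ.filter fun a => f a = true).card k := by
      intro k
      by_cases hk : k = j
      · subst hk
        simp
      · simp [hk, Finset.card_univ]
    simp only [h2]
    rw [Finset.prod_update_of_mem (Finset.mem_univ j), Finset.prod_const, mul_left_comm,
      ← pow_succ', Finset.card_sdiff_of_subset (Finset.subset_univ _), Finset.card_univ,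
      Fintype.card_fin, Finset.card_singleton, Nat.sub_add_cancel (Fin.pos j)]
  calc (Fintype.card Ω) * ∑ ω : Fin n → Ω, (Finset.univ.filter fun j => f (ω j) = true).card
      = ∑ j : Fin n, Fintype.card Ω *
          (Finset.univ.filter fun ω : Fin n → Ω => f (ω j) = true).card := by
        rw [← Finset.mul_sum]
        congr 1
        simp only [Finset.card_filter]
        rw [Finset.sum_comm]
    _ = _ := by
        simp only [h, Finset.sum_const, Finset.card_univ, Fintype.card_fin, smul_eq_mul, mul_assoc]

open Classical in
/-- A Markov bound: with probability at least `1/15`, an empirical frequency exceeds the true one by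
less than `1/16`. -/
theorem card_le_card_frequency_lt {Ω : Type*} [Fintype Ω] [Nonempty Ω] (f : Ω → Bool) (n : ℕ)
    (hn : 0 < n)
    (hf : ((Finset.univ.filter fun a => f a = true).card : ℝ) / Fintype.card Ω ≤ 7 / 8) :
    (Fintype.card Ω : ℝ) ^ n ≤ 15 * ((Finset.univ.filter fun ω : Fin n → Ω =>
      ((Finset.univ.filter fun j => f (ω j) = true).card : ℝ)
        < (((Finset.univ.filter fun a => f a = true).card : ℝ) / Fintype.card Ω + 1 / 16) * n
      ).card : ℝ) := by
  set p : ℝ := ((Finset.univ.filter fun a => f a = true).card : ℝ) / Fintype.card Ω with hp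
  set cnt : (Fin n → Ω) → ℝ := fun ω => ((Finset.univ.filter fun j => f (ω j) = true).card : ℝ)
  have hN : (0 : ℝ) < Fintype.card Ω := by exact_mod_cast Fintype.card_pos
  have hp0 : 0 ≤ p := by positivity
  have hn' : (0 : ℝ) < n := by exact_mod_cast hn
  have hsum : ∑ ω : Fin n → Ω, cnt ω = n * p * (Fintype.card Ω : ℝ) ^ n := by
    have := sum_card_filter_apply f n
    have h2 : (Fintype.card Ω : ℝ) * ∑ ω : Fin n → Ω, cnt ω
        = n * ((Finset.univ.filter fun a => f a = true).card : ℝ) * (Fintype.card Ω : ℝ) ^ n := by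
      simp only [cnt]
      exact_mod_cast this
    rw [hp]
    field_simp
    linarith
  have hsplit := Finset.card_filter_add_card_filter_not (s := (Finset.univ : Finset (Fin n → Ω)))
    (fun ω => cnt ω < (p + 1 / 16) * n)
  rw [Finset.card_univ, Fintype.card_fun, Fintype.card_fin] at hsplit
  have hsplit' : ((Finset.univ.filter fun ω => cnt ω < (p + 1 / 16) * n).card : ℝ)
      + ((Finset.univ.filter fun ω => ¬ cnt ω < (p + 1 / 16) * n).card : ℝ)
      = (Fintype.card Ω : ℝ) ^ n := by exact_mod_cast hsplit
  have hm : ((Finset.univ.filter fun ω => ¬ cnt ω < (p + 1 / 16) * n).card : ℝ)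
      * ((p + 1 / 16) * n) ≤ ∑ ω : Fin n → Ω, cnt ω := by
    rw [← nsmul_eq_mul]
    refine le_trans (Finset.card_nsmul_le_sum _ cnt _ ?_) ?_
    · intro ω hω
      exact not_lt.1 (Finset.mem_filter.1 hω).2
    · exact Finset.sum_le_sum_of_subset_of_nonneg (Finset.filter_subset _ _)
        fun _ _ _ => by positivity
  rw [hsum] at hm
  set b : ℝ := ((Finset.univ.filter fun ω => ¬ cnt ω < (p + 1 / 16) * n).card : ℝ)
  set N : ℝ := (Fintype.card Ω : ℝ) ^ n
  have hN0 : 0 ≤ N := by positivity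
  have hb : b * (p + 1 / 16) ≤ p * N := by
    have : (b * (p + 1 / 16)) * n ≤ (p * N) * n := by linarith
    exact le_of_mul_le_mul_right this hn'
  -- The ratio `p / (p + 1/16)` is increasing in `p` and equals 14/15 at `p = 7/8`.
  have hbN : b ≤ 14 / 15 * N := by
    by_contra! hcon
    nlinarith
  linarith

theorem card_filter_exists_le {α β : Type*} [Fintype α] (P : β → α → Prop)
    [∀ b, DecidablePred (P b)] (s : Finset β) [DecidablePred fun a => ∃ b ∈ s, P b a] :
    (Finset.univ.filter fun a => ∃ b ∈ s, P b a).card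
      ≤ ∑ b ∈ s, (Finset.univ.filter (P b)).card := by
  classical
  refine le_trans (Finset.card_le_card ?_) (Finset.card_biUnion_le (s := s))
  intro a ha
  simpa using ha

open Classical in
/-- Uniform one-sided deviation bound for a family with few traces on double samples. -/
theorem card_deviation_le {Ω ι : Type*} [Fintype Ω] [Nonempty Ω] (F : ι → Ω → Bool) (n G : ℕ)
    (hn : 0 < n)
    (hG : ∀ z : Fin n × Bool → Ω, (Set.range fun i => fun j => F i (z j)).ncard ≤ G) :
    ((Finset.univ.filter fun ω : Fin n → Ω => ∃ i,
      (((Finset.univ.filter fun a => F i a = true).card : ℝ) / Fintype.card Ω + 1 / 8) * n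
        ≤ ((Finset.univ.filter fun j => F i (ω j) = true).card : ℝ)).card : ℝ)
      ≤ 15 * (G * Real.exp (-(n : ℝ) / 512)) * (Fintype.card Ω : ℝ) ^ n := by
  set p : ι → ℝ := fun i =>
    ((Finset.univ.filter fun a => F i a = true).card : ℝ) / Fintype.card Ω with hp
  set N : ℝ := (Fintype.card Ω : ℝ) ^ n with hN
  have hNpos : 0 < N := by
    have : (0 : ℝ) < Fintype.card Ω := by exact_mod_cast Fintype.card_pos
    positivity
  have hn' : (0 : ℝ) < n := by exact_mod_cast hn
  let cnt : ι → (Fin n → Ω) → ℝ := fun i ω =>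
    ((Finset.univ.filter fun j => F i (ω j) = true).card : ℝ)
  set bad : Finset (Fin n → Ω) :=
    Finset.univ.filter fun ω => ∃ i, (p i + 1 / 8) * n ≤ cnt i ω with hbad
  let dev : (Fin n → Bool) → (Fin n → Bool) → ℝ := fun u v =>
    ∑ j, ((if u j then (1 : ℝ) else 0) - if v j then (1 : ℝ) else 0)
  have hcnt : ∀ i ω ω', cnt i ω - cnt i ω' = dev (fun j => F i (ω j)) (fun j => F i (ω' j)) := by
    intro i ω ω'
    simp only [cnt, dev, Finset.sum_sub_distrib, Finset.card_filter]
    push_cast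
    rfl
  let joint : Finset ((Fin n → Ω) × (Fin n → Ω)) := Finset.univ.filter fun w =>
    ∃ i, (n : ℝ) / 16 ≤ dev (fun j => F i (w.1 j)) (fun j => F i (w.2 j))
  -- the second sample exposes a bad first sample
  have hghost : (bad.card : ℝ) * N ≤ 15 * (joint.card : ℝ) := by
    have h1 : ∀ ω ∈ bad, N / 15 ≤
        ((Finset.univ.filter fun ω' : Fin n → Ω => (ω, ω') ∈ joint).card : ℝ) := by
      intro ω hω
      obtain ⟨i, hi⟩ := (Finset.mem_filter.1 hω).2
      have hle : cnt i ω ≤ n := by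
        have := Finset.card_filter_le (Finset.univ : Finset (Fin n)) (fun j => F i (ω j) = true)
        rw [Finset.card_univ, Fintype.card_fin] at this
        simp only [cnt]
        exact_mod_cast this
      -- An empirical frequency is at most one, so an excess of 1/8 forces `p i ≤ 7 / 8`, as the
      -- Markov bound requires.
      have hp78 : p i ≤ 7 / 8 := by
        have : (p i + 1 / 8) * n ≤ 1 * n := by linarith
        have := le_of_mul_le_mul_right this hn'
        linarith
      have h2 := card_le_card_frequency_lt (F i) n hn hp78
      have h3 : (Finset.univ.filter fun ω' : Fin n → Ω => cnt i ω' < (p i + 1 / 16) * n)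
          ⊆ Finset.univ.filter fun ω' : Fin n → Ω => (ω, ω') ∈ joint := by
        intro ω' hω'
        have h4 := (Finset.mem_filter.1 hω').2
        simp only [Finset.mem_filter, Finset.mem_univ, true_and, joint]
        refine ⟨i, ?_⟩
        rw [← hcnt]
        linarith
      have h5 : ((Finset.univ.filter fun ω' : Fin n → Ω => cnt i ω' < (p i + 1 / 16) * n).card : ℝ)
          ≤ ((Finset.univ.filter fun ω' : Fin n → Ω => (ω, ω') ∈ joint).card : ℝ) := by
        exact_mod_cast Finset.card_le_card h3
      have h6 : N ≤ 15 * ((Finset.univ.filter fun ω' : Fin n → Ω =>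
        cnt i ω' < (p i + 1 / 16) * n).card : ℝ) := h2
      linarith
    have h7 : joint.card = ∑ ω : Fin n → Ω,
        (Finset.univ.filter fun ω' : Fin n → Ω => (ω, ω') ∈ joint).card := by
      simp only [Finset.card_filter]
      rw [← Fintype.sum_prod_type (f := fun w => if w ∈ joint then 1 else 0)]
      simp
    have h8 : (bad.card : ℝ) * (N / 15) ≤ ∑ ω ∈ bad,
        ((Finset.univ.filter fun ω' : Fin n → Ω => (ω, ω') ∈ joint).card : ℝ) := by
      rw [← nsmul_eq_mul]
      exact Finset.card_nsmul_le_sum _ _ _ h1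
    have h9 : ∑ ω ∈ bad, ((Finset.univ.filter fun ω' : Fin n → Ω => (ω, ω') ∈ joint).card : ℝ)
        ≤ (joint.card : ℝ) := by
      rw [h7]
      push_cast
      exact Finset.sum_le_sum_of_subset_of_nonneg (Finset.subset_univ _)
        fun _ _ _ => by positivity
    linarith
  -- swapping the two samples
  let swap : (Fin n → Bool) → (Fin n → Ω) × (Fin n → Ω) → (Fin n → Ω) × (Fin n → Ω) :=
    fun σ w => (fun j => if σ j then w.2 j else w.1 j, fun j => if σ j then w.1 j else w.2 j)
  have hswap : ∀ σ, Function.Involutive (swap σ) := by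
    intro σ w
    refine Prod.ext ?_ ?_ <;>
    · funext j
      by_cases h : σ j <;> simp [swap, h]
  have hinv : ∀ σ, (Finset.univ.filter fun w => swap σ w ∈ joint).card = joint.card := by
    intro σ
    refine Finset.card_bij (fun w _ => swap σ w) ?_ ?_ ?_
    · intro w hw
      exact (Finset.mem_filter.1 hw).2
    · intro w _ w' _ h
      exact (hswap σ).injective h
    · intro w hw
      refine ⟨swap σ w, ?_, hswap σ w⟩
      simp only [Finset.mem_filter, Finset.mem_univ, true_and]
      rwa [hswap σ w]
  -- For a fixed double sample the event depends on `i` only through the trace of `F i` on the `2 *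
  -- n` points: a union bound over at most `G` traces, with Hoeffding's inequality for each.
  have hfix : ∀ w, ((Finset.univ.filter fun σ => swap σ w ∈ joint).card : ℝ)
      ≤ G * (2 ^ n * Real.exp (-(n : ℝ) / 512)) := by
    intro w
    let z : Fin n × Bool → Ω := fun j => if j.2 then w.2 j.1 else w.1 j.1
    let pat : Finset (Fin n × Bool → Bool) :=
      (Set.toFinite (Set.range fun i => fun j => F i (z j))).toFinset
    have hpat : pat.card ≤ G := by
      have := hG z
      rwa [Set.ncard_eq_toFinset_card _ (Set.toFinite _)] at this
    let val : (Fin n × Bool → Bool) → Fin n → ℝ := fun u j =>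
      (if u (j, false) then (1 : ℝ) else 0) - if u (j, true) then (1 : ℝ) else 0
    have hval : ∀ u j, |val u j| ≤ 1 := by
      intro u j
      simp only [val]
      split_ifs <;> simp
    have hsub : (Finset.univ.filter fun σ => swap σ w ∈ joint) ⊆ Finset.univ.filter
        fun σ : Fin n → Bool => ∃ u ∈ pat, (n : ℝ) / 16 ≤
          ∑ j, if σ j then -val u j else val u j := by
      intro σ hσ
      simp only [Finset.mem_filter, Finset.mem_univ, true_and, joint] at hσ ⊢
      obtain ⟨i, hi⟩ := hσ
      refine ⟨fun j => F i (z j), by simp [pat], ?_⟩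
      refine le_trans hi (le_of_eq ?_)
      refine Finset.sum_congr rfl fun j _ => ?_
      by_cases h : σ j <;> simp [swap, val, z, h]
    have h1 := le_trans (Finset.card_le_card hsub) (card_filter_exists_le _ pat)
    have h2 : ((Finset.univ.filter fun σ => swap σ w ∈ joint).card : ℝ) ≤
        ∑ u ∈ pat, ((Finset.univ.filter fun σ : Fin n → Bool =>
          (n : ℝ) / 16 ≤ ∑ j, if σ j then -val u j else val u j).card : ℝ) := by
      exact_mod_cast h1
    refine le_trans h2 (le_trans (Finset.sum_le_card_nsmul _ _ _
      fun u _ => card_signed_sum_ge_le n (val u) (hval u)) ?_)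
    rw [nsmul_eq_mul]
    gcongr
  -- Double counting of the pairs of a swap and a double sample that is swapped into `joint`.
  have hdouble : (2 : ℝ) ^ n * (joint.card : ℝ)
      ≤ (N * N) * (G * (2 ^ n * Real.exp (-(n : ℝ) / 512))) := by
    have h1 : ∑ σ : Fin n → Bool, (Finset.univ.filter fun w => swap σ w ∈ joint).card
        = ∑ w, (Finset.univ.filter fun σ => swap σ w ∈ joint).card := by
      simp only [Finset.card_filter]
      rw [Finset.sum_comm]
    simp only [hinv] at h1
    rw [Finset.sum_const, Finset.card_univ, Fintype.card_fun, Fintype.card_fin, Fintype.card_bool,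
      smul_eq_mul] at h1
    have h2 : (2 : ℝ) ^ n * (joint.card : ℝ)
        = ∑ w, ((Finset.univ.filter fun σ => swap σ w ∈ joint).card : ℝ) := by exact_mod_cast h1
    rw [h2]
    refine le_trans (Finset.sum_le_card_nsmul _ _ _ fun w _ => hfix w) ?_
    rw [nsmul_eq_mul, Finset.card_univ, Fintype.card_prod, Fintype.card_fun, Fintype.card_fin]
    push_cast
    exact le_rfl
  have h2n : (0 : ℝ) < 2 ^ n := by positivity
  have hj : (joint.card : ℝ) ≤ (N * N) * (G * Real.exp (-(n : ℝ) / 512)) := by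
    refine le_of_mul_le_mul_left ?_ h2n
    linarith
  have : (bad.card : ℝ) * N ≤ (15 * (G * Real.exp (-(n : ℝ) / 512)) * N) * N := by linarith
  exact le_of_mul_le_mul_right this hNpos

/-! ### Traces of classes of bounded VC dimension -/

/-- The Sauer–Shelah lemma for the traces of a class on a family of points. -/
theorem ncard_trace_le {Y J : Type*} [Fintype J] (H : Set (Y → Bool)) {d : ℕ} (hd : vcDim H ≤ d)
    (z : J → Y) :
    ((fun (h : Y → Bool) (j : J) => h (z j)) '' H).ncard
      ≤ ∑ k ∈ Finset.Iic d, (Fintype.card J).choose k := by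
  classical
  set P := (fun (h : Y → Bool) (j : J) => h (z j)) '' H with hP
  let 𝒜 : Finset (Finset J) :=
    (Set.toFinite P).toFinset.image fun u => Finset.univ.filter fun j => u j = true
  have hcard : P.ncard = 𝒜.card := by
    rw [Set.ncard_eq_toFinset_card _ (Set.toFinite P), Finset.card_image_of_injective]
    intro u v huv
    funext j
    have : j ∈ Finset.univ.filter (fun j => u j = true) ↔
        j ∈ Finset.univ.filter (fun j => v j = true) := by
      simp only at huv
      rw [huv]
    rw [Bool.eq_iff_iff]
    simpa using this
  have htrace : ∀ s : Finset J, 𝒜.Shatters s → ∀ t ⊆ s, ∃ h ∈ H, ∀ j ∈ s,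
      (h (z j) = true ↔ j ∈ t) := by
    intro s hs t ht
    obtain ⟨u, hu, hut⟩ := hs ht
    obtain ⟨v, hv, rfl⟩ := Finset.mem_image.1 hu
    obtain ⟨h, hh, rfl⟩ := (Set.Finite.mem_toFinset _).1 hv
    refine ⟨h, hh, fun j hj => ?_⟩
    rw [← hut]
    simp [hj]
  have hsh : ∀ s : Finset J, 𝒜.Shatters s → s.card ≤ d := by
    intro s hs
    -- Coinciding points cannot be separated by the trace that singles out one of them; so a
    -- shattered index set yields as many points.
    have hinj : Set.InjOn z s := by
      intro a ha b hb hab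
      obtain ⟨h, -, hh⟩ := htrace s hs {a} (by simpa using ha)
      have h1 := (hh a ha).2 (by simp)
      rw [hab, hh b hb] at h1
      exact (Finset.mem_singleton.1 h1).symm
    have h1 : Shatters H (s.image z) := by
      intro g
      obtain ⟨h, hhH, hh⟩ := htrace s hs (s.filter fun j => g (z j) = true)
        (Finset.filter_subset _ _)
      refine ⟨h, hhH, fun x hx => ?_⟩
      obtain ⟨j, hj, rfl⟩ := Finset.mem_image.1 hx
      rw [Bool.eq_iff_iff, hh j hj]
      simp [hj]
    have h2 : ((s.image z).card : ℕ∞) ≤ vcDim H := le_iSup₂_of_le (s.image z) h1 le_rfl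
    rw [Finset.card_image_of_injOn hinj] at h2
    exact_mod_cast h2.trans hd
  have hvc : 𝒜.vcDim ≤ d := by
    refine Finset.sup_le fun s hs => hsh s (Finset.mem_shatterer.1 hs)
  rw [hcard]
  refine le_trans (Finset.card_le_card_shatterer 𝒜) (le_trans Finset.card_shatterer_le_sum_vcDim ?_)
  exact Finset.sum_le_sum_of_subset (Finset.Iic_subset_Iic.2 hvc)

/-- The usual bound `(e N / d) ^ d`: each term with `k ≤ d` is inflated by `(N / d) ^ (d - k) ≥ 1`,
after which the sum is part of the binomial expansion of `(1 + d / N) ^ N ≤ exp d`. -/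
theorem sum_choose_le {N d : ℕ} (hd : 0 < d) (hN : d ≤ N) :
    ((∑ k ∈ Finset.Iic d, N.choose k : ℕ) : ℝ) ≤ ((N : ℝ) / d) ^ d * Real.exp d := by
  have hd' : (0 : ℝ) < d := by exact_mod_cast hd
  have hN' : (0 : ℝ) < N := by exact_mod_cast lt_of_lt_of_le hd hN
  have hone : (1 : ℝ) ≤ (N : ℝ) / d := by
    rw [one_le_div hd']
    exact_mod_cast hN
  have h1 : ∀ k ∈ Finset.Iic d, ((N.choose k : ℕ) : ℝ)
      ≤ ((N : ℝ) / d) ^ d * (((d : ℝ) / N) ^ k * 1 ^ (N - k) * N.choose k) := by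
    intro k hk
    have hk' := Finset.mem_Iic.1 hk
    have h2 : (1 : ℝ) ≤ ((N : ℝ) / d) ^ d * ((d : ℝ) / N) ^ k := by
      have : ((N : ℝ) / d) ^ d = ((N : ℝ) / d) ^ (d - k) * ((N : ℝ) / d) ^ k := by
        rw [← pow_add, Nat.sub_add_cancel hk']
      rw [this, mul_assoc, ← mul_pow]
      have h3 : (N : ℝ) / d * (d / N) = 1 := by field_simp
      rw [h3, one_pow, mul_one]
      exact one_le_pow₀ hone
    have h4 : (0 : ℝ) ≤ (N.choose k : ℕ) := Nat.cast_nonneg _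
    calc ((N.choose k : ℕ) : ℝ) = 1 * (N.choose k : ℕ) := (one_mul _).symm
      _ ≤ (((N : ℝ) / d) ^ d * ((d : ℝ) / N) ^ k) * (N.choose k : ℕ) := by gcongr
      _ = _ := by rw [one_pow]; ring
  push_cast
  refine le_trans (Finset.sum_le_sum h1) ?_
  rw [← Finset.mul_sum]
  gcongr
  have h5 : ∑ k ∈ Finset.Iic d, ((d : ℝ) / N) ^ k * 1 ^ (N - k) * N.choose k
      ≤ ∑ k ∈ Finset.range (N + 1), ((d : ℝ) / N) ^ k * 1 ^ (N - k) * N.choose k := by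
    refine Finset.sum_le_sum_of_subset_of_nonneg ?_ fun _ _ _ => by positivity
    intro k hk
    have := Finset.mem_Iic.1 hk
    exact Finset.mem_range.2 (by omega)
  refine le_trans h5 ?_
  rw [← add_pow]
  calc ((d : ℝ) / N + 1) ^ N ≤ Real.exp (d / N) ^ N := by
        gcongr
        exact Real.add_one_le_exp _
    _ = Real.exp d := by
        rw [← Real.exp_nat_mul]
        congr 1
        field_simp

/-- The origin of the constant `2 ^ 14`: it makes the exponent `n / 512` equal to `32 * d` and the
ratio `2 * n / d` equal to `2 ^ 15`. The growth function then contributes `(2 ^ 15 * e) ^ d` (with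
Euler's number `e`), and `2 ^ 15 * exp (-31)` is below 1/60 since `e ≥ 2`. -/
theorem deviation_bound_le_half {d n : ℕ} (hd : 0 < d) (hn : n = 2 ^ 14 * d) :
    15 * (((2 * ∑ k ∈ Finset.Iic d, (2 * n).choose k : ℕ) : ℝ) * Real.exp (-(n : ℝ) / 512))
      ≤ 1 / 2 := by
  have hd' : (0 : ℝ) < d := by exact_mod_cast hd
  have h1 := sum_choose_le (N := 2 * n) hd (by omega)
  have h2 : (((2 * n : ℕ) : ℝ) / d) = 2 ^ 15 := by
    rw [hn]
    push_cast
    field_simp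
    norm_num
  rw [h2] at h1
  have h3 : Real.exp (-(n : ℝ) / 512) = (Real.exp (-32)) ^ d := by
    rw [← Real.exp_nat_mul, hn]
    congr 1
    push_cast
    ring
  have h4 : Real.exp (d : ℝ) = Real.exp 1 ^ d := by
    rw [← Real.exp_nat_mul, mul_one]
  have h5 : 60 * (2 ^ 15 * Real.exp 1 * Real.exp (-32)) ≤ 1 := by
    have h6 : Real.exp 1 * Real.exp (-32) = (Real.exp 1 ^ 31)⁻¹ := by
      rw [← Real.exp_nat_mul, ← Real.exp_neg, ← Real.exp_add]
      norm_num
    have h7 : (2 : ℝ) ^ 31 ≤ Real.exp 1 ^ 31 := by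
      gcongr
      have := Real.add_one_le_exp (1 : ℝ)
      linarith
    rw [mul_assoc (2 ^ 15 : ℝ), h6]
    have h8 : (Real.exp 1 ^ 31)⁻¹ ≤ ((2 : ℝ) ^ 31)⁻¹ := inv_anti₀ (by positivity) h7
    refine le_trans (by gcongr) (show 60 * (2 ^ 15 * ((2 : ℝ) ^ 31)⁻¹) ≤ 1 by norm_num)
  set q : ℝ := 2 ^ 15 * Real.exp 1 * Real.exp (-32) with hq
  have hq0 : 0 ≤ q := by positivity
  have h9 : q ^ d ≤ q := by
    refine pow_le_of_le_one hq0 ?_ (by omega)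
    linarith
  have h10 : ((∑ k ∈ Finset.Iic d, (2 * n).choose k : ℕ) : ℝ) * Real.exp (-(n : ℝ) / 512)
      ≤ q ^ d := by
    rw [h3, hq, mul_pow, mul_pow, ← h4]
    gcongr
  rw [Nat.cast_mul]
  push_cast at h10 ⊢
  linarith

open Classical in
/-- For a family whose traces on double samples are at most twice as many as for VC dimension `d`,
a sample of size `2 ^ 14 * d` has uniform deviation less than `1/8` with probability at least
`1/2`. -/
theorem card_deviation_le_half {Ω ι : Type*} [Fintype Ω] [Nonempty Ω] (F : ι → Ω → Bool)
    {d n : ℕ} (hd : 0 < d) (hn : n = 2 ^ 14 * d)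
    (hG : ∀ z : Fin n × Bool → Ω, (Set.range fun i => fun j => F i (z j)).ncard
      ≤ 2 * ∑ k ∈ Finset.Iic d, (2 * n).choose k) :
    2 * ((Finset.univ.filter fun ω : Fin n → Ω => ∃ i,
      (((Finset.univ.filter fun a => F i a = true).card : ℝ) / Fintype.card Ω + 1 / 8) * n
        ≤ ((Finset.univ.filter fun j => F i (ω j) = true).card : ℝ)).card)
      ≤ (Fintype.card Ω) ^ n := by
  have h1 := card_deviation_le F n _ (by omega) hG
  have h2 := deviation_bound_le_half hd hn
  have h3 : 15 * (((2 * ∑ k ∈ Finset.Iic d, (2 * n).choose k : ℕ) : ℝ)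
      * Real.exp (-(n : ℝ) / 512)) * (Fintype.card Ω : ℝ) ^ n
      ≤ 1 / 2 * (Fintype.card Ω : ℝ) ^ n := by gcongr
  have h4 := le_trans h1 h3
  have h5 : 2 * ((Finset.univ.filter fun ω : Fin n → Ω => ∃ i,
      (((Finset.univ.filter fun a => F i a = true).card : ℝ) / Fintype.card Ω + 1 / 8) * n
        ≤ ((Finset.univ.filter fun j => F i (ω j) = true).card : ℝ)).card : ℝ)
      ≤ (Fintype.card Ω : ℝ) ^ n := by linarith
  exact_mod_cast h5

open Classical in
/-- A proper consistent learner trained on `2 ^ 14 * d` uniform draws from a finite table of points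
errs on less than `1/8` of the table, with probability at least `1/2`. -/
theorem card_large_error_le {X : Type*} {C : Set (X → Bool)} {d L N : ℕ} (hC : vcDim C ≤ d)
    (hd : 0 < d) (hL : L = 2 ^ 14 * d) (hN : 0 < N) {A : Learner X} (hA : A.Proper C)
    (hA' : A.Consistent C) {f : X → Bool} (hf : f ∈ C) (tb : Fin N → X) :
    2 * (Finset.univ.filter fun g : Fin L → Fin N =>
      N ≤ 8 * (Finset.univ.filter fun a =>
        A (labelled f (List.ofFn fun j => tb (g j))) (tb a) ≠ f (tb a)).card).card ≤ N ^ L := by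
  have : Nonempty (Fin N) := ⟨⟨0, hN⟩⟩
  -- The events are agreements with `f`, because the deviation bound is one-sided: a consistent
  -- hypothesis has empirical agreement 1, so true agreement at most 7/8 is a deviation of 1/8.
  have h1 := card_deviation_le_half (Ω := Fin N) (ι := C)
    (fun h a => h.1 (tb a) == f (tb a)) hd hL ?_
  · rw [Fintype.card_fin] at h1
    refine le_trans ?_ h1
    gcongr with g
    intro hg
    set h := A (labelled f (List.ofFn fun j => tb (g j))) with hh
    refine ⟨⟨h, hA f hf _⟩, ?_⟩
    have h2 : (Finset.univ.filter fun j => (h (tb (g j)) == f (tb (g j))) = true)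
        = Finset.univ := by
      refine Finset.filter_true_of_mem fun j _ => ?_
      rw [beq_iff_eq]
      exact hA' f hf _ _ (List.mem_ofFn.2 ⟨j, rfl⟩)
    have h3 := Finset.card_filter_add_card_filter_not (s := (Finset.univ : Finset (Fin N)))
      (fun a => (h (tb a) == f (tb a)) = true)
    simp only [beq_iff_eq] at h2 h3 ⊢
    rw [h2, Finset.card_univ, Fintype.card_fin]
    rw [Finset.card_univ, Fintype.card_fin] at h3
    have h4 : ((Finset.univ.filter fun a => h (tb a) = f (tb a)).card : ℝ) ≤ 7 / 8 * N := by
      have : 8 * (Finset.univ.filter fun a => h (tb a) = f (tb a)).card ≤ 7 * N := by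
        have hg' : N ≤ 8 * (Finset.univ.filter fun a => ¬ h (tb a) = f (tb a)).card := hg
        omega
      have : (8 : ℝ) * ((Finset.univ.filter fun a => h (tb a) = f (tb a)).card : ℝ) ≤ 7 * N := by
        exact_mod_cast this
      linarith
    have hN' : (0 : ℝ) < N := by exact_mod_cast hN
    have h5 : ((Finset.univ.filter fun a => h (tb a) = f (tb a)).card : ℝ) / N ≤ 7 / 8 := by
      rw [div_le_iff₀ hN']
      exact h4
    calc _ ≤ (7 / 8 + 1 / 8 : ℝ) * L := by gcongr
      _ = L := by ring
  · intro z
    have h6 := ncard_trace_le C hC (fun j => tb (z j))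
    -- Comparing with the fixed labels of `f` is a map on traces, so it creates no new ones.
    have h7 : (Set.range fun (h : C) => fun j => (h.1 (tb (z j)) == f (tb (z j))))
        ⊆ (fun (u : Fin L × Bool → Bool) j => (u j == f (tb (z j)))) ''
          ((fun (h : X → Bool) (j : Fin L × Bool) => h (tb (z j))) '' C) := by
      rintro _ ⟨h, rfl⟩
      exact ⟨_, ⟨h.1, h.2, rfl⟩, rfl⟩
    refine le_trans (Set.ncard_le_ncard h7 (Set.toFinite _)) ?_
    refine le_trans (Set.ncard_image_le (Set.toFinite _)) (le_trans h6 ?_)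
    rw [Fintype.card_prod, Fintype.card_fin, Fintype.card_bool, mul_comm L 2]
    omega

open Classical in
/-- If points are misclassified by at most `3/8` of a finite family of concepts, then, with
probability at least `1/2`, the majority vote of `2 ^ 14 * e` uniformly drawn members of the family
is correct at all these points, where `e` is the dual VC dimension. -/
theorem card_bad_votes_le {X : Type*} {C : Set (X → Bool)} {e n T : ℕ}
    (hC : vcDim (dualClass C) ≤ e) (he : 0 < e) (hn : n = 2 ^ 14 * e) (hT : 0 < T)
    (h : Fin T → X → Bool) (hh : ∀ t, h t ∈ C) (f : X → Bool) :
    2 * (Finset.univ.filter fun g : Fin n → Fin T => ∃ x,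
      8 * (Finset.univ.filter fun t => h t x ≠ f x).card ≤ 3 * T ∧
      n ≤ 2 * (Finset.univ.filter fun j => h (g j) x ≠ f x).card).card ≤ T ^ n := by
  have : Nonempty (Fin T) := ⟨⟨0, hT⟩⟩
  -- The roles are exchanged: the points of `X` index the family, and the rounds are the probability
  -- space.
  have h1 := card_deviation_le_half (Ω := Fin T) (ι := X)
    (fun x t => h t x != f x) he hn ?_
  · rw [Fintype.card_fin] at h1
    refine le_trans ?_ h1
    refine Nat.mul_le_mul_left 2 (Finset.card_le_card fun g hg => ?_)
    obtain ⟨x, hx, hg⟩ := (Finset.mem_filter.1 hg).2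
    refine Finset.mem_filter.2 ⟨Finset.mem_univ _, x, ?_⟩
    simp only [bne_iff_ne]
    have hT' : (0 : ℝ) < T := by exact_mod_cast hT
    have h2 : ((Finset.univ.filter fun t => h t x ≠ f x).card : ℝ) / T ≤ 3 / 8 := by
      rw [div_le_iff₀ hT']
      have : (8 : ℝ) * ((Finset.univ.filter fun t => h t x ≠ f x).card : ℝ) ≤ 3 * T := by
        exact_mod_cast hx
      linarith
    have h3 : (n : ℝ) ≤ 2 * ((Finset.univ.filter fun j => h (g j) x ≠ f x).card : ℝ) := by
      exact_mod_cast hg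
    calc _ ≤ (3 / 8 + 1 / 8 : ℝ) * n := by gcongr
      _ ≤ _ := by linarith
  · intro z
    have h6 := ncard_trace_le (dualClass C) hC (fun j => (⟨h (z j), hh (z j)⟩ : C))
    set P := (fun (u : C → Bool) (j : Fin n × Bool) => u ⟨h (z j), hh (z j)⟩) '' dualClass C
      with hP
    -- The label `f x` varies with the index `x` but is constant along each trace. Splitting by its
    -- two values gives two images of the dual traces, whence the factor 2 in
    -- `card_deviation_le_half`.
    have h7 : (Set.range fun x => fun j => (h (z j) x != f x))
        ⊆ (fun (u : (Fin n × Bool → Bool)) j => (u j != true)) '' P ∪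
          (fun (u : (Fin n × Bool → Bool)) j => (u j != false)) '' P := by
      rintro _ ⟨x, rfl⟩
      by_cases hx : f x = true
      · exact Or.inl ⟨_, ⟨_, ⟨x, rfl⟩, rfl⟩, by simp [hx]⟩
      · exact Or.inr ⟨_, ⟨_, ⟨x, rfl⟩, rfl⟩, by simp [hx]⟩
    refine le_trans (Set.ncard_le_ncard h7 (Set.toFinite _)) (le_trans (Set.ncard_union_le _ _) ?_)
    rw [Fintype.card_prod, Fintype.card_fin, Fintype.card_bool, mul_comm n 2] at h6
    have h8 := Set.ncard_image_le (f := fun (u : (Fin n × Bool → Bool)) j => (u j != true))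
      (Set.toFinite P)
    have h9 := Set.ncard_image_le (f := fun (u : (Fin n × Bool → Bool)) j => (u j != false))
      (Set.toFinite P)
    omega

/-! ### A program logic for running times -/

namespace Prog

variable {X : Type*}

/-- From `s`, the program `p` terminates in a state satisfying `Q`, in expected time at most `τ`. -/
def Hoare (E : Env X) (p : Prog) (s : RamState X) (τ : ℕ) (Q : RamState X → Prop) : Prop :=
  ∀ (φ : RamState X → ℝ≥0∞) (R : ℝ≥0∞), (∀ s', Q s' → φ s' ≤ R) → ert E p φ s ≤ τ + R

/-- From `s`, the program `p` terminates in a state satisfying `Q₂`, and with probability at least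
`1/2` in a state satisfying `Q₁`, in expected time at most `τ`. -/
def HalfHoare (E : Env X) (p : Prog) (s : RamState X) (τ : ℕ) (Q₁ Q₂ : RamState X → Prop) : Prop :=
  ∀ (φ : RamState X → ℝ≥0∞) (R₁ R₂ : ℝ≥0∞), R₁ ≤ R₂ → (∀ s', Q₁ s' → φ s' ≤ R₁) →
    (∀ s', Q₂ s' → φ s' ≤ R₂) → ert E p φ s ≤ τ + (R₁ + R₂) / 2

variable {E : Env X} {p q : Prog} {s : RamState X} {τ τ₁ τ₂ : ℕ} {Q Q₁ Q₂ P P₁ P₂ : RamState X → Prop}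

theorem Hoare.mono (h : Hoare E p s τ₁ P) (hτ : τ₁ ≤ τ) (hQ : ∀ s', P s' → Q s') :
    Hoare E p s τ Q := fun φ R hR =>
  (h φ R fun s' hs' => hR s' (hQ s' hs')).trans (by gcongr)

theorem HalfHoare.mono (h : HalfHoare E p s τ₁ P₁ P₂) (hτ : τ₁ ≤ τ) (h₁ : ∀ s', P₁ s' → Q₁ s')
    (h₂ : ∀ s', P₂ s' → Q₂ s') : HalfHoare E p s τ Q₁ Q₂ := fun φ R₁ R₂ hR hR₁ hR₂ =>
  (h φ R₁ R₂ hR (fun s' hs' => hR₁ s' (h₁ s' hs')) fun s' hs' => hR₂ s' (h₂ s' hs')).trans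
    (by gcongr)

theorem Hoare.seq (hp : Hoare E p s τ₁ P) (hq : ∀ s', P s' → Hoare E q s' τ₂ Q) :
    Hoare E (.seq p q) s (1 + τ₁ + τ₂) Q := fun φ R hR => by
  have := hp (ert E q φ) (τ₂ + R) fun s' hs' => hq s' hs' φ R hR
  simp only [ert]
  push_cast
  rw [add_assoc, add_assoc]
  gcongr

theorem Hoare.seq_half (hp : Hoare E p s τ₁ P) (hq : ∀ s', P s' → HalfHoare E q s' τ₂ Q₁ Q₂) :
    HalfHoare E (.seq p q) s (1 + τ₁ + τ₂) Q₁ Q₂ := fun φ R₁ R₂ hR hR₁ hR₂ => by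
  have := hp (ert E q φ) (τ₂ + (R₁ + R₂) / 2) fun s' hs' => hq s' hs' φ R₁ R₂ hR hR₁ hR₂
  simp only [ert]
  push_cast
  rw [add_assoc, add_assoc]
  gcongr

theorem HalfHoare.seq (hp : HalfHoare E p s τ₁ P₁ P₂) (h₁ : ∀ s', P₁ s' → Hoare E q s' τ₂ Q₁)
    (h₂ : ∀ s', P₂ s' → Hoare E q s' τ₂ Q₂) : HalfHoare E (.seq p q) s (1 + τ₁ + τ₂) Q₁ Q₂ :=
  fun φ R₁ R₂ hR hR₁ hR₂ => by
  have := hp (ert E q φ) (τ₂ + R₁) (τ₂ + R₂) (by gcongr) (fun s' hs' => h₁ s' hs' φ R₁ hR₁)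
    fun s' hs' => h₂ s' hs' φ R₂ hR₂
  have h2 : ((τ₂ : ℝ≥0∞) + R₁ + (τ₂ + R₂)) / 2 = τ₂ + (R₁ + R₂) / 2 := by
    rw [add_add_add_comm, ENNReal.add_div, ENNReal.add_div, ENNReal.add_halves]
  rw [h2] at this
  simp only [ert]
  push_cast
  rw [add_assoc, add_assoc]
  gcongr

theorem Hoare.ite {a : ℕ} (hp : s.reg a ≠ 0 → Hoare E p s τ Q)
    (hq : s.reg a = 0 → Hoare E q s τ Q) : Hoare E (.ite a p q) s (1 + τ) Q := fun φ R hR => by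
  simp only [ert]
  push_cast
  rw [add_assoc]
  gcongr
  split_ifs with h
  · exact hp h φ R hR
  · exact hq (not_not.1 h) φ R hR

/-- A loop with a variant. -/
theorem Hoare.bounded {r : ℕ} (t : ℕ → ℕ) (Inv : ℕ → RamState X → Prop)
    (hzero : ∀ s, Inv 0 s → s.reg r = 0) (hsucc : ∀ k s, Inv (k + 1) s → s.reg r ≠ 0)
    (hbody : ∀ k s, Inv (k + 1) s → Hoare E p s (t k) (Inv k)) (k : ℕ) (s : RamState X)
    (hs : Inv k s) :
    Hoare E (.while r p) s (∑ j ∈ Finset.range k, (t j + 1) + 1) (Inv 0) := fun φ R hR => by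
  induction k generalizing s with
  | zero =>
    rw [ert_while, if_neg (by simp [hzero _ hs])]
    have := hR s hs
    simp only [Finset.range_zero, Finset.sum_empty, zero_add, Nat.cast_one]
    gcongr
  | succ k ih =>
    rw [ert_while, if_pos (hsucc _ _ hs)]
    have := hbody k s hs (ert E (.while r p) φ) _ fun s' hs' => ih s' hs'
    refine le_trans (add_le_add_right this 1) (le_of_eq ?_)
    rw [Finset.sum_range_succ]
    push_cast
    ring

/-- A loop that counts a register down. -/
theorem Hoare.countdown {r : ℕ} (t : ℕ → ℕ) (Inv : ℕ → RamState X → Prop)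
    (hreg : ∀ k s, Inv k s → s.reg r = k)
    (hbody : ∀ k s, Inv (k + 1) s → Hoare E p s (t k) (Inv k)) (k : ℕ) (s : RamState X)
    (hs : Inv k s) :
    Hoare E (.while r p) s (∑ j ∈ Finset.range k, (t j + 1) + 1) (Inv 0) :=
  Hoare.bounded t Inv (hreg 0) (fun k s h => by simp [hreg _ _ h]) hbody k s hs

theorem Hoare.countdown_const {r : ℕ} (Inv : ℕ → RamState X → Prop)
    (hreg : ∀ k s, Inv k s → s.reg r = k)
    (hbody : ∀ k s, Inv (k + 1) s → Hoare E p s τ (Inv k)) (k : ℕ) (s : RamState X)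
    (hs : Inv k s) : Hoare E (.while r p) s (k * (τ + 1) + 1) (Inv 0) :=
  (Hoare.countdown (fun _ => τ) Inv hreg hbody k s hs).mono (by simp) fun _ h => h

/-- A loop whose body makes progress with probability at least `1/2`. -/
theorem HalfHoare.retry {r : ℕ} (Inv : ℕ → RamState X → Prop)
    (hzero : ∀ s, Inv 0 s → s.reg r = 0) (hsucc : ∀ k s, Inv (k + 1) s → s.reg r ≠ 0)
    (hbody : ∀ k s, Inv (k + 1) s →
      HalfHoare E p s τ (Inv k) fun s' => Inv k s' ∨ Inv (k + 1) s')
    (k : ℕ) (s : RamState X) (hs : Inv k s) :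
    Hoare E (.while r p) s (k * (2 * (τ + 1)) + 1) (Inv 0) := fun φ R hR => by
  -- The slope `2 * (τ + 1)` solves `b (k + 1) = 1 + τ + (b k + b (k + 1)) / 2`, the equation for an
  -- attempt that succeeds with probability 1/2.
  let b : ℕ → ℝ≥0∞ := fun k => ((k * (2 * (τ + 1)) + 1 : ℕ) : ℝ≥0∞) + R
  have hb : ∀ k, b (k + 1) = b k + 2 * (τ + 1) := by
    intro k
    simp only [b]
    push_cast
    ring
  have hmono : ∀ k, b k ≤ b (k + 1) := fun k => by rw [hb]; exact le_self_add
  -- A state may satisfy `Inv k` for several `k`; the infimum makes the bound a function of the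
  -- state alone.
  let I : RamState X → ℝ≥0∞ := fun s => ⨅ (k : ℕ) (_ : Inv k s), b k
  have hI : ∀ k s, Inv k s → I s ≤ b k := fun k s h => iInf₂_le k h
  refine (ert_while_le_of_invariant E (I := I) (fun s => ?_) s).trans (hI k s hs)
  refine le_iInf₂ fun k hk => ?_
  cases k with
  | zero =>
    rw [if_neg (by simp [hzero s hk])]
    have := hR s hk
    simp only [b, zero_mul, zero_add]
    push_cast
    gcongr
  | succ k =>
    rw [if_pos (hsucc k s hk)]
    have := hbody k s hk I (b k) (b (k + 1)) (hmono k) (hI k) fun s' hs' =>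
      hs'.elim (fun h => (hI k s' h).trans (hmono k)) (hI (k + 1) s')
    refine le_trans (add_le_add_right this 1) (le_of_eq ?_)
    have h2 : (b k + b (k + 1)) / 2 = b k + (τ + 1) := by
      rw [hb, ← add_assoc, ← two_mul, ← mul_add, mul_comm, mul_div_assoc,
        ENNReal.div_self (by norm_num) (by norm_num), mul_one]
    rw [h2, hb]
    ring

/-! ### Straight-line programs and uniform draws -/

/-- Effect of the instructions that are not random. -/
noncomputable def _root_.Instr.next (E : Env X) (s : RamState X) : Instr → RamState X
  | .const r n => s.setReg r (n % E.B)
  | .add r a b => s.setReg r ((s.reg a + s.reg b) % E.B)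
  | .sub r a b => s.setReg r (s.reg a - s.reg b)
  | .mul r a b => s.setReg r ((s.reg a * s.reg b) % E.B)
  | .div r a b => s.setReg r (s.reg a / s.reg b)
  | .load r a => s.setReg r (s.mem (s.reg a))
  | .store a b => { s with mem := Function.update s.mem (s.reg a) (s.reg b) }
  | .rand _ _ => s
  | .label r a => s.setReg r (((E.sample[s.reg a]?).map fun p => p.2.toNat % E.B).getD 0)
  | .learn h a l =>
      let S := s.subsample E (s.reg a) (s.reg l)
      { s with hyp := Function.update s.hyp (s.reg h) (S.length, E.learner S) }
  | .eval r h a => s.setReg r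
      (((E.sample[s.reg a]?).map fun p => ((s.hyp (s.reg h)).2 p.1).toNat % E.B).getD 0)
  | .emitPoint a => { s with outPoints := s.outPoints ++ (E.sample[s.reg a]?).toList }
  | .emitBit a => { s with outBits := s.outBits ++ [decide (s.reg a ≠ 0)] }

def _root_.Instr.det : Instr → Bool
  | .rand _ _ => false
  | _ => true

theorem ert_instr (E : Env X) (i : Instr) (hi : i.det = true) (φ : RamState X → ℝ≥0∞)
    (s : RamState X) : ert E (.instr i) φ s = i.time E s + φ (i.next E s) := by
  cases i <;> first
    | (simp [Instr.det] at hi; done)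
    | simp only [ert, Instr.exec, Instr.next, tsum_pure_mul]

theorem ert_rand (E : Env X) (r a : ℕ) (φ : RamState X → ℝ≥0∞) (s : RamState X)
    (ha : 0 < s.reg a) : ert E (.instr (.rand r a)) φ s
      = 1 + (∑ v ∈ Finset.range (s.reg a), φ (s.setReg r v)) / s.reg a := by
  have h : (Finset.range (s.reg a)).Nonempty := Finset.nonempty_range_iff.2 ha.ne'
  simp only [ert, Instr.exec, dif_pos h, tsum_map_mul, Instr.time, Nat.cast_one]
  congr 1
  rw [tsum_eq_sum (s := Finset.range (s.reg a))]
  · rw [div_eq_mul_inv, Finset.sum_mul]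
    refine Finset.sum_congr rfl fun v hv => ?_
    rw [PMF.uniformOfFinset_apply_of_mem h hv, Finset.card_range, mul_comm]
  · intro v hv
    rw [PMF.uniformOfFinset_apply_of_notMem h hv, zero_mul]

/-- Straight-line programs. -/
def block : Instr → List Instr → Prog
  | i, [] => .instr i
  | i, j :: l => .seq (.instr i) (block j l)

noncomputable def run (E : Env X) : Instr → List Instr → RamState X → RamState X
  | i, [], s => i.next E s
  | i, j :: l, s => run E j l (i.next E s)

noncomputable def runTime (E : Env X) : Instr → List Instr → RamState X → ℕ
  | i, [], s => i.time E s
  | i, j :: l, s => 1 + i.time E s + runTime E j l (i.next E s)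

theorem Hoare.block {i : Instr} {l : List Instr} (hdet : (i :: l).all Instr.det = true)
    (hτ : runTime E i l s ≤ τ) (hQ : Q (run E i l s)) : Hoare E (block i l) s τ Q := by
  induction l generalizing i s τ with
  | nil =>
    intro φ R hR
    simp only [List.all_cons, List.all_nil, Bool.and_true] at hdet
    rw [Prog.block, ert_instr E i hdet]
    gcongr
    · exact hτ
    · exact hR _ hQ
  | cons j l ih =>
    simp only [List.all_cons, Bool.and_eq_true] at hdet
    have h1 : Hoare E (.instr i) s (i.time E s) (fun s' => s' = i.next E s) := fun φ R hR => by
      rw [ert_instr E i hdet.1]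
      gcongr
      exact hR _ rfl
    refine (h1.seq (q := Prog.block j l) fun s' hs' => ?_).mono hτ fun _ h => h
    subst hs'
    exact ih (by simp [hdet]) le_rfl hQ

/-- The common shape of the bodies of the two drawing loops: decrement the counter, draw, and
continue deterministically. The postcondition and the bound `R` depend on the drawn value, so that
averages over draws remain exact. The 4 accounts for two instructions and two sequencings. -/
theorem ert_instr_seq_rand_seq_le {i : Instr} (hi : i.det = true) (hit : i.time E s = 1)
    {r a N : ℕ} (hN : 0 < N) (ha : (i.next E s).reg a = N) (Q : ℕ → RamState X → Prop)
    (hq : ∀ v < N, Hoare E q ((i.next E s).setReg r v) τ (Q v))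
    (φ : RamState X → ℝ≥0∞) (R : ℕ → ℝ≥0∞) (hR : ∀ v < N, ∀ s', Q v s' → φ s' ≤ R v) :
    ert E (.seq (.instr i) (.seq (.instr (.rand r a)) q)) φ s
      ≤ ((4 + τ : ℕ) : ℝ≥0∞) + (∑ v ∈ Finset.range N, R v) / N := by
  have hN0 : (N : ℝ≥0∞) ≠ 0 := by exact_mod_cast hN.ne'
  change 1 + ert E (.instr i) (ert E (.seq (.instr (.rand r a)) q) φ) s ≤ _
  rw [ert_instr E i hi]
  change 1 + (_ + (1 + ert E (.instr (.rand r a)) (ert E q φ) (i.next E s))) ≤ _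
  rw [ert_rand E r a _ _ (ha ▸ hN), ha, hit]
  have h1 : ∑ v ∈ Finset.range N, ert E q φ ((i.next E s).setReg r v)
      ≤ ∑ v ∈ Finset.range N, ((τ : ℝ≥0∞) + R v) :=
    Finset.sum_le_sum fun v hv => hq v (Finset.mem_range.1 hv) φ (R v) (hR v (Finset.mem_range.1 hv))
  have h2 : (∑ v ∈ Finset.range N, ((τ : ℝ≥0∞) + R v)) / N
      = τ + (∑ v ∈ Finset.range N, R v) / N := by
    rw [Finset.sum_add_distrib, Finset.sum_const, Finset.card_range, nsmul_eq_mul, ENNReal.add_div,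
      mul_comm, mul_div_assoc, ENNReal.div_self hN0 (ENNReal.natCast_ne_top N), mul_one]
  calc _ ≤ 1 + (((1 : ℕ) : ℝ≥0∞)
        + (1 + (1 + (∑ v ∈ Finset.range N, ((τ : ℝ≥0∞) + R v)) / N))) := by
        gcongr
    _ = _ := by
        rw [h2]
        push_cast
        ring

/-- A loop whose body draws a uniform number below `N` prepends it to a list. -/
theorem ert_draws_le {r N : ℕ} (hN : 0 < N) (Inv : ℕ → List ℕ → RamState X → Prop)
    (hreg : ∀ k v s, Inv k v s → s.reg r = k)
    (hbody : ∀ k v s, Inv (k + 1) v s → ∀ (φ : RamState X → ℝ≥0∞) (R : ℕ → ℝ≥0∞),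
      (∀ a < N, ∀ s', Inv k (a :: v) s' → φ s' ≤ R a) →
      ert E p φ s ≤ τ + (∑ a ∈ Finset.range N, R a) / N)
    (k : ℕ) (v : List ℕ) (s : RamState X) (hs : Inv k v s) (φ : RamState X → ℝ≥0∞)
    (R : List ℕ → ℝ≥0∞)
    (hR : ∀ g : Fin k → Fin N, ∀ s', Inv 0 (List.ofFn (fun j => (g j : ℕ)) ++ v) s' →
      φ s' ≤ R (List.ofFn (fun j => (g j : ℕ)) ++ v)) :
    ert E (.while r p) φ s ≤ ((k * (τ + 1) + 1 : ℕ) : ℝ≥0∞)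
      + (∑ g : Fin k → Fin N, R (List.ofFn (fun j => (g j : ℕ)) ++ v)) / (N : ℝ≥0∞) ^ k := by
  have hN0 : (N : ℝ≥0∞) ≠ 0 := by exact_mod_cast hN.ne'
  induction k generalizing s v with
  | zero =>
    rw [ert_while, if_neg (by simp [hreg _ _ _ hs])]
    have h2 := hR Fin.elim0 s (by simpa using hs)
    simp only [List.ofFn_zero, List.nil_append] at h2
    simp only [zero_mul, zero_add, Finset.univ_unique, Finset.sum_singleton, List.ofFn_zero,
      List.nil_append, pow_zero, div_one, Nat.cast_one]
    gcongr
  | succ k ih =>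
    rw [ert_while, if_pos (by simp [hreg _ _ _ hs])]
    -- Later draws are prepended, so the draw made now becomes the last entry of the tuple; hence
    -- `Fin.snoc`.
    have hlist : ∀ (a : Fin N) (g : Fin k → Fin N),
        List.ofFn (fun j => ((Fin.snoc g a : Fin (k + 1) → Fin N) j : ℕ)) ++ v
          = List.ofFn (fun j => (g j : ℕ)) ++ ((a : ℕ) :: v) := by
      intro a g
      rw [List.ofFn_succ']
      simp
    have h1 := hbody k v s hs (ert E (.while r p) φ)
      (fun a => ((k * (τ + 1) + 1 : ℕ) : ℝ≥0∞)
        + (∑ g : Fin k → Fin N, R (List.ofFn (fun j => (g j : ℕ)) ++ (a :: v)))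
          / (N : ℝ≥0∞) ^ k) (fun a ha s' hs' => ih (a :: v) s' hs' fun g s'' hs'' => by
        have := hR (Fin.snoc g (⟨a, ha⟩ : Fin N)) s''
        rw [hlist] at this
        exact this hs'')
    refine le_trans (add_le_add_right h1 1) (le_of_eq ?_)
    have h3 : ∑ g : Fin (k + 1) → Fin N, R (List.ofFn (fun j => (g j : ℕ)) ++ v)
        = ∑ a ∈ Finset.range N,
          ∑ g : Fin k → Fin N, R (List.ofFn (fun j => (g j : ℕ)) ++ (a :: v)) := by
      rw [Finset.sum_range, ← Fintype.sum_prod_type',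
        ← (Fin.snocEquiv fun _ : Fin (k + 1) => Fin N).sum_comp]
      refine Finset.sum_congr rfl fun w _ => ?_
      rw [← hlist]
      rfl
    rw [h3, Finset.sum_add_distrib, Finset.sum_const, Finset.card_range, nsmul_eq_mul,
      ENNReal.add_div, mul_comm (N : ℝ≥0∞) _, mul_div_assoc,
      ENNReal.div_self hN0 (ENNReal.natCast_ne_top N), mul_one]
    have h4 : (∑ a ∈ Finset.range N, (∑ g : Fin k → Fin N,
          R (List.ofFn (fun j => (g j : ℕ)) ++ (a :: v))) / (N : ℝ≥0∞) ^ k) / N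
        = (∑ a ∈ Finset.range N, ∑ g : Fin k → Fin N,
          R (List.ofFn (fun j => (g j : ℕ)) ++ (a :: v))) / (N : ℝ≥0∞) ^ (k + 1) := by
      simp only [div_eq_mul_inv]
      rw [← Finset.sum_mul, mul_assoc, pow_succ,
        ENNReal.mul_inv (Or.inr (ENNReal.natCast_ne_top N)) (Or.inr hN0)]
    rw [h4]
    push_cast
    ring

/-- A loop that draws numbers below `N`, for a set of favourable draws of probability at least
`1/2`. -/
theorem HalfHoare.draws {r N : ℕ} (hN : 0 < N) (Inv : ℕ → List ℕ → RamState X → Prop)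
    (hreg : ∀ k v s, Inv k v s → s.reg r = k)
    (hbody : ∀ k v s, Inv (k + 1) v s → ∀ (φ : RamState X → ℝ≥0∞) (R : ℕ → ℝ≥0∞),
      (∀ a < N, ∀ s', Inv k (a :: v) s' → φ s' ≤ R a) →
      ert E p φ s ≤ τ + (∑ a ∈ Finset.range N, R a) / N)
    (k : ℕ) (s : RamState X) (hs : Inv k [] s) (bad : (Fin k → Fin N) → Prop)
    [DecidablePred bad] (hbad : 2 * (Finset.univ.filter bad).card ≤ N ^ k) :
    HalfHoare E (.while r p) s (k * (τ + 1) + 1)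
      (fun s' => ∃ g : Fin k → Fin N, ¬ bad g ∧ Inv 0 (List.ofFn fun j => (g j : ℕ)) s')
      (fun s' => ∃ g : Fin k → Fin N, Inv 0 (List.ofFn fun j => (g j : ℕ)) s') := by
  classical
  intro φ R₁ R₂ hR hR₁ hR₂
  let R : List ℕ → ℝ≥0∞ := fun v =>
    if ∃ g : Fin k → Fin N, ¬ bad g ∧ v = List.ofFn (fun j => (g j : ℕ)) then R₁ else R₂
  have h1 := ert_draws_le hN Inv hreg hbody k [] s hs φ R (fun g s' hs' => by
    rw [List.append_nil] at hs' ⊢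
    simp only [R]
    split_ifs with h
    · obtain ⟨g', hg', hgg⟩ := h
      exact hR₁ s' ⟨g', hg', hgg ▸ hs'⟩
    · exact hR₂ s' ⟨g, hs'⟩)
  refine h1.trans (add_le_add le_rfl ?_)
  have hN0 : (N : ℝ≥0∞) ^ k ≠ 0 := pow_ne_zero _ (by exact_mod_cast hN.ne')
  have hNt : (N : ℝ≥0∞) ^ k ≠ ⊤ := ENNReal.pow_ne_top (ENNReal.natCast_ne_top N)
  have h2 : ∑ g : Fin k → Fin N, R (List.ofFn (fun j => (g j : ℕ)) ++ [])
      ≤ ∑ g : Fin k → Fin N, if bad g then R₂ else R₁ := by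
    refine Finset.sum_le_sum fun g _ => ?_
    rw [List.append_nil]
    simp only [R]
    split_ifs with h h' h'
    · exact hR
    · exact le_rfl
    · exact le_rfl
    · exact absurd ⟨g, h', rfl⟩ h
  have h3 : ∑ g : Fin k → Fin N, (if bad g then R₂ else R₁)
      = (Finset.univ.filter bad).card * R₂ + (Finset.univ.filter fun g => ¬ bad g).card * R₁ := by
    rw [Finset.sum_ite, Finset.sum_const, Finset.sum_const, nsmul_eq_mul, nsmul_eq_mul]
  have h4 := Finset.card_filter_add_card_filter_not (s := (Finset.univ : Finset (Fin k → Fin N))) bad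
  rw [Finset.card_univ, Fintype.card_fun, Fintype.card_fin, Fintype.card_fin] at h4
  -- Bad draws are at most half, so they can be matched with as many good ones; the surplus `e` of
  -- good draws only lowers the average, since `R₁ ≤ R₂`.
  obtain ⟨e, he⟩ : ∃ e, (Finset.univ.filter fun g => ¬ bad g).card
      = (Finset.univ.filter bad).card + e := Nat.exists_eq_add_of_le (by omega)
  set b := (Finset.univ.filter bad).card
  rw [he] at h3 h4
  rw [ENNReal.div_le_iff_le_mul (Or.inl hN0) (Or.inl hNt)]
  refine h2.trans (h3.le.trans ?_)
  have h5 : (N : ℝ≥0∞) ^ k = 2 * b + e := by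
    rw [two_mul, add_assoc]
    exact_mod_cast h4.symm
  rw [h5, mul_comm _ (2 * (b : ℝ≥0∞) + e), ← mul_div_assoc, ENNReal.le_div_iff_mul_le (by simp) (by simp)]
  push_cast
  calc (b * R₂ + (b + e) * R₁) * 2 = (2 * b + e) * R₁ + (2 * b * R₂ + e * R₁) := by ring
    _ ≤ (2 * b + e) * R₁ + (2 * b * R₂ + e * R₂) := by gcongr
    _ = (2 * b + e) * (R₁ + R₂) := by ring

end Prog

/-! ### The compression program -/

namespace Prog

variable {X : Type*}

/-! ### Quantized weights and sampling from them -/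

/-- Register `14` copies of the index in register `12` are appended to a table of length
register `11`, which starts at the address in register `0`. -/
def appendLoop : Prog :=
  .while 14 (block (.sub 14 14 3) [.add 15 0 11, .store 15 12, .add 11 11 3])

/-- Quantization of the weights: a table with `m * wᵢ / W + 1` copies of each index `i < m`. -/
def tableLoop : Prog :=
  .while 12 (.seq
    (block (.sub 12 12 3) [.load 14 12, .mul 14 0 14, .div 14 14 10, .add 14 14 3]) appendLoop)

/-- The states agree up to the registers in `rs` and the memory between `lo` and `hi`. -/
structure Same (rs : List ℕ) (lo hi : ℕ) (s s' : RamState X) : Prop where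
  reg : ∀ r, r ∉ rs → s'.reg r = s.reg r
  mem : ∀ a, (a < lo ∨ hi ≤ a) → s'.mem a = s.mem a
  hyp : s'.hyp = s.hyp
  outPoints : s'.outPoints = s.outPoints
  outBits : s'.outBits = s.outBits

theorem Same.refl (rs : List ℕ) (lo hi : ℕ) (s : RamState X) : Same rs lo hi s s :=
  ⟨fun _ _ => rfl, fun _ _ => rfl, rfl, rfl, rfl⟩

theorem Same.trans {rs : List ℕ} {lo hi : ℕ} {s s' s'' : RamState X} (h : Same rs lo hi s s')
    (h' : Same rs lo hi s' s'') : Same rs lo hi s s'' :=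
  ⟨fun r hr => (h'.reg r hr).trans (h.reg r hr), fun a ha => (h'.mem a ha).trans (h.mem a ha),
    h'.hyp.trans h.hyp, h'.outPoints.trans h.outPoints, h'.outBits.trans h.outBits⟩

theorem Same.mono {rs rs' : List ℕ} {lo hi lo' hi' : ℕ} {s s' : RamState X}
    (h : Same rs lo hi s s') (hrs : rs ⊆ rs') (hlo : lo' ≤ lo) (hhi : hi ≤ hi') :
    Same rs' lo' hi' s s' :=
  ⟨fun r hr => h.reg r fun hr' => hr (hrs hr'), fun a ha => h.mem a (by omega),
    h.hyp, h.outPoints, h.outBits⟩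

/-- The table is described through sums of arbitrary functions `F` over its entries, that is, as a
multiset: neither its order nor its exact layout matters for uniform draws. -/
theorem appendLoop_spec (E : Env X) {m hi i q : ℕ} (s₀ : RamState X) (h0 : s₀.reg 0 = m)
    (h3 : s₀.reg 3 = 1) (h12 : s₀.reg 12 = i) (h14 : s₀.reg 14 = q)
    (hhi : m + s₀.reg 11 + q ≤ hi) (hB : hi < E.B) :
    Hoare E appendLoop s₀ (q * 8 + 1) fun s =>
      Same [11, 14, 15] m hi s₀ s ∧ s.reg 11 = s₀.reg 11 + q ∧
      ∀ F : ℕ → ℕ, ∑ j ∈ Finset.range (s.reg 11), F (s.mem (m + j))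
        = ∑ j ∈ Finset.range (s₀.reg 11), F (s₀.mem (m + j)) + q * F i := by
  refine (Hoare.countdown_const (τ := 7) (fun k s => Same [11, 14, 15] m hi s₀ s ∧ s.reg 14 = k ∧
      s.reg 11 + k = s₀.reg 11 + q ∧
      ∀ F : ℕ → ℕ, ∑ j ∈ Finset.range (s.reg 11), F (s.mem (m + j)) + k * F i
        = ∑ j ∈ Finset.range (s₀.reg 11), F (s₀.mem (m + j)) + q * F i)
    (fun k s h => h.2.1) ?_ q s₀ ⟨.refl _ _ _ _, h14, rfl, fun F => rfl⟩).mono le_rfl ?_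
  · rintro k s ⟨hs, hk, hN, hF⟩
    have e0 := hs.reg 0 (by decide)
    have e3 := hs.reg 3 (by decide)
    have e12 := hs.reg 12 (by decide)
    rw [h0] at e0; rw [h3] at e3; rw [h12] at e12
    have m1 : (m + s.reg 11) % E.B = m + s.reg 11 := Nat.mod_eq_of_lt (by omega)
    have m2 : (s.reg 11 + 1) % E.B = s.reg 11 + 1 := Nat.mod_eq_of_lt (by omega)
    refine Hoare.block rfl (by simp [runTime, Instr.time]) ⟨⟨?_, ?_, ?_, ?_, ?_⟩, ?_, ?_, ?_⟩
    · intro r hr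
      have := hs.reg r hr
      simp at hr
      simp [run, Instr.next, RamState.setReg, hr, this]
    · intro a ha
      rw [← hs.mem a ha]
      have : a ≠ m + s.reg 11 := by omega
      simp [run, Instr.next, RamState.setReg, e0, m1, this]
    · exact hs.hyp
    · exact hs.outPoints
    · exact hs.outBits
    · simp [run, Instr.next, RamState.setReg, e3, hk]
    · simp [run, Instr.next, RamState.setReg, e3, m2]
      omega
    · intro F
      rw [← hF F]
      simp [run, Instr.next, RamState.setReg, e0, e3, e12, m1, m2, Finset.sum_range_succ]
      rw [Finset.sum_congr rfl (g := fun j => F (s.mem (m + j)))]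
      · ring
      · intro j hj
        have := Finset.mem_range.1 hj
        rw [Function.update_of_ne (by omega)]
  · rintro s ⟨hs, hk, hN, hF⟩
    exact ⟨hs, by omega, fun F => by simpa using hF F⟩

theorem hoare_block_eq (E : Env X) {i : Instr} {l : List Instr}
    (hdet : (i :: l).all Instr.det = true) {s : RamState X} {τ : ℕ} (hτ : runTime E i l s ≤ τ) :
    Hoare E (block i l) s τ fun s' => s' = run E i l s :=
  Hoare.block hdet hτ rfl

/-- The rounded-down parts add up to at most `m`, and so do the extra copies. Hence the table fits
into the memory between `m` and `3 * m`. -/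
theorem sum_quantized_le {m W : ℕ} (w : ℕ → ℕ) (hW : W = ∑ i ∈ Finset.range m, w i) (hpos : 0 < W) :
    ∑ i ∈ Finset.range m, (m * w i / W + 1) ≤ 2 * m := by
  have h1 : W * ∑ i ∈ Finset.range m, m * w i / W ≤ W * m := by
    calc W * ∑ i ∈ Finset.range m, m * w i / W = ∑ i ∈ Finset.range m, W * (m * w i / W) :=
          Finset.mul_sum _ _ _
      _ ≤ ∑ i ∈ Finset.range m, m * w i := Finset.sum_le_sum fun i _ => Nat.mul_div_le _ _
      _ = W * m := by rw [← Finset.mul_sum, ← hW, mul_comm]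
  have h2 := Nat.le_of_mul_le_mul_left h1 hpos
  rw [Finset.sum_add_distrib]
  simp
  omega

/-- The inner loops are amortized: their total length is that of the table, at most `2 * m`, so the
cost is `12 * m + 8 * (2 * m)` and not quadratic. -/
theorem tableLoop_spec (E : Env X) {m W : ℕ} (s₀ : RamState X) (h0 : s₀.reg 0 = m)
    (h3 : s₀.reg 3 = 1) (h10 : s₀.reg 10 = W) (h11 : s₀.reg 11 = 0) (h12 : s₀.reg 12 = m)
    (hW : W = ∑ i ∈ Finset.range m, s₀.mem i) (hpos : 0 < W) (hB : m * W < E.B)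
    (hB' : 3 * m + 1 < E.B) :
    Hoare E tableLoop s₀ (28 * m + 1) fun s =>
      Same [11, 12, 14, 15] m (3 * m) s₀ s ∧
      ∀ F : ℕ → ℕ, ∑ j ∈ Finset.range (s.reg 11), F (s.mem (m + j))
        = ∑ i ∈ Finset.range m, (m * s₀.mem i / W + 1) * F i := by
  have hq := sum_quantized_le s₀.mem hW hpos
  refine (Hoare.countdown (fun i => 11 + 8 * (m * s₀.mem i / W + 1)) (fun k s =>
      Same [11, 12, 14, 15] m (3 * m) s₀ s ∧ s.reg 12 = k ∧ k ≤ m ∧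
      ∀ F : ℕ → ℕ, ∑ j ∈ Finset.range (s.reg 11), F (s.mem (m + j))
        = ∑ i ∈ Finset.Ico k m, (m * s₀.mem i / W + 1) * F i)
    (fun k s h => h.2.1) ?_ m s₀ ⟨.refl _ _ _ _, h12, le_rfl, fun F => by simp [h11]⟩).mono ?_ ?_
  · rintro k s ⟨hs, hk, hkm, hF⟩
    have e0 := (hs.reg 0 (by decide)).trans h0
    have e3 := (hs.reg 3 (by decide)).trans h3
    have e10 := (hs.reg 10 (by decide)).trans h10
    have emem : s.mem k = s₀.mem k := hs.mem k (by omega)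
    have hle : s₀.mem k ≤ W := by
      rw [hW]
      exact Finset.single_le_sum (f := s₀.mem) (fun _ _ => Nat.zero_le _)
        (Finset.mem_range.2 (by omega))
    have hmul : m * s₀.mem k ≤ m * W := Nat.mul_le_mul_left m hle
    have hdiv : m * s₀.mem k / W ≤ m := by
      refine Nat.div_le_of_le_mul ?_
      rwa [mul_comm W]
    have m1 : (m * s₀.mem k) % E.B = m * s₀.mem k := Nat.mod_eq_of_lt (by omega)
    have m2 : (m * s₀.mem k / W + 1) % E.B = m * s₀.mem k / W + 1 :=
      Nat.mod_eq_of_lt (by omega)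
    have hN := hF fun _ => 1
    simp only [Finset.sum_const, Finset.card_range, smul_eq_mul, mul_one] at hN
    have hbot : ∀ F : ℕ → ℕ, ∑ i ∈ Finset.Ico k m, (m * s₀.mem i / W + 1) * F i
        = (m * s₀.mem k / W + 1) * F k
          + ∑ i ∈ Finset.Ico (k + 1) m, (m * s₀.mem i / W + 1) * F i :=
      fun F => Finset.sum_eq_sum_Ico_succ_bot (by omega) _
    have hsub : ∑ i ∈ Finset.Ico k m, (m * s₀.mem i / W + 1) ≤ 2 * m := by
      refine le_trans (Finset.sum_le_sum_of_subset fun i hi => ?_) hq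
      exact Finset.mem_range.2 (Finset.mem_Ico.1 hi).2
    have hb1 := hbot fun _ => 1
    simp only [mul_one] at hb1
    refine (Hoare.seq (hoare_block_eq E rfl (τ := 9) (by simp [runTime, Instr.time]))
      (τ₂ := (m * s₀.mem k / W + 1) * 8 + 1) (Q := fun s' =>
      Same [11, 12, 14, 15] m (3 * m) s₀ s' ∧ s'.reg 12 = k ∧ k ≤ m ∧
      ∀ F : ℕ → ℕ, ∑ j ∈ Finset.range (s'.reg 11), F (s'.mem (m + j))
        = ∑ i ∈ Finset.Ico k m, (m * s₀.mem i / W + 1) * F i) ?_).mono (by omega) fun _ h => h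
    rintro s' rfl
    refine (appendLoop_spec E (m := m) (hi := 3 * m) (i := k) (q := m * s₀.mem k / W + 1) _
      ?_ ?_ ?_ ?_ ?_ (by omega)).mono le_rfl ?_
    · simp [run, Instr.next, RamState.setReg, e0]
    · simp [run, Instr.next, RamState.setReg, e3]
    · simp [run, Instr.next, RamState.setReg, e3, hk]
    · simp [run, Instr.next, RamState.setReg, e3, hk, e0, e10, emem, m1, m2]
    · simp [run, Instr.next, RamState.setReg]
      omega
    · rintro s' ⟨hs', h11', hF'⟩
      have hb : Same [11, 12, 14, 15] m (3 * m) s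
          (run E (.sub 12 12 3) [.load 14 12, .mul 14 0 14, .div 14 14 10, .add 14 14 3] s) := by
        refine ⟨fun r hr => ?_, fun _ _ => rfl, rfl, rfl, rfl⟩
        simp at hr
        simp [run, Instr.next, RamState.setReg, hr]
      refine ⟨hs.trans (hb.trans (hs'.mono (by decide) le_rfl le_rfl)), ?_, by omega, ?_⟩
      · rw [hs'.reg 12 (by decide)]
        simp [run, Instr.next, RamState.setReg, e3, hk]
      · intro F
        rw [hF' F, hbot F, ← hF F]
        simp [run, Instr.next, RamState.setReg]
        ring
  · have : ∑ j ∈ Finset.range m, (11 + 8 * (m * s₀.mem j / W + 1) + 1)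
        = 12 * m + 8 * ∑ j ∈ Finset.range m, (m * s₀.mem j / W + 1) := by
      simp only [Finset.sum_add_distrib, ← Finset.mul_sum, Finset.sum_const, Finset.card_range,
        smul_eq_mul]
      omega
    omega
  · rintro s ⟨hs, -, -, hF⟩
    exact ⟨hs, fun F => by rw [hF F, Finset.range_eq_Ico]⟩

/-- Training indices, drawn from the table, are stored from the address in register `20` on. -/
def drawTableLoop : Prog :=
  .while 13 (.seq (.instr (.sub 13 13 3)) (.seq (.instr (.rand 14 11))
    (block (.add 14 0 14) [.load 14 14, .add 15 20 13, .store 15 14])))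

/-- The set `bad` of draws is left free; it is later instantiated with the training samples on which
the learner has large error. -/
theorem drawTableLoop_spec (E : Env X) {m N L base : ℕ} (s₀ : RamState X) (h0 : s₀.reg 0 = m)
    (h3 : s₀.reg 3 = 1) (h11 : s₀.reg 11 = N) (h13 : s₀.reg 13 = L) (h20 : s₀.reg 20 = base)
    (hN : 0 < N) (hbase : m + N ≤ base) (hB : base + L < E.B)
    (bad : (Fin L → Fin N) → Prop) [DecidablePred bad]
    (hbad : 2 * (Finset.univ.filter bad).card ≤ N ^ L) :
    HalfHoare E drawTableLoop s₀ (L * 12 + 1)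
      (fun s => ∃ g : Fin L → Fin N, ¬ bad g ∧ Same [13, 14, 15] base (base + L) s₀ s ∧
        ∀ j : Fin L, s.mem (base + j) = s₀.mem (m + g j))
      (fun s => ∃ g : Fin L → Fin N, Same [13, 14, 15] base (base + L) s₀ s ∧
        ∀ j : Fin L, s.mem (base + j) = s₀.mem (m + g j)) := by
  have key := HalfHoare.draws (E := E) (τ := 11) (r := 13)
    (p := .seq (.instr (.sub 13 13 3)) (.seq (.instr (.rand 14 11))
      (block (.add 14 0 14) [.load 14 14, .add 15 20 13, .store 15 14]))) hN
    (fun k v s => Same [13, 14, 15] base (base + L) s₀ s ∧ s.reg 13 = k ∧ k + v.length = L ∧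
      ∀ j (hj : j < v.length), s.mem (base + (k + j)) = s₀.mem (m + v[j]))
    (fun k v s h => h.2.1) ?_ L s₀ ⟨.refl _ _ _ _, h13, by simp, by simp⟩ bad hbad
  · have hfin : ∀ (g : Fin L → Fin N) (s : RamState X),
        (∀ j (hj : j < (List.ofFn fun j => (g j : ℕ)).length),
          s.mem (base + (0 + j)) = s₀.mem (m + (List.ofFn fun j => (g j : ℕ))[j])) →
        ∀ j : Fin L, s.mem (base + j) = s₀.mem (m + g j) := by
      intro g s h j
      have := h j (by simp)
      simpa using this
    refine key.mono le_rfl ?_ ?_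
    · rintro s ⟨g, hg, hs, -, -, hv⟩
      exact ⟨g, hg, hs, hfin g s hv⟩
    · rintro s ⟨g, hs, -, -, hv⟩
      exact ⟨g, hs, hfin g s hv⟩
  · rintro k v s ⟨hs, hk, hL, hv⟩ φ R hR
    have e0 := (hs.reg 0 (by decide)).trans h0
    have e3 := (hs.reg 3 (by decide)).trans h3
    have e11 := (hs.reg 11 (by decide)).trans h11
    have e20 := (hs.reg 20 (by decide)).trans h20
    refine ert_instr_seq_rand_seq_le (τ := 7) rfl rfl hN
      (by simp [Instr.next, RamState.setReg, e11]) _ (fun a ha => ?_) φ R hR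
    have m1 : (m + a) % E.B = m + a := Nat.mod_eq_of_lt (by omega)
    have m2 : (base + k) % E.B = base + k := Nat.mod_eq_of_lt (by omega)
    have emem : s.mem (m + a) = s₀.mem (m + a) := hs.mem _ (by omega)
    refine Hoare.block rfl (by simp [runTime, Instr.time])
      ⟨⟨?_, ?_, hs.hyp, hs.outPoints, hs.outBits⟩, ?_, ?_, ?_⟩
    · intro r hr
      have := hs.reg r hr
      simp at hr
      simp [run, Instr.next, RamState.setReg, hr, this]
    · intro b hb
      rw [← hs.mem b hb]
      have : b ≠ base + k := by omega
      simp [run, Instr.next, RamState.setReg, e0, e3, e20, hk, m2, this]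
    · simp [run, Instr.next, RamState.setReg, e3, hk]
    · simp only [List.length_cons]
      omega
    · intro j hj
      simp [run, Instr.next, RamState.setReg, e0, e3, e20, hk, m1, m2]
      cases j with
      | zero => simp [emem]
      | succ j =>
        have := hv j (by simpa using hj)
        rw [Function.update_of_ne (by omega), show k + (j + 1) = k + 1 + j by ring, this]
        rfl

/-- Indices of hypotheses are drawn and stored from the address in register `18` on. -/
def drawVotersLoop : Prog :=
  .while 13 (.seq (.instr (.sub 13 13 3)) (.seq (.instr (.rand 14 7))
    (block (.add 15 18 13) [.store 15 14])))

theorem drawVotersLoop_spec (E : Env X) {T n base : ℕ} (s₀ : RamState X)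
    (h3 : s₀.reg 3 = 1) (h7 : s₀.reg 7 = T) (h13 : s₀.reg 13 = n) (h18 : s₀.reg 18 = base)
    (hT : 0 < T) (hB : base + n < E.B)
    (bad : (Fin n → Fin T) → Prop) [DecidablePred bad]
    (hbad : 2 * (Finset.univ.filter bad).card ≤ T ^ n) :
    HalfHoare E drawVotersLoop s₀ (n * 8 + 1)
      (fun s => ∃ g : Fin n → Fin T, ¬ bad g ∧ Same [13, 14, 15] base (base + n) s₀ s ∧
        ∀ j : Fin n, s.mem (base + j) = g j)
      (fun s => ∃ g : Fin n → Fin T, Same [13, 14, 15] base (base + n) s₀ s ∧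
        ∀ j : Fin n, s.mem (base + j) = g j) := by
  have key := HalfHoare.draws (E := E) (τ := 7) (r := 13)
    (p := .seq (.instr (.sub 13 13 3)) (.seq (.instr (.rand 14 7))
      (block (.add 15 18 13) [.store 15 14]))) hT
    (fun k v s => Same [13, 14, 15] base (base + n) s₀ s ∧ s.reg 13 = k ∧ k + v.length = n ∧
      ∀ j (hj : j < v.length), s.mem (base + (k + j)) = v[j])
    (fun k v s h => h.2.1) ?_ n s₀ ⟨.refl _ _ _ _, h13, by simp, by simp⟩ bad hbad
  · have hfin : ∀ (g : Fin n → Fin T) (s : RamState X),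
        (∀ j (hj : j < (List.ofFn fun j => (g j : ℕ)).length),
          s.mem (base + (0 + j)) = (List.ofFn fun j => (g j : ℕ))[j]) →
        ∀ j : Fin n, s.mem (base + j) = g j := by
      intro g s h j
      have := h j (by simp)
      simpa using this
    refine key.mono le_rfl ?_ ?_
    · rintro s ⟨g, hg, hs, -, -, hv⟩
      exact ⟨g, hg, hs, hfin g s hv⟩
    · rintro s ⟨g, hs, -, -, hv⟩
      exact ⟨g, hs, hfin g s hv⟩
  · rintro k v s ⟨hs, hk, hL, hv⟩ φ R hR
    have e3 := (hs.reg 3 (by decide)).trans h3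
    have e7 := (hs.reg 7 (by decide)).trans h7
    have e18 := (hs.reg 18 (by decide)).trans h18
    refine ert_instr_seq_rand_seq_le (τ := 3) rfl rfl hT
      (by simp [Instr.next, RamState.setReg, e7]) _ (fun a ha => ?_) φ R hR
    have m2 : (base + k) % E.B = base + k := Nat.mod_eq_of_lt (by omega)
    refine Hoare.block rfl (by simp [runTime, Instr.time])
      ⟨⟨?_, ?_, hs.hyp, hs.outPoints, hs.outBits⟩, ?_, ?_, ?_⟩
    · intro r hr
      have := hs.reg r hr
      simp at hr
      simp [run, Instr.next, RamState.setReg, hr, this]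
    · intro b hb
      rw [← hs.mem b hb]
      have : b ≠ base + k := by omega
      simp [run, Instr.next, RamState.setReg, e3, e18, hk, m2, this]
    · simp [run, Instr.next, RamState.setReg, e3, hk]
    · simp only [List.length_cons]
      omega
    · intro j hj
      simp [run, Instr.next, RamState.setReg, e3, e18, hk, m2]
      cases j with
      | zero => simp
      | succ j =>
        have := hv j (by simpa using hj)
        rw [Function.update_of_ne (by omega), show k + (j + 1) = k + 1 + j by ring, this]
        rfl

/-! ### Weighted errors and reweighting -/

/-- Register `21` is increased by the weights of the sample points that are misclassified by the
hypothesis in slot register `9`. -/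
def errorLoop : Prog :=
  .while 12 (block (.sub 12 12 3) [.eval 14 9 12, .label 15 12, .sub 16 14 15, .sub 17 15 14,
    .add 16 16 17, .load 14 12, .mul 14 14 16, .add 21 21 14])

/-- The weights of the sample points that are misclassified by the hypothesis in slot register `9`
are doubled. -/
def updateLoop : Prog :=
  .while 12 (block (.sub 12 12 3) [.eval 14 9 12, .label 15 12, .sub 16 14 15, .sub 17 15 14,
    .add 16 16 17, .load 14 12, .mul 16 14 16, .add 14 14 16, .store 12 14])

/-- `1` if the Boolean values differ, else `0`. -/
def mistake (a b : Bool) : ℕ := if a ≠ b then 1 else 0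

/-- Truncated subtraction in both directions computes the exclusive or without branching. -/
theorem mistake_eq (a b : Bool) : a.toNat - b.toNat + (b.toNat - a.toNat) = mistake a b := by
  cases a <;> cases b <;> rfl

theorem mistake_le (a b : Bool) : mistake a b ≤ 1 := by
  cases a <;> cases b <;> decide

theorem toNat_mod {B : ℕ} (hB : 1 < B) (a : Bool) : a.toNat % B = a.toNat :=
  Nat.mod_eq_of_lt (lt_of_le_of_lt (Bool.toNat_le a) hB)

theorem errorLoop_spec (E : Env X) {m ℓ : ℕ} {pt : ℕ → X} {f h : X → Bool}
    (hE : ∀ i < m, E.sample[i]? = some (pt i, f (pt i))) (s₀ : RamState X)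
    (h3 : s₀.reg 3 = 1) (h12 : s₀.reg 12 = m) (h21 : s₀.reg 21 = 0)
    (hh : s₀.hyp (s₀.reg 9) = (ℓ, h)) (hB1 : 1 < E.B)
    (hB : ∑ i ∈ Finset.range m, s₀.mem i < E.B) :
    Hoare E errorLoop s₀ (m * (18 + E.TE ℓ) + 1) fun s =>
      Same [12, 14, 15, 16, 17, 21] 0 0 s₀ s ∧
      s.reg 21 = ∑ i ∈ Finset.range m, s₀.mem i * mistake (h (pt i)) (f (pt i)) := by
  refine (Hoare.countdown_const (τ := 17 + E.TE ℓ) (fun k s =>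
      Same [12, 14, 15, 16, 17, 21] 0 0 s₀ s ∧ s.reg 12 = k ∧ k ≤ m ∧
      s.reg 21 = ∑ i ∈ Finset.Ico k m, s₀.mem i * mistake (h (pt i)) (f (pt i)))
    (fun k s h => h.2.1) ?_ m s₀ ⟨.refl _ _ _ _, h12, le_rfl, by simp [h21]⟩).mono
      (by apply le_of_eq; ring) ?_
  · rintro k s ⟨hs, hk, hkm, h21⟩
    have e3 := (hs.reg 3 (by decide)).trans h3
    have e9 := hs.reg 9 (by decide)
    have ehyp : s.hyp (s.reg 9) = (ℓ, h) := by rw [hs.hyp, e9, hh]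
    have emem : s.mem k = s₀.mem k := hs.mem k (by omega)
    have hsub : ∑ i ∈ Finset.Ico k m, s₀.mem i * mistake (h (pt i)) (f (pt i)) < E.B := by
      refine lt_of_le_of_lt (le_trans ?_ (Finset.sum_le_sum_of_subset (s := Finset.Ico k m)
        (fun i hi => Finset.mem_range.2 (Finset.mem_Ico.1 hi).2))) hB
      exact Finset.sum_le_sum fun i _ =>
        (Nat.mul_le_mul_left _ (mistake_le _ _)).trans_eq (mul_one _)
    rw [Finset.sum_eq_sum_Ico_succ_bot (by omega), ← h21] at hsub
    have m1 : mistake (h (pt k)) (f (pt k)) % E.B = mistake (h (pt k)) (f (pt k)) :=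
      Nat.mod_eq_of_lt (lt_of_le_of_lt (mistake_le _ _) hB1)
    have m2 : (s₀.mem k * mistake (h (pt k)) (f (pt k))) % E.B
        = s₀.mem k * mistake (h (pt k)) (f (pt k)) := Nat.mod_eq_of_lt (by omega)
    have m3 : (s.reg 21 + s₀.mem k * mistake (h (pt k)) (f (pt k))) % E.B
        = s.reg 21 + s₀.mem k * mistake (h (pt k)) (f (pt k)) := Nat.mod_eq_of_lt (by omega)
    refine Hoare.block rfl ?_ ⟨⟨?_, ?_, hs.hyp, hs.outPoints, hs.outBits⟩, ?_, by omega, ?_⟩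
    · simp [runTime, Instr.time, Instr.next, RamState.setReg, ehyp]
      omega
    · intro r hr
      have := hs.reg r hr
      simp at hr
      simp [run, Instr.next, RamState.setReg, hr, this]
    · intro a ha
      rw [← hs.mem a ha]
      rfl
    · simp [run, Instr.next, RamState.setReg, e3, hk]
    · rw [Finset.sum_eq_sum_Ico_succ_bot (by omega), ← h21]
      simp [run, Instr.next, RamState.setReg, e3, hk, hE k (by omega), ehyp, toNat_mod hB1,
        mistake_eq, m1, emem, m2, m3]
      ring
  · rintro s ⟨hs, -, -, h21⟩
    exact ⟨hs, by rw [h21, Finset.range_eq_Ico]⟩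

theorem updateLoop_spec (E : Env X) {m ℓ : ℕ} {pt : ℕ → X} {f h : X → Bool}
    (hE : ∀ i < m, E.sample[i]? = some (pt i, f (pt i))) (s₀ : RamState X)
    (h3 : s₀.reg 3 = 1) (h12 : s₀.reg 12 = m)
    (hh : s₀.hyp (s₀.reg 9) = (ℓ, h)) (hB1 : 1 < E.B)
    (hB : ∀ i < m, 2 * s₀.mem i < E.B) :
    Hoare E updateLoop s₀ (m * (20 + E.TE ℓ) + 1) fun s =>
      Same [12, 14, 15, 16, 17] 0 m s₀ s ∧
      ∀ i < m, s.mem i = s₀.mem i * 2 ^ mistake (h (pt i)) (f (pt i)) := by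
  refine (Hoare.countdown_const (τ := 19 + E.TE ℓ) (fun k s =>
      Same [12, 14, 15, 16, 17] 0 m s₀ s ∧ s.reg 12 = k ∧ k ≤ m ∧
      (∀ i < k, s.mem i = s₀.mem i) ∧
      ∀ i, k ≤ i → i < m → s.mem i = s₀.mem i * 2 ^ mistake (h (pt i)) (f (pt i)))
    (fun k s h => h.2.1) ?_ m s₀
    ⟨.refl _ _ _ _, h12, le_rfl, fun _ _ => rfl, fun i hi hi' => by omega⟩).mono
      (by apply le_of_eq; ring) ?_
  · rintro k s ⟨hs, hk, hkm, hlt, hge⟩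
    have e3 := (hs.reg 3 (by decide)).trans h3
    have e9 := hs.reg 9 (by decide)
    have ehyp : s.hyp (s.reg 9) = (ℓ, h) := by rw [hs.hyp, e9, hh]
    have emem : s.mem k = s₀.mem k := hlt k (by omega)
    have hle := mistake_le (h (pt k)) (f (pt k))
    have hlt2 := hB k (by omega)
    have hml : s₀.mem k * mistake (h (pt k)) (f (pt k)) ≤ s₀.mem k :=
      (Nat.mul_le_mul_left _ hle).trans_eq (mul_one _)
    have m1 : mistake (h (pt k)) (f (pt k)) % E.B = mistake (h (pt k)) (f (pt k)) :=
      Nat.mod_eq_of_lt (lt_of_le_of_lt (mistake_le _ _) hB1)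
    have m2 : (s₀.mem k * mistake (h (pt k)) (f (pt k))) % E.B
        = s₀.mem k * mistake (h (pt k)) (f (pt k)) := Nat.mod_eq_of_lt (by omega)
    have m3 : (s₀.mem k + s₀.mem k * mistake (h (pt k)) (f (pt k))) % E.B
        = s₀.mem k + s₀.mem k * mistake (h (pt k)) (f (pt k)) := Nat.mod_eq_of_lt (by omega)
    have hpow : s₀.mem k + s₀.mem k * mistake (h (pt k)) (f (pt k))
        = s₀.mem k * 2 ^ mistake (h (pt k)) (f (pt k)) := by
      interval_cases mistake (h (pt k)) (f (pt k)) <;> omega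
    have hmem : (run E (.sub 12 12 3) [.eval 14 9 12, .label 15 12, .sub 16 14 15, .sub 17 15 14,
        .add 16 16 17, .load 14 12, .mul 16 14 16, .add 14 14 16, .store 12 14] s).mem
        = Function.update s.mem k (s₀.mem k * 2 ^ mistake (h (pt k)) (f (pt k))) := by
      simp [run, Instr.next, RamState.setReg, e3, hk, hE k (by omega), ehyp, toNat_mod hB1,
        mistake_eq, m1, emem, m2, m3.trans hpow]
    refine Hoare.block rfl ?_ ⟨⟨?_, ?_, hs.hyp, hs.outPoints, hs.outBits⟩, ?_, by omega, ?_, ?_⟩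
    · simp [runTime, Instr.time, Instr.next, RamState.setReg, ehyp]
      omega
    · intro r hr
      have := hs.reg r hr
      simp at hr
      simp [run, Instr.next, RamState.setReg, hr, this]
    · intro a ha
      rw [← hs.mem a ha, hmem, Function.update_of_ne (by omega)]
    · simp [run, Instr.next, RamState.setReg, e3, hk]
    · intro i hi
      rw [hmem, Function.update_of_ne (by omega), hlt i (by omega)]
    · intro i hi hi'
      rw [hmem]
      by_cases hik : i = k
      · subst hik
        simp
      · rw [Function.update_of_ne hik, hge i (by omega) hi']
  · rintro s ⟨hs, -, -, -, hge⟩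
    exact ⟨hs, fun i hi => hge i (Nat.zero_le _) hi⟩

/-- The training sample whose indices are stored from the address `base` on. -/
def group (pt : ℕ → X) (f : X → Bool) (L base : ℕ) (mem : ℕ → ℕ) : List (X × Bool) :=
  labelled f ((List.range L).map fun j => pt (mem (base + j)))

theorem group_congr {pt : ℕ → X} {f : X → Bool} {L base : ℕ} {mem mem' : ℕ → ℕ}
    (h : ∀ j < L, mem (base + j) = mem' (base + j)) :
    group pt f L base mem = group pt f L base mem' := by
  unfold group
  congr 1
  exact List.map_congr_left fun j hj => by rw [h j (List.mem_range.1 hj)]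

theorem group_eq_ofFn {pt : ℕ → X} {f : X → Bool} {L base : ℕ} {mem : ℕ → ℕ} (y : Fin L → X)
    (h : ∀ j : Fin L, pt (mem (base + j)) = y j) :
    group pt f L base mem = labelled f (List.ofFn y) := by
  unfold group
  congr 1
  refine List.ext_getElem (by simp) fun j h1 h2 => ?_
  simp at h1
  simpa using h ⟨j, h1⟩

theorem subsample_eq_group {E : Env X} {m L base : ℕ} {pt : ℕ → X} {f : X → Bool}
    (hE : ∀ i < m, E.sample[i]? = some (pt i, f (pt i))) (s : RamState X)
    (h : ∀ j < L, s.mem (base + j) < m) :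
    s.subsample E base L = group pt f L base s.mem := by
  unfold RamState.subsample group labelled
  rw [List.map_map, ← List.filterMap_eq_map]
  exact List.filterMap_congr fun j hj => hE _ (h j (List.mem_range.1 hj))

theorem length_group (pt : ℕ → X) (f : X → Bool) (L base : ℕ) (mem : ℕ → ℕ) :
    (group pt f L base mem).length = L := by
  simp [group, labelled]

/-- A hypothesis with small error on the quantized table has small weighted error. -/
theorem four_mul_weighted_error_le {m W N : ℕ} (w tbl e : ℕ → ℕ) (hm : 0 < m)
    (hW : W = ∑ i ∈ Finset.range m, w i) (hpos : 0 < W)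
    (hF : ∀ F : ℕ → ℕ, ∑ j ∈ Finset.range N, F (tbl j)
      = ∑ i ∈ Finset.range m, (m * w i / W + 1) * F i)
    (he : 8 * ∑ j ∈ Finset.range N, e (tbl j) < N) :
    4 * ∑ i ∈ Finset.range m, w i * e i ≤ W := by
  have hN := hF fun _ => 1
  simp only [Finset.sum_const, Finset.card_range, smul_eq_mul, mul_one] at hN
  have hN2 := sum_quantized_le w hW hpos
  rw [← hN] at hN2
  rw [hF e] at he
  set S := ∑ i ∈ Finset.range m, (m * w i / W + 1) * e i
  -- The extra copy pays for rounding down: `m * w i ≤ W * (m * w i / W + 1)`. Since `8 * S < N ≤ 2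
  -- * m`, passing from the table to the weights costs a factor of 2, from 1/8 to 1/4.
  have h1 : m * ∑ i ∈ Finset.range m, w i * e i ≤ W * S := by
    rw [Finset.mul_sum, Finset.mul_sum]
    refine Finset.sum_le_sum fun i _ => ?_
    rw [← mul_assoc, ← mul_assoc]
    refine Nat.mul_le_mul_right _ ?_
    exact (Nat.lt_mul_div_succ _ hpos).le
  have h2 : m * (4 * ∑ i ∈ Finset.range m, w i * e i) ≤ m * W := by
    have h3 : W * (8 * S) ≤ W * (2 * m) := Nat.mul_le_mul_left W (by omega)
    nlinarith
  exact Nat.le_of_mul_le_mul_left h2 hm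

/-! ### The boosting invariant -/

/-- The contents of the registers that stay fixed during boosting. -/
structure Base (m L n T : ℕ) (s : RamState X) : Prop where
  r0 : s.reg 0 = m
  r3 : s.reg 3 = 1
  r4 : s.reg 4 = L
  r5 : s.reg 5 = n
  r7 : s.reg 7 = T
  r18 : s.reg 18 = 3 * m
  r19 : s.reg 19 = 4 * m
  r30 : s.reg 30 = 0
  outPoints : s.outPoints = []
  outBits : s.outBits = []

theorem Base.congr {m L n T : ℕ} {s s' : RamState X} (h : Base m L n T s)
    (hreg : ∀ r ∈ [0, 3, 4, 5, 7, 18, 19, 30], s'.reg r = s.reg r)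
    (hp : s'.outPoints = s.outPoints) (hb : s'.outBits = s.outBits) : Base m L n T s' where
  r0 := (hreg 0 (by decide)).trans h.r0
  r3 := (hreg 3 (by decide)).trans h.r3
  r4 := (hreg 4 (by decide)).trans h.r4
  r5 := (hreg 5 (by decide)).trans h.r5
  r7 := (hreg 7 (by decide)).trans h.r7
  r18 := (hreg 18 (by decide)).trans h.r18
  r19 := (hreg 19 (by decide)).trans h.r19
  r30 := (hreg 30 (by decide)).trans h.r30
  outPoints := hp.trans h.outPoints
  outBits := hb.trans h.outBits

theorem Same.base {rs : List ℕ} {lo hi m L n T : ℕ} {s s' : RamState X} (h : Same rs lo hi s s')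
    (hs : Base m L n T s) (hrs : ∀ r ∈ [0, 3, 4, 5, 7, 18, 19, 30], r ∉ rs) :
    Base m L n T s' :=
  hs.congr (fun r hr => h.reg r (hrs r hr)) h.outPoints h.outBits

/-- The state of the boosting algorithm when `rem` of the `T` rounds remain. -/
structure Boosted (A : Learner X) (pt : ℕ → X) (f : X → Bool) (m L T rem : ℕ)
    (s : RamState X) : Prop where
  rem_le : rem ≤ T
  r8 : s.reg 8 = rem
  idx : ∀ t, rem ≤ t → t < T → ∀ j < L, s.mem (4 * m + t * L + j) < m
  hyp : ∀ t, rem ≤ t → t < T → s.hyp t = (L, A (group pt f L (4 * m + t * L) s.mem))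
  weight : ∀ i < m, s.mem i
    = 2 ^ ∑ t ∈ Finset.Ico rem T, mistake ((s.hyp t).2 (pt i)) (f (pt i))
  total : s.reg 10 = ∑ i ∈ Finset.range m, s.mem i
  potential : 4 ^ (T - rem) * s.reg 10 ≤ 5 ^ (T - rem) * m

/-- The frame rule of the invariant. Rounds are numbered downwards, so only the weights below `m`,
the training indices from `4 * m + rem * L` on and the slots from `rem` on matter. The table in `[m,
3 * m)`, the drawn voters in `[3 * m, 4 * m)` and the sample of the current attempt are scratch
space. -/
theorem Boosted.congr {A : Learner X} {pt : ℕ → X} {f : X → Bool} {m L T rem : ℕ}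
    {s s' : RamState X} (h : Boosted A pt f m L T rem s) (h8 : s'.reg 8 = s.reg 8)
    (h10 : s'.reg 10 = s.reg 10) (hmem : ∀ a, (a < m ∨ 4 * m + rem * L ≤ a) → s'.mem a = s.mem a)
    (hhyp : ∀ t, rem ≤ t → s'.hyp t = s.hyp t) : Boosted A pt f m L T rem s' where
  rem_le := h.rem_le
  r8 := h8.trans h.r8
  idx t ht ht' j hj := by
    have : rem * L ≤ t * L := Nat.mul_le_mul_right L ht
    rw [hmem _ (Or.inr (by omega))]
    exact h.idx t ht ht' j hj
  hyp t ht ht' := by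
    rw [hhyp t ht, h.hyp t ht ht']
    have : rem * L ≤ t * L := Nat.mul_le_mul_right L ht
    rw [group_congr fun j _ => (hmem _ (Or.inr (by omega)))]
  weight i hi := by
    rw [hmem i (Or.inl hi), h.weight i hi]
    congr 1
    exact Finset.sum_congr rfl fun t ht => by rw [hhyp t (Finset.mem_Ico.1 ht).1]
  total := by
    rw [h10, h.total]
    exact Finset.sum_congr rfl fun i hi => (hmem i (Or.inl (Finset.mem_range.1 hi))).symm
  potential := by rw [h10]; exact h.potential

/-- The crude growth rate 2 in place of 5/4 suffices to exclude overflow of machine words. -/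
theorem Boosted.total_le {A : Learner X} {pt : ℕ → X} {f : X → Bool} {m L T rem : ℕ}
    {s : RamState X} (h : Boosted A pt f m L T rem s) : s.reg 10 ≤ m * 2 ^ T := by
  have h1 : 4 ^ (T - rem) * s.reg 10 ≤ 4 ^ (T - rem) * (m * 2 ^ T) := by
    calc 4 ^ (T - rem) * s.reg 10 ≤ 5 ^ (T - rem) * m := h.potential
      _ ≤ 8 ^ (T - rem) * m := by gcongr; norm_num
      _ = 4 ^ (T - rem) * (m * 2 ^ (T - rem)) := by
          rw [show (8 : ℕ) = 4 * 2 by norm_num, mul_pow]; ring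
      _ ≤ 4 ^ (T - rem) * (m * 2 ^ T) := by gcongr <;> omega
  exact Nat.le_of_mul_le_mul_left h1 (by positivity)

theorem Boosted.total_pos {A : Learner X} {pt : ℕ → X} {f : X → Bool} {m L T rem : ℕ}
    {s : RamState X} (h : Boosted A pt f m L T rem s) (hm : 0 < m) : 0 < s.reg 10 := by
  rw [h.total]
  refine Finset.sum_pos (fun i hi => ?_) ⟨0, Finset.mem_range.2 hm⟩
  rw [h.weight i (Finset.mem_range.1 hi)]
  positivity

/-! ### One boosting round -/

/-- Draw a training sample for the next round. -/
def drawSample : Prog :=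
  .seq (block (.sub 9 8 3) [.mul 20 9 4, .add 20 20 19, .const 11 0, .add 12 0 30])
    (.seq tableLoop (.seq (block (.add 13 4 30) []) drawTableLoop))

/-- The good draws are those of `card_large_error_le` for the table, and
`four_mul_weighted_error_le` converts their error to the weights. Every draw, good or bad, yields
valid sample indices. -/
theorem drawSample_spec {E : Env X} {C : Set (X → Bool)} {m d L n T rem : ℕ} {pt : ℕ → X}
    {f : X → Bool} (hC : vcDim C ≤ d) (hd : 0 < d) (hLd : L = 2 ^ 14 * d)
    (hA : E.learner.Proper C) (hA' : E.learner.Consistent C) (hf : f ∈ C)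
    (hm : 0 < m) (hLm : L ≤ m) (hB : 10 * (m ^ 2 * 2 ^ T) < E.B) (s : RamState X)
    (hbase : Base m L n T s) (hs : Boosted E.learner pt f m L T (rem + 1) s) :
    HalfHoare E drawSample s (40 * m + 15)
      (fun s' => (Same [9, 11, 12, 13, 14, 15, 20] m (4 * m + rem * L + L) s s' ∧
        s'.reg 9 = rem ∧ s'.reg 20 = 4 * m + rem * L ∧
        ∀ j < L, s'.mem (4 * m + rem * L + j) < m) ∧
        4 * ∑ i ∈ Finset.range m, s.mem i *
          mistake (E.learner (group pt f L (4 * m + rem * L) s'.mem) (pt i)) (f (pt i))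
            ≤ s.reg 10)
      (fun s' => Same [9, 11, 12, 13, 14, 15, 20] m (4 * m + rem * L + L) s s' ∧
        s'.reg 9 = rem ∧ s'.reg 20 = 4 * m + rem * L ∧
        ∀ j < L, s'.mem (4 * m + rem * L + j) < m) := by
  have hpos := hs.total_pos hm
  have hle := hs.total_le
  have hT : T ≤ 2 ^ T := Nat.lt_two_pow_self.le
  have hmm : m * 2 ^ T ≤ m ^ 2 * 2 ^ T := Nat.mul_le_mul_right _ (by nlinarith)
  have hm1 : m * 1 ≤ m * 2 ^ T := Nat.mul_le_mul_left m Nat.one_le_two_pow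
  have hTL : T * L ≤ m * 2 ^ T := by rw [mul_comm m]; exact Nat.mul_le_mul hT hLm
  have hremL : rem * L ≤ T * L := Nat.mul_le_mul_right L (by have := hs.rem_le; omega)
  have hmW : m * s.reg 10 ≤ m ^ 2 * 2 ^ T := by
    rw [pow_two, mul_assoc]
    exact Nat.mul_le_mul_left m hle
  set base := 4 * m + rem * L with hbase'
  have e8 := hs.r8
  have m1 : (rem * L) % E.B = rem * L := Nat.mod_eq_of_lt (by omega)
  have m2 : (rem * L + 4 * m) % E.B = base := by
    rw [Nat.mod_eq_of_lt (by omega), add_comm]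
  have m3 : m % E.B = m := Nat.mod_eq_of_lt (by omega)
  have m4 : L % E.B = L := Nat.mod_eq_of_lt (by omega)
  refine HalfHoare.mono (Hoare.seq_half (hoare_block_eq E rfl (τ := 9)
    (by simp [runTime, Instr.time])) (τ₂ := 28 * m + 12 * L + 5) ?_) (by omega)
    (fun _ h => h) (fun _ h => h)
  rintro s₁ rfl
  set s₁ := run E (.sub 9 8 3) [.mul 20 9 4, .add 20 20 19, .const 11 0, .add 12 0 30] s with hs₁
  have hsame₁ : Same [9, 11, 12, 13, 14, 15, 20] m (base + L) s s₁ := by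
    refine ⟨fun r hr => ?_, fun _ _ => rfl, rfl, rfl, rfl⟩
    simp at hr
    simp [hs₁, run, Instr.next, RamState.setReg, hr]
  have h9 : s₁.reg 9 = rem := by
    simp [hs₁, run, Instr.next, RamState.setReg, e8, hbase.r3]
  have h20 : s₁.reg 20 = base := by
    simp [hs₁, run, Instr.next, RamState.setReg, e8, hbase.r3, hbase.r4, hbase.r19, m1, m2]
  have h11 : s₁.reg 11 = 0 := by
    simp [hs₁, run, Instr.next, RamState.setReg]
  have h12 : s₁.reg 12 = m := by
    simp [hs₁, run, Instr.next, RamState.setReg, hbase.r0, hbase.r30, m3]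
  have hb₁ : Base m L n T s₁ := hsame₁.base hbase (by decide)
  have hmem₁ : s₁.mem = s.mem := rfl
  have h10 : s₁.reg 10 = s.reg 10 := hsame₁.reg 10 (by decide)
  clear_value s₁
  refine HalfHoare.mono (Hoare.seq_half (tableLoop_spec E s₁ hb₁.r0 hb₁.r3 h10 h11 h12
    (by rw [hmem₁]; exact hs.total) hpos (by omega) (by omega)) (τ₂ := 12 * L + 3) ?_) (by omega)
    (fun _ h => h) (fun _ h => h)
  rintro s₂ ⟨hsame₂, hF⟩
  rw [hmem₁] at hF
  refine HalfHoare.mono (Hoare.seq_half (hoare_block_eq E rfl (τ := 1)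
    (by simp [runTime, Instr.time])) (τ₂ := 12 * L + 1) ?_) (by omega)
    (fun _ h => h) (fun _ h => h)
  rintro s₃ rfl
  set s₃ := run E (.add 13 4 30) [] s₂ with hs₃
  have hb₂ : Base m L n T s₂ := hsame₂.base hb₁ (by decide)
  have hsame₃ : Same [9, 11, 12, 13, 14, 15, 20] m (base + L) s s₃ := by
    refine (hsame₁.trans (hsame₂.mono (by decide) le_rfl (by omega))).trans
      ⟨fun r hr => ?_, fun _ _ => rfl, rfl, rfl, rfl⟩
    simp at hr
    simp [hs₃, run, Instr.next, RamState.setReg, hr]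
  have hb₃ : Base m L n T s₃ := hsame₃.base hbase (by decide)
  have g13 : s₃.reg 13 = L := by
    simp [hs₃, run, Instr.next, RamState.setReg, hb₂.r4, hb₂.r30, m4]
  have g9 : s₃.reg 9 = rem := by
    rw [← h9, ← hsame₂.reg 9 (by decide)]
    simp [hs₃, run, Instr.next, RamState.setReg]
  have g20 : s₃.reg 20 = base := by
    rw [← h20, ← hsame₂.reg 20 (by decide)]
    simp [hs₃, run, Instr.next, RamState.setReg]
  have g11 : s₃.reg 11 = s₂.reg 11 := by
    simp [hs₃, run, Instr.next, RamState.setReg]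
  have gmem : s₃.mem = s₂.mem := rfl
  clear_value s₃
  rw [← gmem, ← g11] at hF
  generalize hN : s₃.reg 11 = N at hF
  have hN1 := hF fun _ => 1
  simp only [Finset.sum_const, Finset.card_range, smul_eq_mul, mul_one] at hN1
  have hN2 := sum_quantized_le s.mem hs.total hpos
  rw [← hN1] at hN2
  have hNpos : 0 < N := by
    rw [hN1]
    exact Finset.sum_pos (fun i _ => Nat.succ_pos _) ⟨0, Finset.mem_range.2 hm⟩
  have hrange : ∀ a < N, s₃.mem (m + a) < m := by
    intro a ha
    -- Summing the indicator of invalid indices over the table gives zero, so all entries are valid.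
    have h1 := hF fun i => if i < m then 0 else 1
    have h2 : ∑ i ∈ Finset.range m, (m * s.mem i / s.reg 10 + 1) * (if i < m then 0 else 1) = 0 :=
      Finset.sum_eq_zero fun i hi => by simp [Finset.mem_range.1 hi]
    rw [h2, Finset.sum_eq_zero_iff] at h1
    have := h1 a (Finset.mem_range.2 ha)
    by_contra hcon
    simp [hcon] at this
  classical
  let tb : Fin N → X := fun a => pt (s₃.mem (m + a))
  refine (drawTableLoop_spec E s₃ hb₃.r0 hb₃.r3 hN g13 g20 hNpos (by omega) (by omega) _
    (card_large_error_le hC hd hLd hNpos hA hA' hf tb)).mono (by omega) ?_ ?_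
  · rintro s₄ ⟨g, hg, hsame₄, hv⟩
    refine ⟨⟨hsame₃.trans (hsame₄.mono (by decide) (by omega) le_rfl), ?_, ?_, ?_⟩, ?_⟩
    · rw [hsame₄.reg 9 (by decide), g9]
    · rw [hsame₄.reg 20 (by decide), g20]
    · intro j hj
      rw [hv ⟨j, hj⟩]
      exact hrange _ (g ⟨j, hj⟩).2
    · rw [group_eq_ofFn (fun j => tb (g j)) fun j => by rw [hv j]]
      rw [not_le, Finset.card_filter] at hg
      refine four_mul_weighted_error_le s.mem (fun a => s₃.mem (m + a))
        (fun i => mistake (E.learner (labelled f (List.ofFn fun j => tb (g j))) (pt i))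
          (f (pt i))) hm hs.total hpos hF ?_
      rw [← Fin.sum_univ_eq_sum_range (fun a => mistake (E.learner (labelled f
        (List.ofFn fun j => tb (g j))) (pt (s₃.mem (m + a)))) (f (pt (s₃.mem (m + a))))) N]
      exact hg
  · rintro s₄ ⟨g, hsame₄, hv⟩
    refine ⟨hsame₃.trans (hsame₄.mono (by decide) (by omega) le_rfl), ?_, ?_, ?_⟩
    · rw [hsame₄.reg 9 (by decide), g9]
    · rw [hsame₄.reg 20 (by decide), g20]
    · intro j hj
      rw [hv ⟨j, hj⟩]
      exact hrange _ (g ⟨j, hj⟩).2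

/-- Register `31` is used nowhere else, so this has no effect on the invariants. -/
def skip : Prog := block (.const 31 0) []

/-- Train on the drawn sample and compute the weighted error. -/
def learnAndTest : Prog :=
  .seq (block (.learn 9 20 4) [.const 21 0, .add 12 0 30]) errorLoop

/-- Accept the new hypothesis if its weighted error is at most `1/4`. -/
def finishRound : Prog :=
  .seq (block (.add 16 21 21) [.add 16 16 16, .sub 16 16 10]) (.ite 16 skip
    (.seq (block (.add 12 0 30) []) (.seq updateLoop (block (.add 10 10 21) [.add 8 9 30]))))

theorem learnAndTest_spec {E : Env X} {m L n T rem base : ℕ} {pt : ℕ → X} {f : X → Bool}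
    (hE : ∀ i < m, E.sample[i]? = some (pt i, f (pt i))) (hB1 : 1 < E.B) (hmB : m < E.B)
    (s : RamState X) (hbase : Base m L n T s) (h9 : s.reg 9 = rem) (h20 : s.reg 20 = base)
    (hidx : ∀ j < L, s.mem (base + j) < m) (hB : ∑ i ∈ Finset.range m, s.mem i < E.B) :
    Hoare E learnAndTest s (L + E.TA L + m * (18 + E.TE L) + 8) fun s' =>
      Same [12, 14, 15, 16, 17, 21] 0 0
        { s with hyp := Function.update s.hyp rem (L, E.learner (group pt f L base s.mem)) } s' ∧
      s'.reg 21 = ∑ i ∈ Finset.range m, s.mem i *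
        mistake (E.learner (group pt f L base s.mem) (pt i)) (f (pt i)) := by
  have hsub := subsample_eq_group hE s hidx
  have m3 : m % E.B = m := Nat.mod_eq_of_lt hmB
  refine Hoare.mono (Hoare.seq (hoare_block_eq E rfl (τ := L + E.TA L + 5) ?_)
    (τ₂ := m * (18 + E.TE L) + 1) ?_) (by omega) (fun _ h => h)
  · simp [runTime, Instr.time, hbase.r4, h20, hsub, length_group]
    omega
  · rintro s₁ rfl
    set h := E.learner (group pt f L base s.mem)
    set s₁ := run E (.learn 9 20 4) [.const 21 0, .add 12 0 30] s with hs₁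
    have hsame : Same [12, 14, 15, 16, 17, 21] 0 0
        { s with hyp := Function.update s.hyp rem (L, h) } s₁ := by
      refine ⟨fun r hr => ?_, fun _ _ => rfl, ?_, rfl, rfl⟩
      · simp at hr
        simp [hs₁, run, Instr.next, RamState.setReg, hr]
      · simp [hs₁, run, Instr.next, RamState.setReg, h9, h20, hbase.r4, hsub, length_group, h]
    refine (errorLoop_spec E (ℓ := L) (h := h) hE s₁ ?_ ?_ ?_ ?_ hB1 hB).mono le_rfl ?_
    · simp [hs₁, run, Instr.next, RamState.setReg, hbase.r3]
    · simp [hs₁, run, Instr.next, RamState.setReg, hbase.r0, hbase.r30, m3]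
    · simp [hs₁, run, Instr.next, RamState.setReg]
    · rw [hsame.hyp, hsame.reg 9 (by decide)]
      simp [h9]
    · rintro s' ⟨hs', h21⟩
      exact ⟨hsame.trans hs', h21⟩

/-- Doubling the weights of the misclassified points adds exactly the weighted error to the total.
An error of at most a quarter therefore multiplies the total by at most 5/4. -/
theorem Boosted.accept {A : Learner X} {pt : ℕ → X} {f h : X → Bool} {m L T rem : ℕ}
    {s s' : RamState X} (hs : Boosted A pt f m L T (rem + 1) s) (h8 : s'.reg 8 = rem)
    (hmem : ∀ a, 4 * m + (rem + 1) * L ≤ a → s'.mem a = s.mem a)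
    (hhyp : s'.hyp = Function.update s.hyp rem (L, h))
    (hidx : ∀ j < L, s'.mem (4 * m + rem * L + j) < m)
    (hh : h = A (group pt f L (4 * m + rem * L) s'.mem))
    (hw : ∀ i < m, s'.mem i = s.mem i * 2 ^ mistake (h (pt i)) (f (pt i)))
    (h10 : s'.reg 10 = s.reg 10 + ∑ i ∈ Finset.range m, s.mem i * mistake (h (pt i)) (f (pt i)))
    (herr : 4 * ∑ i ∈ Finset.range m, s.mem i * mistake (h (pt i)) (f (pt i)) ≤ s.reg 10) :
    Boosted A pt f m L T rem s' where
  rem_le := by have := hs.rem_le; omega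
  r8 := h8
  idx t ht ht' j hj := by
    by_cases htr : t = rem
    · subst htr
      exact hidx j hj
    · have : (rem + 1) * L ≤ t * L := Nat.mul_le_mul_right L (by omega)
      rw [hmem _ (by omega)]
      exact hs.idx t (by omega) ht' j hj
  hyp t ht ht' := by
    rw [hhyp]
    by_cases htr : t = rem
    · subst htr
      simp [hh]
    · have : (rem + 1) * L ≤ t * L := Nat.mul_le_mul_right L (by omega)
      rw [Function.update_of_ne htr, hs.hyp t (by omega) ht',
        group_congr fun j _ => (hmem _ (by omega))]
  weight i hi := by
    have := hs.rem_le
    rw [hw i hi, hs.weight i hi, ← pow_add, Finset.sum_eq_sum_Ico_succ_bot (by omega : rem < T),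
      add_comm, hhyp]
    congr 2
    · simp
    · refine Finset.sum_congr rfl fun t ht => ?_
      have := (Finset.mem_Ico.1 ht).1
      rw [Function.update_of_ne (by omega)]
  total := by
    rw [h10, hs.total, ← Finset.sum_add_distrib]
    refine Finset.sum_congr rfl fun i hi => ?_
    rw [hw i (Finset.mem_range.1 hi)]
    have := mistake_le (h (pt i)) (f (pt i))
    interval_cases mistake (h (pt i)) (f (pt i)) <;> omega
  potential := by
    have := hs.rem_le
    have h1 := hs.potential
    rw [show T - rem = T - (rem + 1) + 1 by omega, pow_succ, pow_succ, h10]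
    set k := T - (rem + 1)
    calc 4 ^ k * 4 * (s.reg 10 + ∑ i ∈ Finset.range m, s.mem i * mistake (h (pt i)) (f (pt i)))
        = 4 ^ k * (4 * s.reg 10
          + 4 * ∑ i ∈ Finset.range m, s.mem i * mistake (h (pt i)) (f (pt i))) := by ring
      _ ≤ 4 ^ k * (4 * s.reg 10 + s.reg 10) := by gcongr
      _ = 5 * (4 ^ k * s.reg 10) := by ring
      _ ≤ 5 * (5 ^ k * m) := by gcongr
      _ = 5 ^ k * 5 * m := by ring

/-- The test is exact: register `16` holds the truncated difference of four times the error and the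
total weight, and is zero precisely when the hypothesis is acceptable. A rejection thus comes with a
proof that the error was too large, and it leaves the invariant of the previous level intact, since
only slot `rem` and scratch memory were overwritten. -/
theorem finishRound_spec {E : Env X} {m L n T rem : ℕ} {pt : ℕ → X} {f h : X → Bool}
    (hE : ∀ i < m, E.sample[i]? = some (pt i, f (pt i))) (hm : 0 < m)
    (hB : 10 * (m ^ 2 * 2 ^ T) < E.B) (s s' : RamState X)
    (hbase : Base m L n T s) (hs : Boosted E.learner pt f m L T (rem + 1) s)
    (hsame : Same [9, 11, 12, 13, 14, 15, 16, 17, 20, 21] m (4 * m + rem * L + L)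
      { s with hyp := Function.update s.hyp rem (L, h) } s')
    (h9 : s'.reg 9 = rem) (hidx : ∀ j < L, s'.mem (4 * m + rem * L + j) < m)
    (hh : h = E.learner (group pt f L (4 * m + rem * L) s'.mem))
    (h21 : s'.reg 21 = ∑ i ∈ Finset.range m, s.mem i * mistake (h (pt i)) (f (pt i))) :
    Hoare E finishRound s' (m * (20 + E.TE L) + 20) fun s'' => Base m L n T s'' ∧
      (Boosted E.learner pt f m L T rem s'' ∨ (s.reg 10 < 4 * s'.reg 21 ∧
        Boosted E.learner pt f m L T (rem + 1) s'')) := by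
  have hmul : (rem + 1) * L = rem * L + L := by ring
  have hle := hs.total_le
  have hmm : m * 2 ^ T ≤ m ^ 2 * 2 ^ T := Nat.mul_le_mul_right _ (by nlinarith)
  have hm1 : m * 1 ≤ m * 2 ^ T := Nat.mul_le_mul_left m Nat.one_le_two_pow
  have herr : s'.reg 21 ≤ s.reg 10 := by
    rw [h21, hs.total]
    exact Finset.sum_le_sum fun i _ => (Nat.mul_le_mul_left _ (mistake_le _ _)).trans_eq (mul_one _)
  have hb' : Base m L n T s' := hbase.congr (fun r hr => hsame.reg r (by
    simp at hr ⊢; omega)) hsame.outPoints hsame.outBits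
  have e10 : s'.reg 10 = s.reg 10 := hsame.reg 10 (by decide)
  have e8 : s'.reg 8 = s.reg 8 := hsame.reg 8 (by decide)
  have m1 : (s'.reg 21 + s'.reg 21) % E.B = s'.reg 21 + s'.reg 21 := Nat.mod_eq_of_lt (by omega)
  have m2 : (s'.reg 21 + s'.reg 21 + (s'.reg 21 + s'.reg 21)) % E.B
      = s'.reg 21 + s'.reg 21 + (s'.reg 21 + s'.reg 21) := Nat.mod_eq_of_lt (by omega)
  have m3 : m % E.B = m := Nat.mod_eq_of_lt (by omega)
  refine Hoare.mono (Hoare.seq (hoare_block_eq E rfl (τ := 5) (by simp [runTime, Instr.time]))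
    (τ₂ := m * (20 + E.TE L) + 13) ?_) (by omega) (fun _ h => h)
  rintro s₁ rfl
  set s₁ := run E (.add 16 21 21) [.add 16 16 16, .sub 16 16 10] s' with hs₁
  have h16 : s₁.reg 16 = 4 * s'.reg 21 - s.reg 10 := by
    simp [hs₁, run, Instr.next, RamState.setReg, m1, m2, e10]
    omega
  have hreg₁ : ∀ r, r ≠ 16 → s₁.reg r = s'.reg r := by
    intro r hr
    simp [hs₁, run, Instr.next, RamState.setReg, hr]
  have hmem₁ : s₁.mem = s'.mem := rfl
  have hhyp₁ : s₁.hyp = s'.hyp := rfl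
  have hp₁ : s₁.outPoints = s'.outPoints := rfl
  have hbt₁ : s₁.outBits = s'.outBits := rfl
  clear_value s₁
  have hb₁ : Base m L n T s₁ := hb'.congr (fun r hr => hreg₁ r (by simp at hr; omega)) hp₁ hbt₁
  refine (Hoare.ite (τ := m * (20 + E.TE L) + 12) (fun h0 => ?_) fun h0 => ?_).mono (by omega)
    fun _ h => h
  · refine Hoare.block rfl (by simp [runTime, Instr.time]) ⟨hb₁.congr (fun r hr => ?_) rfl rfl,
      Or.inr ⟨by omega, hs.congr ?_ ?_ ?_ ?_⟩⟩
    · have : r ≠ 31 := by simp at hr; omega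
      simp [run, Instr.next, RamState.setReg, this]
    · simp [run, Instr.next, RamState.setReg, hreg₁, e8]
    · simp [run, Instr.next, RamState.setReg, hreg₁, e10]
    · intro a ha
      simp [run, Instr.next, RamState.setReg, hmem₁]
      exact hsame.mem a (by omega)
    · intro t ht
      simp [run, Instr.next, RamState.setReg, hhyp₁, hsame.hyp]
      rw [Function.update_of_ne (by omega)]
  · refine Hoare.mono (Hoare.seq (hoare_block_eq E rfl (τ := 1) (by simp [runTime, Instr.time]))
      (τ₂ := m * (20 + E.TE L) + 6) ?_) (by omega) (fun _ h => h)
    rintro s₂ rfl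
    set s₂ := run E (.add 12 0 30) [] s₁ with hs₂
    have hreg₂ : ∀ r, r ≠ 12 → s₂.reg r = s₁.reg r := by
      intro r hr
      simp [hs₂, run, Instr.next, RamState.setReg, hr]
    have hmem₂ : s₂.mem = s'.mem := hmem₁
    have hhyp₂ : s₂.hyp = s'.hyp := hhyp₁
    have hb₂ : Base m L n T s₂ := hb₁.congr (fun r hr => hreg₂ r (by simp at hr; omega)) rfl rfl
    have e12 : s₂.reg 12 = m := by
      simp [hs₂, run, Instr.next, RamState.setReg, hb₁.r0, hb₁.r30, m3]
    clear_value s₂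
    have hwt : ∀ i < m, s₂.mem i = s.mem i := fun i hi => by
      rw [hmem₂]
      exact hsame.mem i (by omega)
    refine Hoare.mono (Hoare.seq (updateLoop_spec E (ℓ := L) (h := h) hE s₂ hb₂.r3 e12 ?_ (by omega)
      fun i hi => ?_) (τ₂ := 3) ?_) (by omega) (fun _ h => h)
    · rw [hhyp₂, hreg₂ 9 (by decide), hreg₁ 9 (by decide), h9, hsame.hyp]
      simp
    · have : s.mem i ≤ s.reg 10 := by
        rw [hs.total]
        exact Finset.single_le_sum (f := s.mem) (fun _ _ => Nat.zero_le _) (Finset.mem_range.2 hi)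
      rw [hwt i hi]
      omega
    · rintro s₃ ⟨hsame₃, hw⟩
      have hb₃ : Base m L n T s₃ := hsame₃.base hb₂ (by decide)
      have f10 : s₃.reg 10 = s.reg 10 := by
        rw [hsame₃.reg 10 (by decide), hreg₂ 10 (by decide), hreg₁ 10 (by decide), e10]
      have f21 : s₃.reg 21 = s'.reg 21 := by
        rw [hsame₃.reg 21 (by decide), hreg₂ 21 (by decide), hreg₁ 21 (by decide)]
      have f9 : s₃.reg 9 = rem := by
        rw [hsame₃.reg 9 (by decide), hreg₂ 9 (by decide), hreg₁ 9 (by decide), h9]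
      have m4 : (s.reg 10 + s'.reg 21) % E.B = s.reg 10 + s'.reg 21 := Nat.mod_eq_of_lt (by omega)
      have m5 : rem % E.B = rem := by
        have := hs.rem_le
        have hT : T < 2 ^ T := Nat.lt_two_pow_self
        have : 1 * 2 ^ T ≤ m ^ 2 * 2 ^ T := Nat.mul_le_mul_right _ (Nat.one_le_pow _ _ hm)
        exact Nat.mod_eq_of_lt (by omega)
      refine Hoare.block rfl (by simp [runTime, Instr.time])
        ⟨hb₃.congr (fun r hr => ?_) rfl rfl, Or.inl (hs.accept (h := h) ?_ ?_ ?_ ?_ ?_ ?_ ?_ ?_)⟩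
      · have : r ≠ 10 ∧ r ≠ 8 := by simp at hr; omega
        simp [run, Instr.next, RamState.setReg, this]
      · simp [run, Instr.next, RamState.setReg, f9, hb₃.r30, m5]
      · intro a ha
        simp [run, Instr.next, RamState.setReg]
        rw [hsame₃.mem a (by omega), hmem₂]
        exact hsame.mem a (by omega)
      · simp [run, Instr.next, RamState.setReg]
        rw [hsame₃.hyp, hhyp₂, hsame.hyp]
      · intro j hj
        simp [run, Instr.next, RamState.setReg]
        rw [hsame₃.mem _ (by omega), hmem₂]
        exact hidx j hj
      · rw [hh]
        simp [run, Instr.next, RamState.setReg]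
        rw [group_congr fun j _ => ?_]
        rw [hsame₃.mem _ (by omega), hmem₂]
      · intro i hi
        simp [run, Instr.next, RamState.setReg]
        rw [hw i hi, hwt i hi]
      · rw [← h21]
        simp [run, Instr.next, RamState.setReg, f10, f21, m4]
      · rw [← h21]
        omega

/-- One attempt to complete a boosting round. -/
def attempt : Prog := .seq drawSample (.seq learnAndTest finishRound)

theorem attempt_spec {E : Env X} {C : Set (X → Bool)} {m d L n T rem : ℕ} {pt : ℕ → X}
    {f : X → Bool} (hE : ∀ i < m, E.sample[i]? = some (pt i, f (pt i)))
    (hC : vcDim C ≤ d) (hd : 0 < d) (hLd : L = 2 ^ 14 * d)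
    (hA : E.learner.Proper C) (hA' : E.learner.Consistent C) (hf : f ∈ C)
    (hm : 0 < m) (hLm : L ≤ m) (hB : 10 * (m ^ 2 * 2 ^ T) < E.B) (s : RamState X)
    (hbase : Base m L n T s) (hs : Boosted E.learner pt f m L T (rem + 1) s) :
    HalfHoare E attempt s (80 * m + E.TA L + 2 * (m * E.TE L) + 50)
      (fun s' => Base m L n T s' ∧ Boosted E.learner pt f m L T rem s')
      (fun s' => (Base m L n T s' ∧ Boosted E.learner pt f m L T rem s') ∨
        (Base m L n T s' ∧ Boosted E.learner pt f m L T (rem + 1) s')) := by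
  have hle := hs.total_le
  have hmm : m * 2 ^ T ≤ m ^ 2 * 2 ^ T := Nat.mul_le_mul_right _ (by nlinarith)
  have hm1 : m * 1 ≤ m * 2 ^ T := Nat.mul_le_mul_left m Nat.one_le_two_pow
  -- Once the sample is drawn, everything is deterministic. After a good draw the rejection branch
  -- contradicts the error bound, so the probability 1/2 of a good draw passes to the whole attempt.
  have key : ∀ s', (Same [9, 11, 12, 13, 14, 15, 20] m (4 * m + rem * L + L) s s' ∧
        s'.reg 9 = rem ∧ s'.reg 20 = 4 * m + rem * L ∧
        ∀ j < L, s'.mem (4 * m + rem * L + j) < m) →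
      Hoare E (.seq learnAndTest finishRound) s'
        (38 * m + L + E.TA L + 2 * (m * E.TE L) + 29) fun s'' => Base m L n T s'' ∧
        (Boosted E.learner pt f m L T rem s'' ∨ (s.reg 10 < 4 * (∑ i ∈ Finset.range m, s.mem i *
          mistake (E.learner (group pt f L (4 * m + rem * L) s'.mem) (pt i)) (f (pt i))) ∧
          Boosted E.learner pt f m L T (rem + 1) s'')) := by
    rintro s' ⟨hsame, h9, h20, hidx⟩
    have hw : ∀ i ∈ Finset.range m, s'.mem i = s.mem i := fun i hi =>
      hsame.mem i (Or.inl (Finset.mem_range.1 hi))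
    refine Hoare.mono (Hoare.seq (learnAndTest_spec hE (by omega) (by omega) s'
      (hsame.base hbase (by decide)) h9 h20 hidx ?_) (τ₂ := m * (20 + E.TE L) + 20) ?_) ?_
      fun _ h => h
    · rw [Finset.sum_congr rfl hw, ← hs.total]
      omega
    · rintro s₁ ⟨hsame₁, h21⟩
      have hmem : s₁.mem = s'.mem := funext fun a => hsame₁.mem a (Or.inr (Nat.zero_le _))
      have h21' : s₁.reg 21 = ∑ i ∈ Finset.range m, s.mem i *
          mistake (E.learner (group pt f L (4 * m + rem * L) s'.mem) (pt i)) (f (pt i)) := by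
        rw [h21]
        exact Finset.sum_congr rfl fun i hi => by rw [hw i hi]
      rw [← h21']
      refine finishRound_spec hE hm hB s s₁ hbase hs ⟨fun r hr => ?_, fun a ha => ?_, ?_, ?_, ?_⟩
        ?_ ?_ ?_ h21'
      · rw [hsame₁.reg r (fun h => hr (by simp at h ⊢; omega))]
        exact hsame.reg r (fun h => hr (by simp at h ⊢; omega))
      · rw [hmem]
        exact hsame.mem a ha
      · rw [hsame₁.hyp]
        simp only
        rw [hsame.hyp]
      · rw [hsame₁.outPoints]
        exact hsame.outPoints
      · rw [hsame₁.outBits]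
        exact hsame.outBits
      · rw [hsame₁.reg 9 (by decide)]
        exact h9
      · rw [hmem]
        exact hidx
      · rw [hmem]
    · apply le_of_eq
      ring
  refine (HalfHoare.seq (drawSample_spec hC hd hLd hA hA' hf hm hLm hB s hbase hs)
    (Q₁ := fun s' => Base m L n T s' ∧ Boosted E.learner pt f m L T rem s')
    (Q₂ := fun s' => (Base m L n T s' ∧ Boosted E.learner pt f m L T rem s') ∨
        (Base m L n T s' ∧ Boosted E.learner pt f m L T (rem + 1) s'))
    (fun s' hs' => (key s' hs'.1).mono le_rfl ?_)
    (fun s' hs' => (key s' hs').mono le_rfl ?_)).mono (by omega) (fun _ h => h) fun _ h => h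
  · rintro s'' ⟨hb, h | ⟨h, -⟩⟩
    · exact ⟨hb, h⟩
    · omega
  · rintro s'' ⟨hb, h | ⟨-, h⟩⟩
    · exact Or.inl ⟨hb, h⟩
    · exact Or.inr ⟨hb, h⟩

theorem boostLoop_spec {E : Env X} {C : Set (X → Bool)} {m d L n T : ℕ} {pt : ℕ → X}
    {f : X → Bool} (hE : ∀ i < m, E.sample[i]? = some (pt i, f (pt i)))
    (hC : vcDim C ≤ d) (hd : 0 < d) (hLd : L = 2 ^ 14 * d)
    (hA : E.learner.Proper C) (hA' : E.learner.Consistent C) (hf : f ∈ C)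
    (hm : 0 < m) (hLm : L ≤ m) (hB : 10 * (m ^ 2 * 2 ^ T) < E.B) (s : RamState X)
    (hbase : Base m L n T s) (hs : Boosted E.learner pt f m L T T s) :
    Hoare E (.while 8 attempt) s
      (T * (2 * (80 * m + E.TA L + 2 * (m * E.TE L) + 51)) + 1)
      (fun s' => Base m L n T s' ∧ Boosted E.learner pt f m L T 0 s') := by
  refine HalfHoare.retry (fun k s => Base m L n T s ∧ Boosted E.learner pt f m L T k s)
    (fun s h => h.2.r8) (fun k s h => by rw [h.2.r8]; omega) (fun k s h => ?_) T s ⟨hbase, hs⟩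
  exact attempt_spec hE hC hd hLd hA hA' hf hm hLm hB s h.1 h.2

/-! ### Drawing and testing a majority vote -/

/-- Register `21` is increased by the number of drawn hypotheses that misclassify the sample point
of index register `12`. -/
def countLoop : Prog :=
  .while 13 (block (.sub 13 13 3) [.add 15 18 13, .load 15 15, .eval 14 15 12, .label 16 12,
    .sub 17 14 16, .sub 16 16 14, .add 16 17 16, .add 21 21 16])

/-- Register `22` becomes positive if the majority vote of the drawn hypotheses is wrong at some
sample point. -/
def voteLoop : Prog :=
  .while 12 (.seq (block (.sub 12 12 3) [.const 21 0, .add 13 5 30]) (.seq countLoop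
    (block (.add 21 21 21) [.add 21 21 3, .sub 21 21 5, .add 22 22 21])))

theorem countLoop_spec (E : Env X) {m n i ℓ base : ℕ} {pt : ℕ → X} {f : X → Bool}
    {h : ℕ → X → Bool} (hE : ∀ i < m, E.sample[i]? = some (pt i, f (pt i))) (s₀ : RamState X)
    (h3 : s₀.reg 3 = 1) (h13 : s₀.reg 13 = n) (h18 : s₀.reg 18 = base) (h12 : s₀.reg 12 = i)
    (h21 : s₀.reg 21 = 0) (him : i < m)
    (hh : ∀ j < n, s₀.hyp (s₀.mem (base + j)) = (ℓ, h j)) (hB1 : 1 < E.B)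
    (hB : base + n < E.B) :
    Hoare E countLoop s₀ (n * (18 + E.TE ℓ) + 1) fun s =>
      Same [13, 14, 15, 16, 17, 21] 0 0 s₀ s ∧
      s.reg 21 = ∑ j ∈ Finset.range n, mistake (h j (pt i)) (f (pt i)) := by
  refine (Hoare.countdown_const (τ := 17 + E.TE ℓ) (fun k s =>
      Same [13, 14, 15, 16, 17, 21] 0 0 s₀ s ∧ s.reg 13 = k ∧ k ≤ n ∧
      s.reg 21 = ∑ j ∈ Finset.Ico k n, mistake (h j (pt i)) (f (pt i)))
    (fun k s h => h.2.1) ?_ n s₀ ⟨.refl _ _ _ _, h13, le_rfl, by simp [h21]⟩).mono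
      (by apply le_of_eq; ring) ?_
  · rintro k s ⟨hs, hk, hkn, h21⟩
    have e3 := (hs.reg 3 (by decide)).trans h3
    have e12 := (hs.reg 12 (by decide)).trans h12
    have e18 := (hs.reg 18 (by decide)).trans h18
    have emem : s.mem (base + k) = s₀.mem (base + k) := hs.mem _ (by omega)
    have ehyp : s.hyp (s₀.mem (base + k)) = (ℓ, h k) := by rw [hs.hyp, hh k (by omega)]
    have hsub : ∑ j ∈ Finset.Ico k n, mistake (h j (pt i)) (f (pt i)) ≤ n := by
      refine le_trans (Finset.sum_le_card_nsmul _ _ 1 fun j _ => mistake_le _ _) ?_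
      simp
    rw [Finset.sum_eq_sum_Ico_succ_bot (by omega), ← h21] at hsub
    have m0 : (base + k) % E.B = base + k := Nat.mod_eq_of_lt (by omega)
    have m1 : mistake (h k (pt i)) (f (pt i)) % E.B = mistake (h k (pt i)) (f (pt i)) :=
      Nat.mod_eq_of_lt (lt_of_le_of_lt (mistake_le _ _) hB1)
    have m3 : (s.reg 21 + mistake (h k (pt i)) (f (pt i))) % E.B
        = s.reg 21 + mistake (h k (pt i)) (f (pt i)) := Nat.mod_eq_of_lt (by omega)
    refine Hoare.block rfl ?_ ⟨⟨?_, ?_, hs.hyp, hs.outPoints, hs.outBits⟩, ?_, by omega, ?_⟩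
    · simp [runTime, Instr.time, Instr.next, RamState.setReg, e3, hk, e18, m0, emem, ehyp]
      omega
    · intro r hr
      have := hs.reg r hr
      simp at hr
      simp [run, Instr.next, RamState.setReg, hr, this]
    · intro a ha
      rw [← hs.mem a ha]
      rfl
    · simp [run, Instr.next, RamState.setReg, e3, hk]
    · rw [Finset.sum_eq_sum_Ico_succ_bot (by omega), ← h21]
      simp [run, Instr.next, RamState.setReg, e3, hk, e18, e12, m0, emem, hE i him, ehyp,
        toNat_mod hB1, mistake_eq, m1, m3]
      ring
  · rintro s ⟨hs, -, -, h21⟩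
    exact ⟨hs, by rw [h21, Finset.range_eq_Ico]⟩

/-- With `c` wrong votes, the truncated `2 * c + 1 - n` vanishes exactly if `2 * c < n`. So register
`22` stays zero if and only if the correct label wins strictly at every sample point; ties count as
failures. -/
theorem voteLoop_spec (E : Env X) {m n ℓ base : ℕ} {pt : ℕ → X} {f : X → Bool}
    {h : ℕ → X → Bool} (hE : ∀ i < m, E.sample[i]? = some (pt i, f (pt i))) (s₀ : RamState X)
    (h3 : s₀.reg 3 = 1) (h5 : s₀.reg 5 = n) (h18 : s₀.reg 18 = base) (h30 : s₀.reg 30 = 0)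
    (h12 : s₀.reg 12 = m) (h22 : s₀.reg 22 = 0)
    (hh : ∀ j < n, s₀.hyp (s₀.mem (base + j)) = (ℓ, h j)) (hB1 : 1 < E.B)
    (hB : base + n < E.B) (hB' : m * (n + 1) < E.B) (hB'' : 2 * n + 1 < E.B) :
    Hoare E voteLoop s₀ (m * (16 + n * (18 + E.TE ℓ)) + 1) fun s =>
      Same [12, 13, 14, 15, 16, 17, 21, 22] 0 0 s₀ s ∧
      s.reg 22 = ∑ i ∈ Finset.range m,
        (2 * ∑ j ∈ Finset.range n, mistake (h j (pt i)) (f (pt i)) + 1 - n) := by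
  set c : ℕ → ℕ := fun i => ∑ j ∈ Finset.range n, mistake (h j (pt i)) (f (pt i)) with hc
  have hcn : ∀ i, c i ≤ n := by
    intro i
    refine le_trans (Finset.sum_le_card_nsmul _ _ 1 fun j _ => mistake_le _ _) ?_
    simp
  refine (Hoare.countdown_const (τ := 15 + n * (18 + E.TE ℓ)) (fun k s =>
      Same [12, 13, 14, 15, 16, 17, 21, 22] 0 0 s₀ s ∧ s.reg 12 = k ∧ k ≤ m ∧
      s.reg 22 = ∑ i ∈ Finset.Ico k m, (2 * c i + 1 - n))
    (fun k s h => h.2.1) ?_ m s₀ ⟨.refl _ _ _ _, h12, le_rfl, by simp [h22]⟩).mono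
      (by apply le_of_eq; ring) ?_
  · rintro k s ⟨hs, hk, hkm, h22⟩
    have e3 := (hs.reg 3 (by decide)).trans h3
    have e5 := (hs.reg 5 (by decide)).trans h5
    have e18 := (hs.reg 18 (by decide)).trans h18
    have e30 := (hs.reg 30 (by decide)).trans h30
    have m0 : n % E.B = n := Nat.mod_eq_of_lt (by omega)
    have hsub : ∑ i ∈ Finset.Ico k m, (2 * c i + 1 - n) ≤ m * (n + 1) := by
      refine le_trans (Finset.sum_le_card_nsmul _ _ (n + 1) fun j _ => ?_) ?_
      · have := hcn j
        omega
      · rw [smul_eq_mul]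
        refine Nat.mul_le_mul_right _ ?_
        simp
    rw [Finset.sum_eq_sum_Ico_succ_bot (by omega), ← h22] at hsub
    have hck := hcn k
    have m1 : (c k + c k) % E.B = c k + c k := Nat.mod_eq_of_lt (by omega)
    have m2 : (c k + c k + 1) % E.B = c k + c k + 1 := Nat.mod_eq_of_lt (by omega)
    have m3 : (s.reg 22 + (c k + c k + 1 - n)) % E.B = s.reg 22 + (c k + c k + 1 - n) :=
      Nat.mod_eq_of_lt (by omega)
    refine Hoare.mono (Hoare.seq (hoare_block_eq E rfl (τ := 5) (by simp [runTime, Instr.time]))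
      (τ₂ := n * (18 + E.TE ℓ) + 9) ?_) (by omega) (fun _ h => h)
    rintro s₁ rfl
    set s₁ := run E (.sub 12 12 3) [.const 21 0, .add 13 5 30] s with hs₁
    have hsame₁ : Same [12, 13, 14, 15, 16, 17, 21, 22] 0 0 s s₁ := by
      refine ⟨fun r hr => ?_, fun _ _ => rfl, rfl, rfl, rfl⟩
      simp at hr
      simp [hs₁, run, Instr.next, RamState.setReg, hr]
    have f12 : s₁.reg 12 = k := by simp [hs₁, run, Instr.next, RamState.setReg, hk, e3]
    have f13 : s₁.reg 13 = n := by simp [hs₁, run, Instr.next, RamState.setReg, e5, e30, m0]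
    have f21 : s₁.reg 21 = 0 := by simp [hs₁, run, Instr.next, RamState.setReg]
    have f22 : s₁.reg 22 = s.reg 22 := by simp [hs₁, run, Instr.next, RamState.setReg]
    have hmem₁ : s₁.mem = s.mem := rfl
    have hhyp₁ : s₁.hyp = s.hyp := rfl
    clear_value s₁
    have hsame₂ := hs.trans hsame₁
    refine Hoare.mono (Hoare.seq (countLoop_spec E (h := h) (ℓ := ℓ) (base := base) hE s₁
      ((hsame₁.reg 3 (by decide)).trans e3) f13 ((hsame₁.reg 18 (by decide)).trans e18) f12 f21
      (by omega) (fun j hj => ?_) hB1 hB) (τ₂ := 7) ?_) (by omega) (fun _ h => h)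
    · rw [hhyp₁, hs.hyp, hmem₁, hs.mem _ (by omega)]
      exact hh j hj
    · rintro s₂ ⟨hsame₃, g21⟩
      have hsame₄ := hsame₂.trans (hsame₃.mono (rs' := [12, 13, 14, 15, 16, 17, 21, 22])
        (by decide) le_rfl le_rfl)
      have g3 := (hsame₄.reg 3 (by decide)).trans h3
      have g5 := (hsame₄.reg 5 (by decide)).trans h5
      have g12 := (hsame₃.reg 12 (by decide)).trans f12
      have g22 := (hsame₃.reg 22 (by decide)).trans f22
      have g21' : s₂.reg 21 = c k := g21
      refine Hoare.block rfl (by simp [runTime, Instr.time])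
        ⟨hsame₄.trans ⟨fun r hr => ?_, fun _ _ => rfl, rfl, rfl, rfl⟩, ?_, by omega, ?_⟩
      · simp at hr
        simp [run, Instr.next, RamState.setReg, hr]
      · simp [run, Instr.next, RamState.setReg, g12]
      · rw [Finset.sum_eq_sum_Ico_succ_bot (by omega), ← h22]
        simp [run, Instr.next, RamState.setReg, g21', g3, g5, g22, m1, m2, m3]
        omega
  · rintro s ⟨hs, -, -, h22⟩
    exact ⟨hs, by rw [h22, Finset.range_eq_Ico]⟩

/-- After boosting, every sample point is misclassified in at most `3/8` of the rounds. -/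
theorem eight_mul_le_of_potential {k m r T : ℕ} (hT : T = 20 * k) (hk : m ≤ 2 ^ k)
    (h : 4 ^ T * 2 ^ r ≤ 5 ^ T * m) : 8 * r ≤ 3 * T := by
  subst hT
  have h1 : 4 ^ (20 * k) * 2 ^ r ≤ (5 ^ 20 * 2) ^ k := by
    rw [mul_pow, ← pow_mul]
    exact h.trans (Nat.mul_le_mul_left _ hk)
  -- Squaring avoids fractional exponents. The numerical fact is `5 ^ 40 ≤ 2 ^ 93`, and the result
  -- `2 * r ≤ 15 * k` is the claim for `T = 20 * k`: twenty rounds per doubling of `m` are enough.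
  have h2 : (4 ^ 40) ^ k * 2 ^ (2 * r) ≤ (4 ^ 40) ^ k * 2 ^ (15 * k) := by
    calc (4 ^ 40) ^ k * 2 ^ (2 * r) = (4 ^ (20 * k) * 2 ^ r) ^ 2 := by
          rw [mul_pow, ← pow_mul, ← pow_mul, ← pow_mul]
          congr 2 <;> ring
      _ ≤ ((5 ^ 20 * 2) ^ k) ^ 2 := Nat.pow_le_pow_left h1 2
      _ = ((5 ^ 20 * 2) ^ 2) ^ k := pow_right_comm _ _ _
      _ ≤ (4 ^ 40 * 2 ^ 15) ^ k := Nat.pow_le_pow_left (by norm_num) k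
      _ = (4 ^ 40) ^ k * 2 ^ (15 * k) := by rw [mul_pow, ← pow_mul 2]
  have h3 := Nat.le_of_mul_le_mul_left h2 (by positivity)
  have h4 := (Nat.pow_le_pow_iff_right (by norm_num : 1 < 2)).1 h3
  omega

/-- Draw hypotheses and test their majority vote. -/
def voteAttempt : Prog :=
  .seq (block (.add 13 5 30) []) (.seq drawVotersLoop
    (.seq (block (.const 22 0) [.add 12 0 30]) voteLoop))

/-- The majority vote of the chosen hypotheses is correct on the sample. -/
def Selected (pt : ℕ → X) (f : X → Bool) (m n T : ℕ) (s : RamState X) : Prop :=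
  (∀ j < n, s.mem (3 * m + j) < T) ∧
  ∀ i < m, 2 * ∑ j ∈ Finset.range n,
    mistake ((s.hyp (s.mem (3 * m + j))).2 (pt i)) (f (pt i)) < n

/-- A good draw passes the test because all sample points meet the 3/8 condition of
`card_bad_votes_le`. Conversely, passing the test certifies `Selected` for any draw, so correctness
does not depend on luck. -/
theorem voteAttempt_spec {E : Env X} {C : Set (X → Bool)} {m e L n k : ℕ} {pt : ℕ → X}
    {f : X → Bool} (hE : ∀ i < m, E.sample[i]? = some (pt i, f (pt i)))
    (hC : vcDim (dualClass C) ≤ e) (he : 0 < e) (hn : n = 2 ^ 14 * e)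
    (hA : E.learner.Proper C) (hf : f ∈ C) (hm : 0 < m) (hk : 0 < k) (hmk : m ≤ 2 ^ k)
    (hnm : n ≤ m) (hB : 10 * (m ^ 2 * 2 ^ (20 * k)) < E.B) (s : RamState X)
    (hbase : Base m L n (20 * k) s) (hs : Boosted E.learner pt f m L (20 * k) 0 s) :
    HalfHoare E voteAttempt s (m * (16 + n * (18 + E.TE L)) + 8 * n + 9)
      (fun s' => (Base m L n (20 * k) s' ∧ Boosted E.learner pt f m L (20 * k) 0 s') ∧
        s'.reg 22 = 0 ∧ Selected pt f m n (20 * k) s')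
      (fun s' => (Base m L n (20 * k) s' ∧ Boosted E.learner pt f m L (20 * k) 0 s') ∧
        (s'.reg 22 = 0 → Selected pt f m n (20 * k) s')) := by
  classical
  generalize hT : 20 * k = T at hB hbase hs ⊢
  have hT0 : 0 < T := by omega
  have hmm : m ^ 2 * 1 ≤ m ^ 2 * 2 ^ T := Nat.mul_le_mul_left _ Nat.one_le_two_pow
  have hm2 : m * 1 ≤ m ^ 2 := by rw [pow_two]; exact Nat.mul_le_mul_left m hm
  have hmn : m * (n + 1) ≤ m ^ 2 + m := by nlinarith
  have m0 : n % E.B = n := Nat.mod_eq_of_lt (by omega)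
  have m1 : m % E.B = m := Nat.mod_eq_of_lt (by omega)
  let H : Fin T → X → Bool := fun t => (s.hyp t).2
  have hH : ∀ t, H t ∈ C := by
    intro t
    simp only [H]
    rw [hs.hyp t (Nat.zero_le _) t.2]
    exact hA f hf _
  -- The weight of a point, `2` to the number of its mistakes, is at most the total weight, which
  -- the potential bounds by `(5 / 4) ^ T * m`.
  have hfew : ∀ i < m, 8 * (Finset.univ.filter fun t => H t (pt i) ≠ f (pt i)).card ≤ 3 * T := by
    intro i hi
    have h1 : (Finset.univ.filter fun t => H t (pt i) ≠ f (pt i)).card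
        = ∑ t ∈ Finset.range T, mistake ((s.hyp t).2 (pt i)) (f (pt i)) := by
      rw [Finset.card_filter,
        ← Fin.sum_univ_eq_sum_range (fun t => mistake ((s.hyp t).2 (pt i)) (f (pt i)))]
      rfl
    have h2 : s.mem i ≤ s.reg 10 := by
      rw [hs.total]
      exact Finset.single_le_sum (f := s.mem) (fun _ _ => Nat.zero_le _) (Finset.mem_range.2 hi)
    rw [hs.weight i hi, ← Finset.range_eq_Ico, ← h1] at h2
    have h3 := hs.potential
    rw [Nat.sub_zero] at h3
    exact eight_mul_le_of_potential hT.symm hmk ((Nat.mul_le_mul_left _ h2).trans h3)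
  refine HalfHoare.mono (Hoare.seq_half (hoare_block_eq E rfl (τ := 1)
    (by simp [runTime, Instr.time])) (τ₂ := m * (16 + n * (18 + E.TE L)) + 8 * n + 7) ?_)
    (by omega) (fun _ h => h) (fun _ h => h)
  rintro s₁ rfl
  set s₁ := run E (.add 13 5 30) [] s with hs₁
  have hsame₁ : Same [12, 13, 14, 15, 16, 17, 21, 22] (3 * m) (4 * m) s s₁ := by
    refine ⟨fun r hr => ?_, fun _ _ => rfl, rfl, rfl, rfl⟩
    simp at hr
    simp [hs₁, run, Instr.next, RamState.setReg, hr]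
  have f13 : s₁.reg 13 = n := by
    simp [hs₁, run, Instr.next, RamState.setReg, hbase.r5, hbase.r30, m0]
  have hb₁ := hsame₁.base hbase (by decide)
  clear_value s₁
  have key : ∀ s₂ (g : Fin n → Fin T), (Same [13, 14, 15] (3 * m) (3 * m + n) s₁ s₂ ∧
      ∀ j : Fin n, s₂.mem (3 * m + j) = g j) →
      Hoare E (.seq (block (.const 22 0) [.add 12 0 30]) voteLoop) s₂
        (m * (16 + n * (18 + E.TE L)) + 5) fun s' =>
        (Base m L n T s' ∧ Boosted E.learner pt f m L T 0 s') ∧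
        (s'.reg 22 = 0 ↔ ∀ i < m, 2 * (Finset.univ.filter fun j =>
          H (g j) (pt i) ≠ f (pt i)).card < n) ∧
        (s'.reg 22 = 0 → Selected pt f m n T s') := by
    rintro s₂ g ⟨hsame₂, hg⟩
    have hsame₃ := hsame₁.trans (hsame₂.mono (rs' := [12, 13, 14, 15, 16, 17, 21, 22])
      (lo' := 3 * m) (hi' := 4 * m) (by decide) le_rfl (by omega))
    refine Hoare.mono (Hoare.seq (hoare_block_eq E rfl (τ := 3) (by simp [runTime, Instr.time]))
      (τ₂ := m * (16 + n * (18 + E.TE L)) + 1) ?_) (by omega) (fun _ h => h)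
    rintro s₃ rfl
    set s₃ := run E (.const 22 0) [.add 12 0 30] s₂ with hs₃
    have hb₂ := hsame₃.base hbase (by decide)
    have hsame₄ : Same [12, 13, 14, 15, 16, 17, 21, 22] (3 * m) (4 * m) s s₃ := by
      refine hsame₃.trans ⟨fun r hr => ?_, fun _ _ => rfl, rfl, rfl, rfl⟩
      simp at hr
      simp [hs₃, run, Instr.next, RamState.setReg, hr]
    have f12 : s₃.reg 12 = m := by
      simp [hs₃, run, Instr.next, RamState.setReg, hb₂.r0, hb₂.r30, m1]
    have f22 : s₃.reg 22 = 0 := by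
      simp [hs₃, run, Instr.next, RamState.setReg]
    have hb₃ := hsame₄.base hbase (by decide)
    have hmem₃ : s₃.mem = s₂.mem := rfl
    clear_value s₃
    have hvals : ∀ j (hj : j < n), s₃.mem (3 * m + j) = g ⟨j, hj⟩ := fun j hj => by
      rw [hmem₃]
      exact hg ⟨j, hj⟩
    refine (voteLoop_spec E (h := fun j => (s.hyp (s₃.mem (3 * m + j))).2) (ℓ := L) hE s₃ hb₃.r3
      hb₃.r5 hb₃.r18 hb₃.r30 f12 f22 (fun j hj => ?_) (by omega) (by omega) (by omega)
      (by omega)).mono le_rfl ?_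
    · rw [hsame₄.hyp, hvals j hj, hs.hyp _ (Nat.zero_le _) (g ⟨j, hj⟩).2]
    · rintro s₄ ⟨hsame₅, h22⟩
      have hmem₄ : s₄.mem = s₃.mem := funext fun a => hsame₅.mem a (Or.inr (Nat.zero_le _))
      have hhyp₄ : s₄.hyp = s.hyp := hsame₅.hyp.trans hsame₄.hyp
      have hsel : s₄.reg 22 = 0 → ∀ i < m, 2 * ∑ j ∈ Finset.range n,
          mistake ((s.hyp (s₃.mem (3 * m + j))).2 (pt i)) (f (pt i)) < n := by
        intro h0 i hi
        rw [h22, Finset.sum_eq_zero_iff] at h0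
        have := h0 i (Finset.mem_range.2 hi)
        omega
      have hcard : ∀ i, (Finset.univ.filter fun j => H (g j) (pt i) ≠ f (pt i)).card
          = ∑ j ∈ Finset.range n,
            mistake ((s.hyp (s₃.mem (3 * m + j))).2 (pt i)) (f (pt i)) := by
        intro i
        rw [Finset.card_filter, ← Fin.sum_univ_eq_sum_range (fun j =>
          mistake ((s.hyp (s₃.mem (3 * m + j))).2 (pt i)) (f (pt i)))]
        refine Finset.sum_congr rfl fun j _ => ?_
        rw [hvals j j.2]
        rfl
      refine ⟨⟨hsame₅.base hb₃ (by decide), hs.congr ?_ ?_ ?_ ?_⟩, ⟨?_, ?_⟩, ?_⟩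
      · rw [hsame₅.reg 8 (by decide), hsame₄.reg 8 (by decide)]
      · rw [hsame₅.reg 10 (by decide), hsame₄.reg 10 (by decide)]
      · intro a ha
        rw [hmem₄, hsame₄.mem a (by omega)]
      · intro t _
        rw [hhyp₄]
      · intro h0 i hi
        rw [hcard]
        exact hsel h0 i hi
      · intro hall
        rw [h22, Finset.sum_eq_zero_iff]
        intro i hi
        have := hall i (Finset.mem_range.1 hi)
        rw [hcard] at this
        omega
      · intro h0
        refine ⟨fun j hj => ?_, fun i hi => ?_⟩
        · rw [hmem₄, hvals j hj]
          exact (g ⟨j, hj⟩).2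
        · rw [hmem₄, hhyp₄]
          exact hsel h0 i hi
  refine HalfHoare.mono (HalfHoare.seq (drawVotersLoop_spec E s₁ hb₁.r3 hb₁.r7 f13 hb₁.r18 hT0
    (by omega) _ (card_bad_votes_le hC he hn hT0 H hH f))
    (τ₂ := m * (16 + n * (18 + E.TE L)) + 5)
    (Q₁ := fun s' => (Base m L n T s' ∧ Boosted E.learner pt f m L T 0 s') ∧
        s'.reg 22 = 0 ∧ Selected pt f m n T s')
    (Q₂ := fun s' => (Base m L n T s' ∧ Boosted E.learner pt f m L T 0 s') ∧
        (s'.reg 22 = 0 → Selected pt f m n T s')) ?_ ?_)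
    (by omega) (fun _ h => h) (fun _ h => h)
  · rintro s₂ ⟨g, hbad, hg⟩
    refine (key s₂ g hg).mono le_rfl ?_
    rintro s' ⟨h1, h2, h3⟩
    have h0 : s'.reg 22 = 0 := by
      rw [h2]
      intro i hi
      by_contra hcon
      exact hbad ⟨pt i, hfew i hi, not_lt.1 hcon⟩
    exact ⟨h1, h0, h3 h0⟩
  · rintro s₂ ⟨g, hg⟩
    exact (key s₂ g hg).mono le_rfl fun s' h => ⟨h.1, h.2.2⟩

theorem selectLoop_spec {E : Env X} {C : Set (X → Bool)} {m e L n k : ℕ} {pt : ℕ → X}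
    {f : X → Bool} (hE : ∀ i < m, E.sample[i]? = some (pt i, f (pt i)))
    (hC : vcDim (dualClass C) ≤ e) (he : 0 < e) (hn : n = 2 ^ 14 * e)
    (hA : E.learner.Proper C) (hf : f ∈ C) (hm : 0 < m) (hk : 0 < k) (hmk : m ≤ 2 ^ k)
    (hnm : n ≤ m) (hB : 10 * (m ^ 2 * 2 ^ (20 * k)) < E.B) (s : RamState X)
    (hbase : Base m L n (20 * k) s) (hs : Boosted E.learner pt f m L (20 * k) 0 s)
    (h22 : s.reg 22 ≠ 0) :
    Hoare E (.while 22 voteAttempt) s (2 * (m * (16 + n * (18 + E.TE L)) + 8 * n + 10) + 1)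
      (fun s' => Base m L n (20 * k) s' ∧ Boosted E.learner pt f m L (20 * k) 0 s' ∧
        Selected pt f m n (20 * k) s') := by
  -- Only two levels: level 1 until a test is passed, level 0 afterwards.
  let Inv : ℕ → RamState X → Prop := fun j s' =>
    (Base m L n (20 * k) s' ∧ Boosted E.learner pt f m L (20 * k) 0 s') ∧
      ((j = 0 ∧ s'.reg 22 = 0 ∧ Selected pt f m n (20 * k) s') ∨ (j = 1 ∧ s'.reg 22 ≠ 0))
  have h := HalfHoare.retry (E := E) (r := 22) (p := voteAttempt)
    (τ := m * (16 + n * (18 + E.TE L)) + 8 * n + 9) Inv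
    (fun s' hs' => by
      rcases hs'.2 with h | h
      · exact h.2.1
      · omega)
    (fun j s' hs' => by
      rcases hs'.2 with h | h
      · omega
      · exact h.2) (fun j s' hs' => by
      rcases hs'.2 with h | ⟨h, h22⟩
      · omega
      · obtain rfl : j = 0 := by omega
        refine (voteAttempt_spec hE hC he hn hA hf hm hk hmk hnm hB s' hs'.1.1 hs'.1.2).mono le_rfl
          (fun s'' h => ⟨h.1, Or.inl ⟨rfl, h.2⟩⟩) fun s'' h => ?_
        by_cases h0 : s''.reg 22 = 0
        · exact Or.inl ⟨h.1, Or.inl ⟨rfl, h0, h.2 h0⟩⟩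
        · exact Or.inr ⟨h.1, Or.inr ⟨rfl, h0⟩⟩) 1 s ⟨⟨hbase, hs⟩, Or.inr ⟨rfl, h22⟩⟩
  refine h.mono (by apply le_of_eq; ring) fun s' hs' => ?_
  rcases hs'.2 with h | h
  · exact ⟨hs'.1.1, hs'.1.2, h.2.2⟩
  · omega

/-! ### Output of the chosen training samples -/

/-- Output the training sample whose indices are stored from the address in register `15` on. -/
def emitGroupLoop : Prog :=
  .while 13 (block (.sub 13 13 3) [.load 14 15, .emitPoint 14, .add 15 15 3])

theorem emitGroupLoop_spec {E : Env X} {m L base : ℕ} {pt : ℕ → X} {f : X → Bool}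
    (hE : ∀ i < m, E.sample[i]? = some (pt i, f (pt i))) (s₀ : RamState X) (h3 : s₀.reg 3 = 1)
    (h13 : s₀.reg 13 = L) (h15 : s₀.reg 15 = base) (hidx : ∀ j < L, s₀.mem (base + j) < m)
    (hB : base + L < E.B) :
    Hoare E emitGroupLoop s₀ (L * 8 + 1) fun s => Same [13, 14, 15] 0 0
      { s₀ with outPoints := s₀.outPoints ++ group pt f L base s₀.mem } s := by
  refine (Hoare.countdown_const (τ := 7) (fun k s => Same [13, 14, 15] 0 0
      { s₀ with outPoints := s₀.outPoints ++ group pt f (L - k) base s₀.mem } s ∧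
      s.reg 13 = k ∧ k ≤ L ∧ s.reg 15 = base + (L - k)) (fun k s h => h.2.1) ?_ L s₀
    ⟨⟨fun _ _ => rfl, fun _ _ => rfl, rfl, by simp [group, labelled], rfl⟩, h13, le_rfl,
      by simp [h15]⟩).mono le_rfl fun s hs => by simpa using hs.1
  rintro k s ⟨hs, hk, hkL, h15⟩
  have e3 : s.reg 3 = 1 := (hs.reg 3 (by decide)).trans h3
  have emem : s.mem = s₀.mem := funext fun a => hs.mem a (Or.inr (Nat.zero_le _))
  have hlt := hidx (L - (k + 1)) (by omega)
  have m1 : (base + (L - (k + 1)) + 1) % E.B = base + (L - (k + 1)) + 1 :=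
    Nat.mod_eq_of_lt (by omega)
  refine Hoare.block rfl (by simp [runTime, Instr.time])
    ⟨⟨fun r hr => ?_, fun a ha => ?_, hs.hyp, ?_, hs.outBits⟩, ?_, by omega, ?_⟩
  · have := hs.reg r hr
    simp at hr this
    simp [run, Instr.next, RamState.setReg, hr, this]
  · simp [run, Instr.next, RamState.setReg, emem]
  · simp [run, Instr.next, RamState.setReg, hs.outPoints, h15, emem, hE _ hlt]
    rw [show L - k = L - (k + 1) + 1 by omega]
    simp [group, labelled, List.range_succ]
  · simp [run, Instr.next, RamState.setReg, hk, e3]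
  · simp [run, Instr.next, RamState.setReg, e3, h15, m1]
    omega

/-- Output the training samples of the chosen hypotheses. -/
def emitLoop : Prog :=
  .while 12 (.seq (block (.sub 12 12 3) [.add 15 18 12, .load 15 15, .mul 15 15 4, .add 15 15 19,
    .add 13 4 30]) emitGroupLoop)

/-- The training samples of the last `c` chosen hypotheses, in reverse order. -/
def chosenGroups (pt : ℕ → X) (f : X → Bool) (m L n : ℕ) (mem : ℕ → ℕ) (c : ℕ) :
    List (List (X × Bool)) :=
  (List.range c).map fun i => group pt f L (4 * m + mem (3 * m + (n - 1 - i)) * L) mem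

theorem emitLoop_spec {E : Env X} {m L n T : ℕ} {pt : ℕ → X} {f : X → Bool}
    (hE : ∀ i < m, E.sample[i]? = some (pt i, f (pt i))) (s₀ : RamState X)
    (hbase : Base m L n T s₀) (hs₀ : Boosted E.learner pt f m L T 0 s₀)
    (hsel : Selected pt f m n T s₀) (h12 : s₀.reg 12 = n) (hn : n ≤ m)
    (hB : 4 * m + T * L + L < E.B) :
    Hoare E emitLoop s₀ (n * (14 + 8 * L) + 1) fun s =>
      s.outPoints = (chosenGroups pt f m L n s₀.mem n).flatten ∧ s.outBits = [] := by
  refine (Hoare.countdown_const (τ := 13 + 8 * L) (fun k s => Same [12, 13, 14, 15] 0 0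
      { s₀ with outPoints := (chosenGroups pt f m L n s₀.mem (n - k)).flatten } s ∧
      s.reg 12 = k ∧ k ≤ n) (fun k s h => h.2.1) ?_ n s₀
    ⟨⟨fun _ _ => rfl, fun _ _ => rfl, rfl, by simp [chosenGroups, hbase.outPoints], rfl⟩, h12,
      le_rfl⟩).mono (by apply le_of_eq; ring)
      fun s hs => ⟨hs.1.outPoints.trans (by simp), hs.1.outBits.trans hbase.outBits⟩
  rintro k s ⟨hs, hk, hkn⟩
  have e3 : s.reg 3 = 1 := (hs.reg 3 (by decide)).trans hbase.r3
  have e4 : s.reg 4 = L := (hs.reg 4 (by decide)).trans hbase.r4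
  have e18 : s.reg 18 = 3 * m := (hs.reg 18 (by decide)).trans hbase.r18
  have e19 : s.reg 19 = 4 * m := (hs.reg 19 (by decide)).trans hbase.r19
  have e30 : s.reg 30 = 0 := (hs.reg 30 (by decide)).trans hbase.r30
  have emem : s.mem = s₀.mem := funext fun a => hs.mem a (Or.inr (Nat.zero_le _))
  set t := s₀.mem (3 * m + k) with ht
  have htT : t < T := hsel.1 k (by omega)
  have htL : (t + 1) * L ≤ T * L := Nat.mul_le_mul_right L htT
  rw [Nat.succ_mul] at htL
  have m1 : (3 * m + k) % E.B = 3 * m + k := Nat.mod_eq_of_lt (by omega)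
  have m2 : (t * L) % E.B = t * L := Nat.mod_eq_of_lt (by omega)
  have m3 : (t * L + 4 * m) % E.B = 4 * m + t * L := by rw [Nat.mod_eq_of_lt (by omega), add_comm]
  have m4 : L % E.B = L := Nat.mod_eq_of_lt (by omega)
  refine Hoare.mono (Hoare.seq (hoare_block_eq E rfl (τ := 11) (by simp [runTime, Instr.time]))
    (τ₂ := L * 8 + 1) ?_) (by omega) (fun _ h => h)
  rintro s₁ rfl
  set s₁ := run E (.sub 12 12 3) [.add 15 18 12, .load 15 15, .mul 15 15 4, .add 15 15 19,
    .add 13 4 30] s with hs₁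
  have hreg₁ : ∀ r, r ∉ [12, 13, 14, 15] → s₁.reg r = s.reg r := by
    intro r hr
    simp at hr
    simp [hs₁, run, Instr.next, RamState.setReg, hr]
  have f12 : s₁.reg 12 = k := by simp [hs₁, run, Instr.next, RamState.setReg, hk, e3]
  have f13 : s₁.reg 13 = L := by simp [hs₁, run, Instr.next, RamState.setReg, e4, e30, m4]
  have f15 : s₁.reg 15 = 4 * m + t * L := by
    simp [hs₁, run, Instr.next, RamState.setReg, hk, e3, e4, e18, e19, m1, emem, ← ht, m2, m3]
  have hmem₁ : s₁.mem = s₀.mem := emem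
  have hhyp₁ : s₁.hyp = s.hyp := rfl
  have hp₁ : s₁.outPoints = s.outPoints := rfl
  have hb₁ : s₁.outBits = s.outBits := rfl
  clear_value s₁
  refine (emitGroupLoop_spec (m := m) (f := f) (pt := pt) hE s₁ ((hreg₁ 3 (by decide)).trans e3)
    f13 f15 (fun j hj => ?_) (by omega)).mono le_rfl ?_
  · rw [hmem₁]
    exact hs₀.idx t (Nat.zero_le _) htT j hj
  · rintro s₂ hsame
    refine ⟨⟨fun r hr => ?_, fun a ha => ?_, ?_, ?_, ?_⟩, ?_, by omega⟩
    · have h1 := hsame.reg r (fun h => hr (by simp at h ⊢; omega))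
      rw [h1]
      exact (hreg₁ r hr).trans (hs.reg r hr)
    · rw [hsame.mem a ha]
      exact congrFun hmem₁ a
    · rw [hsame.hyp]
      exact hhyp₁.trans hs.hyp
    · rw [hsame.outPoints]
      simp only
      rw [hp₁, hs.outPoints, hmem₁, show n - k = n - (k + 1) + 1 by omega]
      simp only [chosenGroups, List.range_succ, List.map_append, List.flatten_append, List.map_cons,
        List.map_nil, List.flatten_cons, List.flatten_nil, List.append_nil]
      rw [show n - 1 - (n - (k + 1)) = k by omega]
    · rw [hsame.outBits]
      exact hb₁.trans hs.outBits
    · rw [hsame.reg 12 (by decide)]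
      exact f12

/-! ### Initialization and the whole boosting run -/

/-- Computation of `20 * ⌈log₂ m⌉` in register `7`. -/
def logLoop : Prog :=
  .while 14 (block (.add 13 13 13) [.add 7 7 15, .sub 14 0 13])

def initWeightsLoop : Prog := .while 12 (block (.sub 12 12 3) [.store 12 3])

/-- Register `13` runs through the powers `2 ^ a`, and the loop stops when `m - 2 ^ a` truncates to
zero, which happens exactly at `a = Nat.clog 2 m`. -/
theorem logLoop_spec {E : Env X} {m : ℕ} (s₀ : RamState X) (h0 : s₀.reg 0 = m)
    (h13 : s₀.reg 13 = 1) (h15 : s₀.reg 15 = 20) (h7 : s₀.reg 7 = 0) (h14 : s₀.reg 14 = m - 1)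
    (hB : 2 ^ Nat.clog 2 m < E.B) (hB' : 20 * Nat.clog 2 m < E.B) :
    Hoare E logLoop s₀ (Nat.clog 2 m * 6 + 1) fun s =>
      Same [7, 13, 14] 0 0 s₀ s ∧ s.reg 7 = 20 * Nat.clog 2 m := by
  refine (Hoare.bounded (fun _ => 5) (fun k s => Same [7, 13, 14] 0 0 s₀ s ∧
      ∃ a, a + k = Nat.clog 2 m ∧ s.reg 13 = 2 ^ a ∧ s.reg 7 = 20 * a ∧ s.reg 14 = m - 2 ^ a)
    ?_ ?_ ?_ (Nat.clog 2 m) s₀ ⟨.refl _ _ _ _, 0, by simp, by simp [h13], by simp [h7], by simp [h14]⟩).mono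
      (by simp) ?_
  · rintro s ⟨-, a, ha, -, -, h14⟩
    have := Nat.le_pow_clog (by norm_num : 1 < 2) m
    rw [add_zero] at ha
    rw [h14, ha]
    omega
  · rintro k s ⟨-, a, ha, -, -, h14⟩
    have : 2 ^ a < m := (Nat.lt_clog_iff_pow_lt (by norm_num)).1 (by omega)
    omega
  · rintro k s ⟨hs, a, ha, h13, h7, h14⟩
    have e0 := (hs.reg 0 (by decide)).trans h0
    have e15 := (hs.reg 15 (by decide)).trans h15
    have hle : 2 ^ (a + 1) ≤ 2 ^ Nat.clog 2 m := Nat.pow_le_pow_right (by norm_num) (by omega)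
    have h2 : 2 ^ a + 2 ^ a = 2 ^ (a + 1) := by ring
    have m1 : (2 ^ (a + 1)) % E.B = 2 ^ (a + 1) := Nat.mod_eq_of_lt (by omega)
    have m2 : (20 * a + 20) % E.B = 20 * a + 20 := Nat.mod_eq_of_lt (by omega)
    refine Hoare.block rfl (by simp [runTime, Instr.time])
      ⟨⟨fun r hr => ?_, fun a ha => hs.mem a ha, hs.hyp, hs.outPoints, hs.outBits⟩,
        a + 1, by omega, ?_, ?_, ?_⟩
    · have := hs.reg r hr
      simp at hr
      simp [run, Instr.next, RamState.setReg, hr, this]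
    · simp [run, Instr.next, RamState.setReg, h13, h2, m1]
    · simp [run, Instr.next, RamState.setReg, h7, e15, m2]
      ring
    · simp [run, Instr.next, RamState.setReg, h13, h2, m1, e0]
  · rintro s ⟨hs, a, ha, -, h7, -⟩
    exact ⟨hs, by rw [h7, ← ha, add_zero]⟩

theorem initWeightsLoop_spec {E : Env X} {m : ℕ} (s₀ : RamState X) (h3 : s₀.reg 3 = 1)
    (h12 : s₀.reg 12 = m) :
    Hoare E initWeightsLoop s₀ (m * 4 + 1) fun s =>
      Same [12] 0 m s₀ s ∧ ∀ i < m, s.mem i = 1 := by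
  refine (Hoare.countdown_const (τ := 3) (fun k s =>
      Same [12] 0 m s₀ s ∧ s.reg 12 = k ∧ k ≤ m ∧ ∀ i, k ≤ i → i < m → s.mem i = 1)
    (fun k s h => h.2.1) ?_ m s₀ ⟨.refl _ _ _ _, h12, le_rfl, fun i hi hi' => by omega⟩).mono
      le_rfl fun s hs => ⟨hs.1, fun i hi => hs.2.2.2 i (Nat.zero_le _) hi⟩
  rintro k s ⟨hs, hk, hkm, h1⟩
  have e3 := (hs.reg 3 (by decide)).trans h3
  refine Hoare.block rfl (by simp [runTime, Instr.time])
    ⟨⟨fun r hr => ?_, fun a ha => ?_, hs.hyp, hs.outPoints, hs.outBits⟩, ?_, by omega,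
      fun i hi hi' => ?_⟩
  · have := hs.reg r hr
    simp at hr
    simp [run, Instr.next, RamState.setReg, hr, this]
  · rw [← hs.mem a ha]
    have : a ≠ k := by omega
    simp [run, Instr.next, RamState.setReg, hk, e3, this]
  · simp [run, Instr.next, RamState.setReg, hk, e3]
  · by_cases hik : i = k
    · simp [run, Instr.next, RamState.setReg, hk, e3, hik]
    · have := h1 i (by omega) hi'
      simp [run, Instr.next, RamState.setReg, hk, e3, hik, this]

/-- Initialization of boosting. -/
def prelude : Prog :=
  .seq (block (.const 13 1) [.const 15 20, .const 7 0, .sub 14 0 13]) (.seq logLoop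
    (.seq (block (.add 18 0 0) [.add 18 18 0, .add 19 18 0, .add 12 0 30])
      (.seq initWeightsLoop (block (.add 10 0 30) [.add 8 7 30]))))

theorem prelude_spec {E : Env X} {m L n : ℕ} {pt : ℕ → X} {f : X → Bool} (hm : 0 < m)
    (s : RamState X) (h0 : s.reg 0 = m) (h3 : s.reg 3 = 1) (h4 : s.reg 4 = L) (h5 : s.reg 5 = n)
    (h30 : s.reg 30 = 0) (hp : s.outPoints = []) (hb : s.outBits = [])
    (hB : 10 * (m ^ 2 * 2 ^ (20 * Nat.clog 2 m)) < E.B) (hB' : 20 < E.B) :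
    Hoare E prelude s (Nat.clog 2 m * 6 + m * 4 + 25) fun s' =>
      Base m L n (20 * Nat.clog 2 m) s' ∧
      Boosted E.learner pt f m L (20 * Nat.clog 2 m) (20 * Nat.clog 2 m) s' := by
  set K := Nat.clog 2 m with hK
  have hT : 20 * K < 2 ^ (20 * K) := Nat.lt_two_pow_self
  have hmm : 1 * 2 ^ (20 * K) ≤ m ^ 2 * 2 ^ (20 * K) :=
    Nat.mul_le_mul_right _ (Nat.one_le_pow _ _ hm)
  have hKT : 2 ^ K ≤ 2 ^ (20 * K) := Nat.pow_le_pow_right (by norm_num) (by omega)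
  have hm1 : m ^ 2 * 1 ≤ m ^ 2 * 2 ^ (20 * K) := Nat.mul_le_mul_left _ Nat.one_le_two_pow
  have hm2 : m * 1 ≤ m ^ 2 := by rw [pow_two]; exact Nat.mul_le_mul_left m hm
  have a1 : 1 % E.B = 1 := Nat.mod_eq_of_lt (by omega)
  have a2 : 20 % E.B = 20 := Nat.mod_eq_of_lt (by omega)
  have a3 : m % E.B = m := Nat.mod_eq_of_lt (by omega)
  have a4 : (m + m) % E.B = m + m := Nat.mod_eq_of_lt (by omega)
  have a5 : (m + m + m) % E.B = m + m + m := Nat.mod_eq_of_lt (by omega)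
  have a6 : (m + m + m + m) % E.B = m + m + m + m := Nat.mod_eq_of_lt (by omega)
  have a7 : (20 * K) % E.B = 20 * K := Nat.mod_eq_of_lt (by omega)
  refine Hoare.mono (Hoare.seq (hoare_block_eq E rfl (τ := 7) (by simp [runTime, Instr.time]))
    (τ₂ := K * 6 + m * 4 + 15) ?_) (by omega) (fun _ h => h)
  rintro s₁ rfl
  set s₁ := run E (.const 13 1) [.const 15 20, .const 7 0, .sub 14 0 13] s with hs₁
  have hreg₁ : ∀ r, r ∉ [7, 13, 14, 15] → s₁.reg r = s.reg r := by
    intro r hr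
    simp at hr
    simp [hs₁, run, Instr.next, RamState.setReg, hr]
  have b13 : s₁.reg 13 = 1 := by simp [hs₁, run, Instr.next, RamState.setReg, a1]
  have b15 : s₁.reg 15 = 20 := by simp [hs₁, run, Instr.next, RamState.setReg, a2]
  have b7 : s₁.reg 7 = 0 := by simp [hs₁, run, Instr.next, RamState.setReg]
  have b14 : s₁.reg 14 = m - 1 := by simp [hs₁, run, Instr.next, RamState.setReg, a1, h0]
  have hp₁ : s₁.outPoints = s.outPoints := rfl
  have hb₁ : s₁.outBits = s.outBits := rfl
  clear_value s₁
  refine Hoare.mono (Hoare.seq (logLoop_spec s₁ ((hreg₁ 0 (by decide)).trans h0) b13 b15 b7 b14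
    (show 2 ^ K < E.B by omega) (show 20 * K < E.B by omega)) (τ₂ := m * 4 + 13) ?_) (by omega) (fun _ h => h)
  rintro s₂ ⟨hsame, c7⟩
  have hreg₂ : ∀ r, r ∉ [7, 13, 14, 15] → s₂.reg r = s.reg r := fun r hr =>
    (hsame.reg r (fun h => hr (by simp at h ⊢; omega))).trans (hreg₁ r hr)
  have c0 := (hreg₂ 0 (by decide)).trans h0
  have c30 := (hreg₂ 30 (by decide)).trans h30
  refine Hoare.mono (Hoare.seq (hoare_block_eq E rfl (τ := 7) (by simp [runTime, Instr.time]))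
    (τ₂ := m * 4 + 5) ?_) (by omega) (fun _ h => h)
  rintro s₃ rfl
  set s₃ := run E (.add 18 0 0) [.add 18 18 0, .add 19 18 0, .add 12 0 30] s₂ with hs₃
  have hb₃ : Base m L n (20 * K) s₃ := by
    have d0 : s₃.reg 0 = m := by simp [hs₃, run, Instr.next, RamState.setReg, c0]
    have d3 : s₃.reg 3 = 1 := by
      simp [hs₃, run, Instr.next, RamState.setReg, hreg₂ 3 (by decide), h3]
    have d4 : s₃.reg 4 = L := by
      simp [hs₃, run, Instr.next, RamState.setReg, hreg₂ 4 (by decide), h4]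
    have d5 : s₃.reg 5 = n := by
      simp [hs₃, run, Instr.next, RamState.setReg, hreg₂ 5 (by decide), h5]
    have d7 : s₃.reg 7 = 20 * K := by simp [hs₃, run, Instr.next, RamState.setReg, c7, hK]
    have d18 : s₃.reg 18 = 3 * m := by
      simp [hs₃, run, Instr.next, RamState.setReg, c0, a4, a5]
      omega
    have d19 : s₃.reg 19 = 4 * m := by
      simp [hs₃, run, Instr.next, RamState.setReg, c0, a4, a5, a6]
      omega
    have d30 : s₃.reg 30 = 0 := by simp [hs₃, run, Instr.next, RamState.setReg, c30]
    exact ⟨d0, d3, d4, d5, d7, d18, d19, d30, (hsame.outPoints.trans hp₁).trans hp,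
      (hsame.outBits.trans hb₁).trans hb⟩
  have d12 : s₃.reg 12 = m := by
    simp [hs₃, run, Instr.next, RamState.setReg, c0, c30, a3]
  clear_value s₃
  refine Hoare.mono (Hoare.seq (initWeightsLoop_spec s₃ hb₃.r3 d12) (τ₂ := 3) ?_) (by omega)
    (fun _ h => h)
  rintro s₄ ⟨hsame₄, hone⟩
  have hb₄ := hsame₄.base hb₃ (by decide)
  refine Hoare.block rfl (by simp [runTime, Instr.time])
    ⟨hb₄.congr (fun r hr => ?_) rfl rfl, le_rfl, ?_, fun t h1 h2 => by omega,
      fun t h1 h2 => by omega, fun i hi => ?_, ?_, ?_⟩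
  · have : r ≠ 8 ∧ r ≠ 10 := by simp at hr; omega
    simp [run, Instr.next, RamState.setReg, this]
  · simp [run, Instr.next, RamState.setReg, hb₄.r7, hb₄.r30, a7]
  · simp [run, Instr.next, RamState.setReg, hone i hi]
  · simp only [run, Instr.next, RamState.setReg]
    rw [Finset.sum_congr rfl fun i hi => hone i (Finset.mem_range.1 hi)]
    simp [hb₄.r0, hb₄.r30, a3]
  · simp [run, Instr.next, RamState.setReg, hb₄.r0, hb₄.r30, a3]

/-- Boosting, selection of hypotheses, and output of their training samples. -/
def boost : Prog :=
  .seq prelude (.seq (.while 8 attempt) (.seq (block (.const 22 1) [])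
    (.seq (.while 22 voteAttempt) (.seq (block (.add 12 5 30) []) emitLoop))))

/-- The postcondition refers to the learner on the emitted groups, not to the hypothesis slots,
because reconstruction has to retrain. The assumptions `L ≤ m` and `n ≤ m` let the drawn voters fit
into `[3 * m, 4 * m)` and make the cost of handling training samples linear in `m`. -/
theorem boost_spec {E : Env X} {C : Set (X → Bool)} {m d e L n : ℕ} {pt : ℕ → X} {f : X → Bool}
    (hE : ∀ i < m, E.sample[i]? = some (pt i, f (pt i))) (hC : vcDim C ≤ d)
    (hC' : vcDim (dualClass C) ≤ e) (hd : 0 < d) (he : 0 < e) (hL : L = 2 ^ 14 * d)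
    (hn : n = 2 ^ 14 * e) (hA : E.learner.Proper C) (hA' : E.learner.Consistent C) (hf : f ∈ C)
    (hLm : L ≤ m) (hnm : n ≤ m) (s : RamState X) (h0 : s.reg 0 = m) (h3 : s.reg 3 = 1)
    (h4 : s.reg 4 = L) (h5 : s.reg 5 = n) (h30 : s.reg 30 = 0) (hp : s.outPoints = [])
    (hb : s.outBits = []) (hB : 10 * (m ^ 2 * 2 ^ (20 * Nat.clog 2 m)) < E.B) :
    Hoare E boost s (20 * Nat.clog 2 m * (2 * (80 * m + E.TA L + 2 * (m * E.TE L) + 51))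
        + 2 * (m * (16 + n * (18 + E.TE L)) + 8 * n + 10) + n * (14 + 8 * L)
        + Nat.clog 2 m * 6 + m * 4 + 40) fun s' =>
      (∃ mem : ℕ → ℕ, s'.outPoints = (chosenGroups pt f m L n mem n).flatten ∧
        (∀ g ∈ chosenGroups pt f m L n mem n, ∀ w ∈ g, ∃ i < m, w = (pt i, f (pt i))) ∧
        ∀ i < m, 2 * ∑ j ∈ Finset.range n, mistake (E.learner
          (group pt f L (4 * m + mem (3 * m + j) * L) mem) (pt i)) (f (pt i)) < n) ∧
      s'.outBits = [] := by
  have hm : 0 < m := by omega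
  have hk : 0 < Nat.clog 2 m := Nat.clog_pos (by norm_num) (by omega)
  have hmk : m ≤ 2 ^ Nat.clog 2 m := Nat.le_pow_clog (by norm_num) m
  have hmm : m ^ 2 * 1 ≤ m ^ 2 * 2 ^ (20 * Nat.clog 2 m) :=
    Nat.mul_le_mul_left _ Nat.one_le_two_pow
  have hm2 : m * 4 ≤ m ^ 2 := by rw [pow_two]; exact Nat.mul_le_mul_left m (by omega)
  have hTL : 20 * Nat.clog 2 m * L ≤ m ^ 2 * 2 ^ (20 * Nat.clog 2 m) := by
    rw [mul_comm (m ^ 2)]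
    exact Nat.mul_le_mul Nat.lt_two_pow_self.le (by nlinarith)
  set k := Nat.clog 2 m with hkdef
  refine Hoare.mono (Hoare.seq (prelude_spec (pt := pt) (f := f) hm s h0 h3 h4 h5 h30 hp hb hB
    (by omega)) (τ₂ := 20 * k * (2 * (80 * m + E.TA L + 2 * (m * E.TE L) + 51))
        + 2 * (m * (16 + n * (18 + E.TE L)) + 8 * n + 10) + n * (14 + 8 * L) + 14) ?_)
    (by omega) fun _ h => h
  rintro s₁ ⟨hb₁, hs₁⟩
  refine Hoare.mono (Hoare.seq (boostLoop_spec hE hC hd hL hA hA' hf hm hLm hB s₁ hb₁ hs₁)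
    (τ₂ := 2 * (m * (16 + n * (18 + E.TE L)) + 8 * n + 10) + n * (14 + 8 * L) + 10) ?_)
    (by omega) fun _ h => h
  rintro s₂ ⟨hb₂, hs₂⟩
  refine Hoare.mono (Hoare.seq (hoare_block_eq E rfl (τ := 1) (by simp [runTime, Instr.time]))
    (τ₂ := 2 * (m * (16 + n * (18 + E.TE L)) + 8 * n + 10) + n * (14 + 8 * L) + 7) ?_)
    (by omega) fun _ h => h
  rintro s₃ rfl
  have a1 : 1 % E.B = 1 := Nat.mod_eq_of_lt (by omega)
  have a2 : n % E.B = n := Nat.mod_eq_of_lt (by omega)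
  have hb₃ : Base m L n (20 * k) (run E (.const 22 1) [] s₂) := hb₂.congr (fun r hr => by
    have : r ≠ 22 := by simp at hr; omega
    simp [run, Instr.next, RamState.setReg, this]) rfl rfl
  have hs₃ : Boosted E.learner pt f m L (20 * k) 0 (run E (.const 22 1) [] s₂) :=
    hs₂.congr (by simp [run, Instr.next, RamState.setReg])
      (by simp [run, Instr.next, RamState.setReg]) (fun _ _ => rfl) fun _ _ => rfl
  refine Hoare.mono (Hoare.seq (selectLoop_spec hE hC' he hn hA hf hm hk hmk hnm hB _ hb₃ hs₃
    (by simp [run, Instr.next, RamState.setReg, a1])) (τ₂ := n * (14 + 8 * L) + 4) ?_)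
    (by omega) fun _ h => h
  rintro s₄ ⟨hb₄, hs₄, hsel⟩
  refine Hoare.mono (Hoare.seq (hoare_block_eq E rfl (τ := 1) (by simp [runTime, Instr.time]))
    (τ₂ := n * (14 + 8 * L) + 1) ?_) (by omega) fun _ h => h
  rintro s₅ rfl
  have hb₅ : Base m L n (20 * k) (run E (.add 12 5 30) [] s₄) := hb₄.congr (fun r hr => by
    have : r ≠ 12 := by simp at hr; omega
    simp [run, Instr.next, RamState.setReg, this]) rfl rfl
  have hs₅ : Boosted E.learner pt f m L (20 * k) 0 (run E (.add 12 5 30) [] s₄) :=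
    hs₄.congr (by simp [run, Instr.next, RamState.setReg])
      (by simp [run, Instr.next, RamState.setReg]) (fun _ _ => rfl) fun _ _ => rfl
  refine (emitLoop_spec hE _ hb₅ hs₅ hsel
    (by simp [run, Instr.next, RamState.setReg, hb₄.r5, hb₄.r30, a2]) hnm (by omega)).mono le_rfl
    fun s₆ hs₆ => ⟨⟨s₄.mem, hs₆.1, ?_, ?_⟩, hs₆.2⟩
  · intro g hg w hw
    obtain ⟨i, hi, rfl⟩ := List.mem_map.1 hg
    have hi' := List.mem_range.1 hi
    simp only [group, labelled, List.map_map, List.mem_map, List.mem_range, Function.comp] at hw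
    obtain ⟨j, hj, rfl⟩ := hw
    exact ⟨_, hs₄.idx _ (Nat.zero_le _) (hsel.1 (n - 1 - i) (by omega)) j hj, rfl⟩
  · intro i hi
    have h := hsel.2 i hi
    rwa [Finset.sum_congr rfl fun j hj => by
      rw [hs₄.hyp _ (Nat.zero_le _) (hsel.1 j (Finset.mem_range.1 hj))]] at h

/-! ### Reconstruction -/

/-- The first `n` consecutive segments of length `L`. -/
def chunks {α : Type*} (L : ℕ) : ℕ → List α → List (List α)
  | 0, _ => []
  | n + 1, l => l.take L :: chunks L n (l.drop L)

theorem chunks_flatten {α : Type*} {L : ℕ} (gs : List (List α)) (h : ∀ g ∈ gs, g.length = L) :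
    chunks L gs.length gs.flatten = gs := by
  induction gs with
  | nil => rfl
  | cons g gs ih =>
    have hg := h g (by simp)
    rw [List.length_cons, chunks, List.flatten_cons, List.take_left' hg, List.drop_left' hg,
      ih fun g' hg' => h g' (by simp [hg'])]

theorem length_flatten_of_forall {α : Type*} {L : ℕ} (gs : List (List α))
    (h : ∀ g ∈ gs, g.length = L) : gs.flatten.length = gs.length * L := by
  induction gs with
  | nil => simp
  | cons g gs ih =>
    rw [List.flatten_cons, List.length_append, h g (by simp), ih fun g' hg' => h g' (by simp [hg']),
      List.length_cons]
    ring

/-- Train on short outputs, and take a majority vote over the segments of long ones. -/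
def reconstruct (A : Learner X) (L n : ℕ) (z : Compressed X) (x : X) : Bool :=
  if z.1.length < L * n then A z.1 x
  else decide (n < 2 * (chunks L n z.1).countP fun g => A g x)

theorem countP_map_range {α : Type*} (g : ℕ → α) (p : α → Bool) (n : ℕ) :
    ((List.range n).map g).countP p = ∑ i ∈ Finset.range n, if p (g i) = true then 1 else 0 := by
  induction n with
  | zero => simp
  | succ n ih =>
    rw [List.range_succ, List.map_append, List.countP_append, ih, Finset.sum_range_succ]
    simp [List.countP_singleton]

/-- The output consists of `n` segments of length `L`, long enough to select the voting branch. A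
strict majority of correct votes decides for the right label in both cases of `f x`. -/
theorem reconstruct_majority {A : Learner X} {pt : ℕ → X} {f : X → Bool} {m L n : ℕ}
    {mem : ℕ → ℕ} {z : Compressed X} (hz : z.1 = (chosenGroups pt f m L n mem n).flatten) {x : X}
    (h : 2 * ∑ j ∈ Finset.range n, mistake
      (A (group pt f L (4 * m + mem (3 * m + j) * L) mem) x) (f x) < n) :
    reconstruct A L n z x = f x := by
  have hlen : ∀ g ∈ chosenGroups pt f m L n mem n, g.length = L := by
    intro g hg
    obtain ⟨i, -, rfl⟩ := List.mem_map.1 hg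
    exact length_group _ _ _ _ _
  have hcn : (chosenGroups pt f m L n mem n).length = n := by simp [chosenGroups]
  have h1 : z.1.length = n * L := by rw [hz, length_flatten_of_forall _ hlen, hcn]
  have h2 : chunks L n z.1 = chosenGroups pt f m L n mem n := by
    have := chunks_flatten _ hlen
    rwa [hcn, ← hz] at this
  set G : ℕ → Bool := fun j => A (group pt f L (4 * m + mem (3 * m + j) * L) mem) x with hG
  have h3 : (chosenGroups pt f m L n mem n).countP (fun g => A g x)
      = ∑ j ∈ Finset.range n, if G j = true then 1 else 0 := by
    rw [chosenGroups, countP_map_range]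
    -- The groups are emitted in reverse order, which a count does not see.
    exact Finset.sum_range_reflect (fun j => if G j = true then 1 else 0) n
  rw [reconstruct, if_neg (by rw [h1, mul_comm]; omega), h2, h3]
  cases hfx : f x with
  | false =>
    rw [hfx] at h
    have h4 : ∑ j ∈ Finset.range n, mistake (G j) false
        = ∑ j ∈ Finset.range n, if G j = true then 1 else 0 :=
      Finset.sum_congr rfl fun j _ => by cases G j <;> rfl
    rw [← h4, decide_eq_false_iff_not]
    exact not_lt.2 h.le
  | true =>
    rw [hfx] at h
    have h4 : ∑ j ∈ Finset.range n, mistake (G j) true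
        + ∑ j ∈ Finset.range n, (if G j = true then 1 else 0) = n := by
      rw [← Finset.sum_add_distrib, Finset.sum_congr rfl (g := fun _ => 1)]
      · simp
      · intro j _
        cases G j <;> rfl
    rw [decide_eq_true_eq]
    have h5 : 2 * ∑ j ∈ Finset.range n, mistake (G j) true < n := h
    omega

/-! ### The complete program -/

def emitAllLoop : Prog := .while 12 (block (.sub 12 12 3) [.emitPoint 12])

theorem emitAllLoop_spec {E : Env X} {m : ℕ} {pt : ℕ → X} {f : X → Bool}
    (hE : ∀ i < m, E.sample[i]? = some (pt i, f (pt i))) (s₀ : RamState X) (h3 : s₀.reg 3 = 1)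
    (h12 : s₀.reg 12 = m) (hp : s₀.outPoints = []) (hb : s₀.outBits = []) :
    Hoare E emitAllLoop s₀ (m * 4 + 1) fun s =>
      s.outPoints = labelled f ((List.range m).map fun c => pt (m - 1 - c)) ∧ s.outBits = [] := by
  refine (Hoare.countdown_const (τ := 3) (fun k s => s.reg 3 = 1 ∧ s.reg 12 = k ∧ k ≤ m ∧
      s.outPoints = labelled f ((List.range (m - k)).map fun c => pt (m - 1 - c)) ∧ s.outBits = [])
    (fun k s h => h.2.1) ?_ m s₀ ⟨h3, h12, le_rfl, by simp [hp, labelled], hb⟩).mono le_rfl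
      fun s hs => hs.2.2.2
  rintro k s ⟨h3, hk, hkm, hp, hb⟩
  refine Hoare.block rfl (by simp [runTime, Instr.time]) ⟨?_, ?_, by omega, ?_, hb⟩
  · simp [run, Instr.next, RamState.setReg, h3]
  · simp [run, Instr.next, RamState.setReg, h3, hk]
  · rw [show m - k = m - (k + 1) + 1 by omega]
    simp [run, Instr.next, RamState.setReg, h3, hk, hE k (by omega), hp, labelled, List.range_succ]
    rw [show m - 1 - (m - (k + 1)) = k by omega]
    exact ⟨rfl, rfl⟩

/-- The compression program. -/
def compressor : Prog :=
  .ite 1 (.seq (block (.const 3 1) [.const 4 (2 ^ 14), .mul 4 4 1, .const 5 (2 ^ 14), .mul 5 5 2,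
    .mul 6 4 5, .sub 6 6 0]) (.ite 6 (.seq (block (.add 12 0 30) []) emitAllLoop) boost)) skip

/-- Outputs that are admissible and from which the labels can be reconstructed. -/
def GoodOutput (A : Learner X) (pt : ℕ → X) (f : X → Bool) (m L n : ℕ) (z : Compressed X) : Prop :=
  (∀ w ∈ z.1, ∃ i < m, w = (pt i, f (pt i))) ∧ z.1.length ≤ L * n ∧ z.2 = [] ∧
    ∀ i < m, reconstruct A L n z (pt i) = f (pt i)

/-! ### Word size and running time estimates -/

/-- With `M = m + d + e + 1 ≥ 3`, the constant `2 ^ 28` is absorbed by `M ^ 28`, and `M ^ 2`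
dominates `d * e`. -/
theorem word_bound {m d e : ℕ} (hm : 1 ≤ m) (he : 1 ≤ e) :
    2 ^ 14 < (m + d + e + 1) ^ 30 ∧ 2 ^ 14 * d < (m + d + e + 1) ^ 30 ∧
      2 ^ 14 * e < (m + d + e + 1) ^ 30 ∧ 2 ^ 14 * d * (2 ^ 14 * e) < (m + d + e + 1) ^ 30 ∧
      m < (m + d + e + 1) ^ 30 := by
  obtain ⟨M, hM⟩ : ∃ M, M = m + d + e + 1 := ⟨_, rfl⟩
  obtain ⟨B, hB⟩ : ∃ B, B = M ^ 30 := ⟨_, rfl⟩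
  have h2 : 268435456 * (d * e) ≤ 268435456 * (M * M) :=
    Nat.mul_le_mul_left _ (Nat.mul_le_mul (by omega) (by omega))
  have h4 : 268435456 * (M * M) < B := by
    rw [hB, show M ^ 30 = M ^ 28 * (M * M) from by rw [← sq, ← pow_add]]
    refine Nat.mul_lt_mul_of_pos_right ?_ (Nat.mul_pos (by omega) (by omega))
    exact lt_of_lt_of_le (by norm_num) (Nat.pow_le_pow_left (show 3 ≤ M by omega) 28)
  have h5 : M ≤ M * M := Nat.le_mul_of_pos_left M (by omega)
  have h6 : 16384 * d * (16384 * e) = 268435456 * (d * e) := by ring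
  rw [← hM, ← hB, show 2 ^ 14 = 16384 by norm_num, h6]
  omega

/-- Since `2 ^ Nat.clog 2 m ≤ 2 * m`, the left side is at most `10 * 2 ^ 20 * m ^ 22`. For `m ≥ 2 ^
14` the constant is below `m ^ 2`, so the 30th power leaves ample room. -/
theorem boost_word_bound {m d e : ℕ} (hm : 2 ^ 14 ≤ m) :
    10 * (m ^ 2 * 2 ^ (20 * Nat.clog 2 m)) < (m + d + e + 1) ^ 30 := by
  have h1 : 2 ^ Nat.clog 2 m ≤ 2 * m := by
    have h2 := Nat.pow_pred_clog_lt_self (b := 2) (by norm_num) (x := m) (by omega)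
    have h3 : 0 < Nat.clog 2 m := Nat.clog_pos (by norm_num) (by omega)
    obtain ⟨k, hk⟩ := Nat.exists_eq_succ_of_ne_zero h3.ne'
    rw [hk] at h2 ⊢
    rw [Nat.pred_succ] at h2
    rw [pow_succ]
    omega
  have h4 : 2 ^ (20 * Nat.clog 2 m) ≤ 2 ^ 20 * m ^ 20 := by
    rw [mul_comm, pow_mul, ← mul_pow]
    exact Nat.pow_le_pow_left h1 20
  have h5 : 10 * 2 ^ 20 ≤ m ^ 2 :=
    le_trans (by norm_num) (Nat.pow_le_pow_left hm 2)
  calc 10 * (m ^ 2 * 2 ^ (20 * Nat.clog 2 m)) ≤ 10 * (m ^ 2 * (2 ^ 20 * m ^ 20)) := by gcongr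
    _ = 10 * 2 ^ 20 * m ^ 22 := by ring
    _ ≤ m ^ 2 * m ^ 22 := by gcongr
    _ = m ^ 24 := by ring
    _ ≤ m ^ 30 := Nat.pow_le_pow_right (by omega) (by norm_num)
    _ < (m + d + e + 1) ^ 30 := Nat.pow_lt_pow_left (by omega) (by norm_num)

/-- Up to rounding, `Nat.clog 2 m` is `log m / log 2 ≤ 2 * log m`; the rounding costs one more, and
`1 ≤ log m` for `m ≥ 3`. -/
theorem real_clog_le {m : ℕ} (hm : 3 ≤ m) : (Nat.clog 2 m : ℝ) ≤ 3 * Real.log m := by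
  have h2 := Nat.pow_pred_clog_lt_self (b := 2) (by norm_num) (x := m) (by omega)
  have h3 : 0 < Nat.clog 2 m := Nat.clog_pos (by norm_num) (by omega)
  obtain ⟨k, hk⟩ := Nat.exists_eq_succ_of_ne_zero h3.ne'
  rw [hk, Nat.pred_succ] at h2
  rw [hk]
  have h4 : (k : ℝ) * Real.log 2 ≤ Real.log m := by
    rw [← Real.log_pow]
    exact Real.log_le_log (by positivity) (by exact_mod_cast h2.le)
  have h5 := Real.log_two_gt_d9
  have h6 : 1 ≤ Real.log m := by
    rw [Real.le_log_iff_exp_le (by positivity)]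
    have := Real.exp_one_lt_d9
    have : (3 : ℝ) ≤ m := by exact_mod_cast hm
    linarith
  have h7 : (k : ℝ) * (1 / 2) ≤ k * Real.log 2 := by gcongr; linarith
  push_cast
  linarith

/-- Boosting accounts for `k * (m + a + m * t)` with `k ≤ 3 * log m`, and testing votes for `m * t *
n`, which is of order `m * t * e`. The bounds `n ≤ m` and `L * n ≤ m` turn the remaining terms into
`O(m)`. -/
theorem boost_time_le {m e n k L a t τ : ℕ} (hm : 3 ≤ m) (he : 1 ≤ e) (hn : n = 2 ^ 14 * e)
    (hnm : n ≤ m) (hK : L * n ≤ m) (ht : 1 ≤ t) (hk : k = Nat.clog 2 m)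
    (hτ : τ = 20 * k * (2 * (80 * m + a + 2 * (m * t) + 51))
        + 2 * (m * (16 + n * (18 + t)) + 8 * n + 10) + n * (14 + 8 * L) + k * 6 + m * 4 + 60) :
    (τ : ℝ) ≤ (10 ^ 6 : ℕ) * (((m : ℝ) + a) * Real.log m + (m : ℝ) * t * ((e : ℝ) + Real.log m)) := by
  set l := Real.log m with hl
  have h1 := real_clog_le hm
  rw [← hk, ← hl] at h1
  have hl0 : 0 ≤ l := Real.log_natCast_nonneg m
  have hnat : τ ≤ k * (10520 * m + 40 * a + 80 * (m * t)) + 622592 * (m * t * e) + 200 * m := by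
    have h2 : m * (n * (18 + t)) ≤ 19 * (2 ^ 14 * (m * t * e)) := by
      have : 18 + t ≤ 19 * t := by omega
      calc m * (n * (18 + t)) ≤ m * (n * (19 * t)) := by gcongr
        _ = 19 * (2 ^ 14 * (m * t * e)) := by rw [hn]; ring
    have h3 : k ≤ k * m := Nat.le_mul_of_pos_right k (by omega)
    rw [hτ]
    have h4 : 20 * k * (2 * (80 * m + a + 2 * (m * t) + 51))
        = 3200 * (k * m) + 40 * (k * a) + 80 * (k * (m * t)) + 2040 * k := by ring
    have h5 : k * (10520 * m + 40 * a + 80 * (m * t))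
        = 10520 * (k * m) + 40 * (k * a) + 80 * (k * (m * t)) := by ring
    have h6 : n * (14 + 8 * L) = 14 * n + 8 * (L * n) := by ring
    have h7 : m * (16 + n * (18 + t)) = 16 * m + m * (n * (18 + t)) := by ring
    rw [h4, h5, h6, h7]
    omega
  have hreal : (τ : ℝ) ≤ k * (10520 * m + 40 * a + 80 * (m * t)) + 622592 * (m * t * e) + 200 * m := by
    exact_mod_cast hnat
  have ht' : (1 : ℝ) ≤ t := by exact_mod_cast ht
  have he' : (1 : ℝ) ≤ e := by exact_mod_cast he
  have hm0 : (0 : ℝ) ≤ m := by positivity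
  have ha0 : (0 : ℝ) ≤ a := by positivity
  have h8 : (k : ℝ) * (10520 * m + 40 * a + 80 * (m * t))
      ≤ 3 * l * (10520 * m + 40 * a + 80 * (m * t)) := by gcongr
  have h9 : (m : ℝ) ≤ m * t * e := by
    calc (m : ℝ) = m * 1 * 1 := by ring
      _ ≤ m * t * e := by gcongr
  have h10 : 0 ≤ (m : ℝ) * l := by positivity
  have h11 : 0 ≤ (a : ℝ) * l := by positivity
  have h12 : 0 ≤ (m : ℝ) * t * l := by positivity
  push_cast
  linarith

/-- The logarithm vanishes at `m = 1`, so linear cost is charged to the term `m * t * e ≥ m`. -/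
theorem linear_time_le {m e a t τ : ℕ} (he : 1 ≤ e) (ht : 1 ≤ t) (hτ : τ ≤ 100 * m) :
    (τ : ℝ) ≤ (10 ^ 6 : ℕ) * (((m : ℝ) + a) * Real.log m + (m : ℝ) * t * ((e : ℝ) + Real.log m)) := by
  have hl0 : 0 ≤ Real.log m := Real.log_natCast_nonneg m
  have ht' : (1 : ℝ) ≤ t := by exact_mod_cast ht
  have he' : (1 : ℝ) ≤ e := by exact_mod_cast he
  have h9 : (m : ℝ) ≤ m * t * e := by
    calc (m : ℝ) = m * 1 * 1 := by ring
      _ ≤ m * t * e := by gcongr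
  have h10 : 0 ≤ ((m : ℝ) + a) * Real.log m := by positivity
  have h12 : 0 ≤ (m : ℝ) * t * Real.log m := by positivity
  have h13 : (τ : ℝ) ≤ 100 * m := by exact_mod_cast hτ
  push_cast
  linarith

/-- A class of VC dimension zero contains at most one concept. -/
theorem eq_of_vcDim_eq_zero {C : Set (X → Bool)} (h : vcDim C = 0) {f g : X → Bool} (hf : f ∈ C)
    (hg : g ∈ C) (x : X) : f x = g x := by
  by_contra hne
  have hs : Shatters C {x} := by
    intro u
    by_cases hu : f x = u x
    · exact ⟨f, hf, by simpa using hu⟩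
    · refine ⟨g, hg, ?_⟩
      simp only [Finset.mem_singleton, forall_eq]
      revert hne hu
      cases f x <;> cases g x <;> cases u x <;> simp
  have h1 : ((({x} : Finset X).card : ℕ) : ℕ∞) ≤ vcDim C := le_iSup₂_of_le {x} hs le_rfl
  rw [h] at h1
  simp at h1

theorem compressor_spec {E : Env X} {C : Set (X → Bool)} {m d e : ℕ} {pt : ℕ → X} {f : X → Bool}
    (hE : ∀ i < m, E.sample[i]? = some (pt i, f (pt i))) (hC : vcDim C = d)
    (hC' : vcDim (dualClass C) = e) (he : 1 ≤ e) (hA : E.learner.Proper C)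
    (hA' : E.learner.Consistent C) (hf : f ∈ C) (hm : 1 ≤ m) (hTE : ∀ l, 1 ≤ E.TE l)
    (hB : E.B = (m + d + e + 1) ^ 30) :
    ∃ τ : ℕ, Hoare E compressor (compressor.init m d e : RamConfig X).state τ
      (fun s => GoodOutput E.learner pt f m (2 ^ 14 * d) (2 ^ 14 * e) s.output) ∧
      (τ : ℝ) ≤ (10 ^ 6 : ℕ) * (((m : ℝ) + E.TA (2 ^ 14 * d)) * Real.log m +
        (m : ℝ) * E.TE (2 ^ 14 * d) * ((e : ℝ) + Real.log m)) := by
  set s₀ := (compressor.init m d e : RamConfig X).state with hs₀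
  have r0 : s₀.reg 0 = m := rfl
  have r1 : s₀.reg 1 = d := rfl
  have r2 : s₀.reg 2 = e := rfl
  have r30 : s₀.reg 30 = 0 := rfl
  have rp : s₀.outPoints = [] := rfl
  have rb : s₀.outBits = [] := rfl
  clear_value s₀
  obtain ⟨b1, b2, b3, b4, b5⟩ := word_bound (d := d) hm he
  rw [← hB] at b1 b2 b3 b4 b5
  rcases Nat.eq_zero_or_pos d with hd | hd
  · refine ⟨2, ?_, linear_time_le he (hTE _) (by omega)⟩
    refine Hoare.mono (Hoare.ite (τ := 1) (fun h => absurd (r1.trans hd) h) fun _ =>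
      Hoare.block rfl (by simp [runTime, Instr.time]) ?_) le_rfl fun _ h => h
    have hout : (run E (.const 31 0) [] s₀).output = ([], []) := by
      simp [run, Instr.next, RamState.setReg, RamState.output, rp, rb]
    subst hd
    rw [hout]
    refine ⟨by simp, by simp, rfl, fun i hi => ?_⟩
    -- For `d = 0` the segments are empty, and the empty output is read as a vote of `n` copies of
    -- the learner's hypothesis for the empty sample. That hypothesis is the only concept.
    refine reconstruct_majority (m := m) (pt := pt) (f := f) (mem := fun _ => 0) ?_ ?_
    · simp [chosenGroups, group, labelled]
    · rw [Finset.sum_eq_zero fun j _ => ?_]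
      · omega
      · have h1 : E.learner [] (pt i) = f (pt i) :=
          eq_of_vcDim_eq_zero (by simpa using hC) (hA f hf []) hf (pt i)
        simp [group, labelled, mistake, h1]
  · set L := 2 ^ 14 * d with hL
    set n := 2 ^ 14 * e with hn
    have a0 : 1 % E.B = 1 := Nat.mod_eq_of_lt (by omega)
    have a1 : 16384 % E.B = 16384 := Nat.mod_eq_of_lt (by omega)
    have a2 : (16384 * d) % E.B = L := Nat.mod_eq_of_lt (by omega)
    have a3 : (16384 * e) % E.B = n := Nat.mod_eq_of_lt (by omega)
    have a4 : (L * n) % E.B = L * n := Nat.mod_eq_of_lt b4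
    have a5 : m % E.B = m := Nat.mod_eq_of_lt b5
    set s₁ := run E (.const 3 1) [.const 4 (2 ^ 14), .mul 4 4 1, .const 5 (2 ^ 14), .mul 5 5 2,
      .mul 6 4 5, .sub 6 6 0] s₀ with hs₁
    have c0 : s₁.reg 0 = m := by simp [hs₁, run, Instr.next, RamState.setReg, r0]
    have c3 : s₁.reg 3 = 1 := by simp [hs₁, run, Instr.next, RamState.setReg, a0]
    have c4 : s₁.reg 4 = L := by simp [hs₁, run, Instr.next, RamState.setReg, a1, r1, a2]
    have c5 : s₁.reg 5 = n := by simp [hs₁, run, Instr.next, RamState.setReg, a1, r2, a3]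
    have c6 : s₁.reg 6 = L * n - m := by
      simp [hs₁, run, Instr.next, RamState.setReg, a1, r0, r1, r2, a2, a3, a4]
    have c30 : s₁.reg 30 = 0 := by simp [hs₁, run, Instr.next, RamState.setReg, r30]
    have cp : s₁.outPoints = [] := rp
    have cb : s₁.outBits = [] := rb
    have hstart : ∀ τ Q, Hoare E (.ite 6 (.seq (block (.add 12 0 30) []) emitAllLoop) boost) s₁ τ Q →
        Hoare E compressor s₀ (15 + τ) Q := by
      intro τ Q h
      refine Hoare.mono (Hoare.ite (τ := 14 + τ) (fun _ => ?_) fun h => by omega) (by omega)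
        fun _ h => h
      refine Hoare.mono (Hoare.seq (hoare_block_eq E rfl (τ := 13)
        (by simp [runTime, Instr.time])) (τ₂ := τ) ?_) (by omega) fun _ h => h
      rintro s rfl
      exact h
    clear_value s₁
    by_cases hmK : m < L * n
    · refine ⟨15 + (1 + (m * 4 + 3)), hstart _ _ (Hoare.ite (fun _ => ?_) fun h => by omega),
        linear_time_le he (hTE _) (by omega)⟩
      refine Hoare.mono (Hoare.seq (hoare_block_eq E rfl (τ := 1)
        (by simp [runTime, Instr.time])) (τ₂ := m * 4 + 1) ?_) (by omega) fun _ h => h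
      rintro s₂ rfl
      refine (emitAllLoop_spec hE (run E (.add 12 0 30) [] s₁) (by simp [run, Instr.next, RamState.setReg, c3])
        (by simp [run, Instr.next, RamState.setReg, c0, c30, a5]) cp cb).mono le_rfl ?_
      rintro s ⟨hp, hb⟩
      set ys := (List.range m).map fun c => pt (m - 1 - c) with hys
      have hlen : s.output.1.length = m := by
        simp [RamState.output, hp, labelled, hys]
      refine ⟨fun w hw => ?_, by omega, hb, fun i hi => ?_⟩
      · simp only [RamState.output, hp, labelled, hys, List.map_map, List.mem_map, List.mem_range,
          Function.comp] at hw
        obtain ⟨c, hc, rfl⟩ := hw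
        exact ⟨m - 1 - c, by omega, rfl⟩
      · rw [reconstruct, if_pos (by omega)]
        simp only [RamState.output, hp]
        refine hA' f hf ys (pt i) (List.mem_map.2 ⟨m - 1 - i, List.mem_range.2 (by omega), ?_⟩)
        rw [show m - 1 - (m - 1 - i) = i by omega]
    · have hLn : L ≤ L * n := Nat.le_mul_of_pos_right L (by omega)
      have hnL : n ≤ L * n := Nat.le_mul_of_pos_left n (by omega)
      have hboost := boost_spec hE hC.le hC'.le hd he hL hn hA hA' hf (by omega) (by omega) s₁ c0 c3
        c4 c5 c30 cp cb (by rw [hB]; exact boost_word_bound (by omega))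
      -- The padding by 4 matches the constant of `boost_time_le`: `15 + 1 + 40 + 4 = 60`.
      refine ⟨_, hstart _ _ (Hoare.ite (fun h => by omega) fun _ => hboost.mono (Nat.le_add_right _ 4) ?_),
        boost_time_le (L := L) (by omega) he hn (by omega) (by omega) (hTE _) rfl (by ring)⟩
      rintro s ⟨⟨mem, hp, hmem, hvote⟩, hb⟩
      refine ⟨fun w hw => ?_, ?_, hb, fun i hi => reconstruct_majority hp (hvote i hi)⟩
      · simp only [RamState.output, hp] at hw
        obtain ⟨g, hg, hwg⟩ := List.mem_flatten.1 hw
        exact hmem g hg w hwg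
      · simp only [RamState.output, hp]
        rw [length_flatten_of_forall (L := L)]
        · simp [chosenGroups, mul_comm]
        · intro g hg
          obtain ⟨i, -, rfl⟩ := List.mem_map.1 hg
          exact length_group _ _ _ _ _

/-! ### The compression map as the law of the output -/

/-- A Hoare triple for a program bounds its expected time and describes its outputs. -/
theorem Hoare.init {E : Env X} {p : Prog} {a b c τ : ℕ} {Q : RamState X → Prop}
    (h : Hoare E p (p.init a b c : RamConfig X).state τ Q) :
    expectedTime E (p.init a b c) ≤ τ ∧ ∑' z, outputProb E (p.init a b c) z = 1 ∧
      ∀ z, outputProb E (p.init a b c) z ≠ 0 → ∃ s, Q s ∧ s.output = z := by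
  classical
  -- Zero on `Q` and infinite elsewhere: a finite bound on the potential then excludes every final
  -- state outside of `Q`.
  let φ : RamState X → ℝ≥0∞ := fun s => if Q s then 0 else ⊤
  have h1 : configErt E φ (p.init a b c) ≤ τ := by
    have := h φ 0 fun s hs => by simp [φ, hs]
    rwa [add_zero] at this
  have h2 : configErt E φ (p.init a b c) ≠ ⊤ := ne_top_of_le_ne_top (ENNReal.natCast_ne_top τ) h1
  have h3 := expectedTime_le E φ (p.init a b c)
  refine ⟨h3.trans h1, tsum_outputProb E (ne_top_of_le_ne_top h2 h3), fun z hz => ?_⟩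
  obtain ⟨t, e, he, hh, hout⟩ := exists_law_of_outputProb_ne_zero E hz
  refine ⟨e.state, of_mem_support_law E (φ := φ) (Q := Q) (fun s hs => ?_) h2 he hh, hout⟩
  by_contra hQ
  simp [φ, hQ] at hs

open Classical in
/-- The law of the output of the compression program. -/
noncomputable def compressorLaw (A : Learner X) (d e : ℕ) (S : List (X × Bool)) :
    PMF (Compressed X) :=
  -- The size bound of a scheme concerns all samples, also those that no concept labels, where the
  -- learner is uncontrolled. There the default is the empty compression, should the program's
  -- output fail to be an admissible distribution. The unit running times are immaterial by
  -- `outputProb_congr_time`.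
  if h : ∃ p : PMF (Compressed X),
      (∀ z, p z = outputProb ⟨S, A, 1, 1, (S.length + d + e + 1) ^ 30⟩
        (compressor.init S.length d e) z) ∧
      ∀ z ∈ p.support, z.1 ⊆ S ∧ z.1.length ≤ 2 ^ 28 * d * e ∧ z.2.length ≤ 0
  then h.choose else PMF.pure ([], [])

theorem compressorLaw_support (A : Learner X) (d e : ℕ) (S : List (X × Bool)) :
    ∀ z ∈ (compressorLaw A d e S).support,
      z.1 ⊆ S ∧ z.1.length ≤ 2 ^ 28 * d * e ∧ z.2.length ≤ 0 := by
  intro z hz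
  rw [compressorLaw] at hz
  split_ifs at hz with h
  · exact h.choose_spec.2 z hz
  · rw [PMF.support_pure, Set.mem_singleton_iff] at hz
    simp [hz]

theorem compressorLaw_apply {C : Set (X → Bool)} {d e : ℕ} (hC : vcDim C = d)
    (hC' : vcDim (dualClass C) = e) (he : 1 ≤ e) {A : Learner X} (hA : A.Proper C)
    (hA' : A.Consistent C) {f : X → Bool} (hf : f ∈ C) {m : ℕ} (hm : 1 ≤ m) (x : Fin m → X)
    (TA TE : ℕ → ℕ) (hTE : ∀ l, 1 ≤ TE l) :
    (∀ z, outputProb ⟨labelled f (List.ofFn x), A, TA, TE, (m + d + e + 1) ^ 30⟩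
        (compressor.init m d e) z = compressorLaw A d e (labelled f (List.ofFn x)) z) ∧
      (∀ z ∈ (compressorLaw A d e (labelled f (List.ofFn x))).support, ∀ i,
        reconstruct A (2 ^ 14 * d) (2 ^ 14 * e) z (x i) = f (x i)) ∧
      expectedTime ⟨labelled f (List.ofFn x), A, TA, TE, (m + d + e + 1) ^ 30⟩
        (compressor.init m d e) ≤ ENNReal.ofReal ((10 ^ 6 : ℕ) *
          (((m : ℝ) + TA (2 ^ 14 * d)) * Real.log m +
            (m : ℝ) * TE (2 ^ 14 * d) * ((e : ℝ) + Real.log m))) := by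
  -- The value for `i ≥ m` only makes `pt` total; it exists because `m ≥ 1`.
  let pt : ℕ → X := fun i => if h : i < m then x ⟨i, h⟩ else x ⟨0, hm⟩
  have hpt : ∀ i : Fin m, pt i = x i := fun i => by simp [pt]
  have hlen : (labelled f (List.ofFn x)).length = m := by simp [labelled]
  have hE : ∀ i < m, (labelled f (List.ofFn x))[i]? = some (pt i, f (pt i)) := by
    intro i hi
    simp [labelled, pt, hi]
  obtain ⟨τ, h1, h2⟩ := compressor_spec (E := ⟨labelled f (List.ofFn x), A, TA, TE,
    (m + d + e + 1) ^ 30⟩) hE hC hC' he hA hA' hf hm hTE rfl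
  obtain ⟨h3, h4, h5⟩ := h1.init
  have hex : ∃ p : PMF (Compressed X),
      (∀ z, p z = outputProb ⟨labelled f (List.ofFn x), A, 1, 1,
        ((labelled f (List.ofFn x)).length + d + e + 1) ^ 30⟩
        (compressor.init (labelled f (List.ofFn x)).length d e) z) ∧
      ∀ z ∈ p.support, z.1 ⊆ labelled f (List.ofFn x) ∧ z.1.length ≤ 2 ^ 28 * d * e ∧
        z.2.length ≤ 0 := by
    refine ⟨⟨_, h4 ▸ ENNReal.summable.hasSum⟩, fun z => ?_, fun z hz => ?_⟩
    · rw [hlen]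
      exact outputProb_congr_time _ _ _ _ _ _ _ _ _
    · obtain ⟨s, ⟨g1, g2, g3, -⟩, rfl⟩ := h5 z hz
      refine ⟨fun w hw => ?_, g2.trans (le_of_eq (by ring)), by simp [g3]⟩
      obtain ⟨i, hi, rfl⟩ := g1 w hw
      exact List.mem_of_getElem? (hE i hi)
  have happly : ∀ z, outputProb ⟨labelled f (List.ofFn x), A, TA, TE, (m + d + e + 1) ^ 30⟩
      (compressor.init m d e) z = compressorLaw A d e (labelled f (List.ofFn x)) z := by
    intro z
    rw [compressorLaw, dif_pos hex, hex.choose_spec.1 z, hlen]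
    exact outputProb_congr_time _ _ _ _ _ _ _ _ _
  refine ⟨happly, fun z hz i => ?_, h3.trans ?_⟩
  · rw [PMF.mem_support_iff, ← happly] at hz
    obtain ⟨s, ⟨-, -, -, g4⟩, rfl⟩ := h5 z hz
    have := g4 i i.2
    rwa [hpt i] at this
  · rw [← ENNReal.ofReal_natCast]
    exact ENNReal.ofReal_le_ofReal h2

end Prog

theorem theorem1 :
    ∃ (P : Prog) (b c c₁ c₂ c₃ : ℕ),
      ∀ (X : Type*) [MeasurableSpace X] (C : Set (X → Bool)) (d dstar : ℕ),
        vcDim C = d → vcDim (dualClass C) = dstar → 1 ≤ dstar →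
      ∀ A : Learner X, A.Proper C → A.Consistent C → A.PAC C →
      ∃ (s : ℕ) (κ : List (X × Bool) → PMF (Compressed X)) (ρ : Compressed X → X → Bool),
        (s : ℝ) ≤ c₂ * (((c₁ * d * dstar : ℕ) : ℝ) * Real.log ((c₁ * d * dstar : ℕ) : ℝ)) ∧
        IsRandomizedCompressionScheme C s κ ρ ∧
        ∀ TA TE : ℕ → ℕ, (∀ l, 1 ≤ TA l) → (∀ l, 1 ≤ TE l) →
        ∀ f ∈ C, ∀ (m : ℕ) (x : Fin m → X), 1 ≤ m →
          let S : List (X × Bool) := labelled f (List.ofFn x)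
          let E : Env X := ⟨S, A, TA, TE, (m + d + dstar + 1) ^ b⟩
          (∀ z, Prog.outputProb E (P.init m d dstar) z = κ S z) ∧
          Prog.expectedTime E (P.init m d dstar) ≤
            ENNReal.ofReal (c₃ * (((m : ℝ) + TA (c * d)) * Real.log m +
              (m : ℝ) * TE (c * d) * ((dstar : ℝ) + Real.log m))) := by
  -- Words lie below the 30th power, training samples have size `2 ^ 14 * d`, and `k = 2 ^ 28 * d *
  -- dstar` is the number `L * n` of points that may be kept. The size `k` itself meets the bound,
  -- so `c₂ = 1`.
  refine ⟨Prog.compressor, 30, 2 ^ 14, 2 ^ 28, 1, 10 ^ 6,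
    fun X _ C d e hC hC' he A hA hA' _ => ⟨2 ^ 28 * d * e, Prog.compressorLaw A d e,
      Prog.reconstruct A (2 ^ 14 * d) (2 ^ 14 * e), ?_,
      ⟨⟨2 ^ 28 * d * e, 0, le_rfl, fun S _ => Prog.compressorLaw_support A d e S⟩, ?_⟩, ?_⟩⟩
  · rw [Nat.cast_one, one_mul]
    rcases Nat.eq_zero_or_pos d with rfl | hd
    · simp
    · have h1 : 2 ^ 28 ≤ 2 ^ 28 * d * e := by
        rw [mul_assoc]
        exact Nat.le_mul_of_pos_right _ (Nat.mul_pos hd he)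
      refine le_mul_of_one_le_right (Nat.cast_nonneg _) ?_
      have h2 : (3 : ℝ) ≤ ((2 ^ 28 * d * e : ℕ) : ℝ) := by
        exact_mod_cast le_trans (by norm_num) h1
      rw [Real.le_log_iff_exp_le (by linarith)]
      have := Real.exp_one_lt_d9
      linarith
  · intro f hf xs hxs z hz x hx
    have h := (Prog.compressorLaw_apply hC hC' he hA hA' hf
      (List.length_pos_iff.2 hxs) xs.get 1 1 fun _ => le_rfl).2.1
    rw [List.ofFn_get] at h
    obtain ⟨i, rfl⟩ := List.get_of_mem hx
    exact h z hz i
  · intro TA TE _ hTE f hf m x hm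
    have h := Prog.compressorLaw_apply hC hC' he hA hA' hf hm x TA TE hTE
    exact ⟨h.1, h.2.2⟩
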